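/- Let $\phi=\frac{1+\sqrt5}{2}$ and let $\mathrm{Fib}$ be the Fibonacci category: the $\mathbb C$-linear semisimple braided tensor category with simple objects $\mathbf 1,\tau$, fusion rule $\tau\otimes\tau=\mathbf 1\oplus\tau$, and trivial associativity and braiding data except $$F^{\tau\tau\tau}_\tau=\begin{pmatrix}\phi^{-1}&\phi^{-1/2}\\ \phi^{-1/2}&-\phi^{-1}\end{pmatrix},\qquad R^{\tau\tau}_{\mathbf 1}=e^{-4\pi i/5},\quad R^{\tau\tau}_\tau=e^{3\pi i/5}.$$ For simple $a,b,c$ with $c\subset a\otimes b$ let $[ab\to c]:a\otimes b\to c$ and $[c\to ab]:c\to a\otimes b$ be the basis morphisms in which these data are expressed, so that $[ab\to c]\circ[c\to ab]=\mathrm{id}_c$. The unit isomorphisms are basis morphisms. Let $H=2+\tau$ denote the object $\mathbf 1_1\oplus\mathbf 1_2\oplus\tau$, where $\mathbf 1_1,\mathbf 1_2$ are two copies of $\mathbf 1$; we write $[xy\to z]$ and $[z\to xy]$ also when the entries are labelled summands, the numerals $1,2$ standing for $\mathbf 1_1,\mathbf 1_2$. Put $$V=-\tfrac{\phi^{-2}}2+\tfrac{5^{1/4}\phi^{-1/2}}2\,i,\qquad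 U=\frac{i\,\sqrt[4]{5\left(-9+4\sqrt5-i\sqrt{1525-682\sqrt5}\right)}}{2^{3/4}}\quad\text{(principal fourth root)}.$$ (1) The following morphisms make $H$ a Hopf algebra in $\mathrm{Fib}$. Multiplication $M:H\otimes H\to H$: $$\begin{aligned}M=\;&[11\to1]+[12\to2]+[21\to2]+[22\to1]+[\tau\tau\to1]-[\tau\tau\to2]\\&+[1\tau\to\tau]-[2\tau\to\tau]+[\tau1\to\tau]-[\tau2\to\tau]-\sqrt2\,\phi^{-3/4}[\tau\tau\to\tau].\end{aligned}$$ Comultiplication $\Delta:H\to H\otimes H$: $$\begin{aligned}\Delta=\;&[1\to11]-\tfrac1{2\phi}[2\to11]+\tfrac1{2\phi}[2\to12]+\tfrac1{2\phi}[2\to21]+\tfrac{\sqrt5}{2\phi}[2\to22]+V[2\to\tau\tau]\\&+\tfrac1{2\phi}[\tau\to1\tau]+\tfrac{\sqrt5}{2\phi}[\tau\to2\tau]+\tfrac1{2\phi}[\tau\to\tau1]+\tfrac{\sqrt5}{2\phi}[\tau\to\tau2]-U[\tau\to\tau\tau].\end{aligned}$$ The unit $\eta:\mathbf 1\to H$ is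 the inclusion of $\mathbf 1_1$. The counit $\epsilon:H\to\mathbf 1$ is the identity on each of $\mathbf 1_1,\mathbf 1_2$ and zero on $\tau$. The antipode is $$S=\mathrm{id}_{\mathbf 1_1}+\mathrm{id}_{\mathbf 1_2}-\left(\tfrac{\phi^{-1}}2+\tfrac{5^{1/4}\phi^{1/2}}2\,i\right)\mathrm{id}_\tau .$$ (2) This Hopf algebra structure is unique up to isomorphism: every Hopf algebra in $\mathrm{Fib}$ whose underlying object is isomorphic to $2+\tau$ is isomorphic, as a Hopf algebra, to $H$. (3) $H$ is neither commutative nor cocommutative (with respect to the braiding of $\mathrm{Fib}$). (4) There is a two-sided integral $\Lambda:\mathbf 1\to H$ with $\epsilon\circ\Lambda\ne0$, and $H$ is semisimple: every left $H$-module in $\mathrm{Fib}$ is a finite direct sum of simple modules. Nevertheless $S$ has order $10$ in $\mathrm{End}(H)$. (5) The following four left $H$-modules are simple and pairwise non-isomorphic, and every simple $H$-module is isomorphic to one of them: * $M_0=(\mathbf 1,\epsilon)$; * $M_1=(\tau,r_1)$ with $r_1=[1\tau\to\tau]+[2\tau\to\tau]$; * $M_2=(\tau,r_2)$ with $r_2=[1\tau\to\tau]-[2\tau\to\tau]+\sqrt2\,\phi^{1/4}[\tau\tau\to\tau]$;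 * $M_3=(\mathbf 1+\tau,r_3)$ with $r_3=[1\mathbf 1\to\mathbf 1]-[2\mathbf 1\to\mathbf 1]+[\tau\tau\to\mathbf 1]+[1\tau\to\tau]-[2\tau\to\tau]+2[\tau\mathbf 1\to\tau]-\sqrt[4]{4\sqrt5-8}\,[\tau\tau\to\tau]$. (6) The category of left $H$-modules in $\mathrm{Fib}$, with the tensor product given by $\Delta$ and the braiding, is equivalent to the Drinfeld center $\mathcal D(\mathrm{Fib})$ as a $\mathbb C$-linear monoidal category. -/

import Mathlib

open CategoryTheory MonoidalCategory

noncomputable section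

open scoped Matrix Kronecker

set_option synthInstance.maxSize 1000
set_option linter.unusedSectionVars false
set_option linter.unusedSimpArgs false

/-! ### The data of the Fibonacci category

The Fibonacci category has simple objects `𝟏`, `τ` with `τ ⊗ τ = 𝟏 ⊕ τ`. An object is recorded by
two finite index sets, its copies of `𝟏` and its copies of `τ`, and a morphism by two complex
matrices. All index bookkeeping for the tensor product is done in this section on pairs of types.
-/

namespace FibMat

/-- `φ⁻¹`, for the golden ratio `φ`. -/
def p : ℂ := ((Real.goldenRatio⁻¹ : ℝ) : ℂ)
/-- `φ^(-1/2)`. -/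
def q : ℂ := ((√(Real.goldenRatio⁻¹) : ℝ) : ℂ)

theorem p_mul_p : p * p = 1 - p := by
  have h : Real.goldenRatio⁻¹ * Real.goldenRatio⁻¹ = 1 - Real.goldenRatio⁻¹ := by
    rw [Real.inv_goldenRatio]
    have := Real.goldenConj_sq
    linear_combination this
  simp only [p]; exact_mod_cast h

theorem q_mul_q : q * q = p := by
  simp only [p, q]
  exact_mod_cast Real.mul_self_sqrt (inv_nonneg.2 Real.goldenRatio_pos.le)

/-- The braiding `τ ⊗ τ ⟶ τ ⊗ τ` on the summand `𝟏`. -/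
def R1 : ℂ := Complex.exp (-4 * Real.pi * Complex.I / 5)
/-- The braiding `τ ⊗ τ ⟶ τ ⊗ τ` on the summand `τ`. -/
def Rt : ℂ := Complex.exp (3 * Real.pi * Complex.I / 5)

theorem R1_eq : R1 = Rt * Rt := by
  rw [R1, Rt, ← Complex.exp_add]
  rw [show (3 * Real.pi * Complex.I / 5 + 3 * Real.pi * Complex.I / 5 : ℂ) =
    -4 * Real.pi * Complex.I / 5 + 2 * Real.pi * Complex.I by ring, Complex.exp_periodic]

theorem Rt_sq : Rt * Rt = -p * Rt - 1 := by
  have h0 : Real.cos (3 * Real.pi / 5) = -Real.goldenRatio⁻¹ / 2 := by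
    have h1 := Real.cos_pi_div_five
    have h2 : Real.cos (3 * Real.pi / 5) = -Real.cos (2 * (Real.pi / 5)) := by
      rw [← Real.cos_pi_sub]; congr 1; ring
    rw [h2, Real.cos_two_mul, h1, Real.inv_goldenRatio, Real.goldenConj]
    have := Real.mul_self_sqrt (show (0:ℝ) ≤ 5 by norm_num)
    linear_combination (-1/8) * this
  have h3 : Rt + Complex.exp (-(3 * Real.pi * Complex.I / 5)) = -p := by
    have h4 := Complex.two_cos (3 * Real.pi / 5 : ℂ)
    have h5 : Complex.cos (3 * Real.pi / 5 : ℂ) = ((-Real.goldenRatio⁻¹ / 2 : ℝ) : ℂ) := by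
      rw [← h0]; push_cast; rfl
    rw [h5] at h4
    rw [Rt, show (3 * Real.pi * Complex.I / 5 : ℂ) = 3 * Real.pi / 5 * Complex.I by ring,
      ← neg_mul, ← h4, p]
    push_cast; ring
  have h6 : Rt * Complex.exp (-(3 * Real.pi * Complex.I / 5)) = 1 := by
    rw [Rt, ← Complex.exp_add]; simp
  linear_combination Rt * h3 - h6

theorem R1_ne : R1 ≠ 0 := Complex.exp_ne_zero _
theorem Rt_ne : Rt ≠ 0 := Complex.exp_ne_zero _

/-- The copies of `𝟏` in `A ⊗ B`: those in `𝟏 ⊗ 𝟏` and those in `τ ⊗ τ`. -/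
abbrev T0 (A₀ A₁ B₀ B₁ : Type) : Type := A₀ × B₀ ⊕ A₁ × B₁
/-- The copies of `τ` in `A ⊗ B`: those in `𝟏 ⊗ τ`, in `τ ⊗ 𝟏` and in `τ ⊗ τ`. -/
abbrev T1 (A₀ A₁ B₀ B₁ : Type) : Type := A₀ × B₁ ⊕ A₁ × B₀ ⊕ A₁ × B₁

section Defs

variable {A₀ A₁ B₀ B₁ A₀' A₁' B₀' B₁' : Type}

/-- The `𝟏`-part of the tensor product of morphisms. -/
def ten0 (f₀ : Matrix A₀' A₀ ℂ) (f₁ : Matrix A₁' A₁ ℂ) (g₀ : Matrix B₀' B₀ ℂ)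
    (g₁ : Matrix B₁' B₁ ℂ) : Matrix (T0 A₀' A₁' B₀' B₁') (T0 A₀ A₁ B₀ B₁) ℂ :=
  Matrix.fromBlocks (f₀ ⊗ₖ g₀) 0 0 (f₁ ⊗ₖ g₁)

/-- The `τ`-part of the tensor product of morphisms. -/
def ten1 (f₀ : Matrix A₀' A₀ ℂ) (f₁ : Matrix A₁' A₁ ℂ) (g₀ : Matrix B₀' B₀ ℂ)
    (g₁ : Matrix B₁' B₁ ℂ) : Matrix (T1 A₀' A₁' B₀' B₁') (T1 A₀ A₁ B₀ B₁) ℂ :=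
  Matrix.fromBlocks (f₀ ⊗ₖ g₁) 0 0 (Matrix.fromBlocks (f₁ ⊗ₖ g₀) 0 0 (f₁ ⊗ₖ g₁))

variable (A₀ A₁ B₀ B₁) (C₀ C₁ : Type)
  [DecidableEq A₀] [DecidableEq A₁] [DecidableEq B₀] [DecidableEq B₁]
  [DecidableEq C₀] [DecidableEq C₁]

open Sum

/-- The `𝟏`-part of the associator `(A ⊗ B) ⊗ C ⟶ A ⊗ (B ⊗ C)`, given by its rows. All its
`F`-symbols are `1`. -/
def assoc0 : Matrix (T0 A₀ A₁ (T0 B₀ B₁ C₀ C₁) (T1 B₀ B₁ C₀ C₁))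
    (T0 (T0 A₀ A₁ B₀ B₁) (T1 A₀ A₁ B₀ B₁) C₀ C₁) ℂ
  | inl (a, inl (b, c)) => Pi.single (inl (inl (a, b), c)) 1
  | inl (a, inr (b, c)) => Pi.single (inr (inl (a, b), c)) 1
  | inr (a, inl (b, c)) => Pi.single (inr (inr (inl (a, b)), c)) 1
  | inr (a, inr (inl (b, c))) => Pi.single (inl (inr (a, b), c)) 1
  | inr (a, inr (inr (b, c))) => Pi.single (inr (inr (inr (a, b)), c)) 1

/-- The inverse of `assoc0`. -/
def assocInv0 : Matrix (T0 (T0 A₀ A₁ B₀ B₁) (T1 A₀ A₁ B₀ B₁) C₀ C₁)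
    (T0 A₀ A₁ (T0 B₀ B₁ C₀ C₁) (T1 B₀ B₁ C₀ C₁)) ℂ
  | inl (inl (a, b), c) => Pi.single (inl (a, inl (b, c))) 1
  | inr (inl (a, b), c) => Pi.single (inl (a, inr (b, c))) 1
  | inr (inr (inl (a, b)), c) => Pi.single (inr (a, inl (b, c))) 1
  | inl (inr (a, b), c) => Pi.single (inr (a, inr (inl (b, c)))) 1
  | inr (inr (inr (a, b)), c) => Pi.single (inr (a, inr (inr (b, c)))) 1

/-- The `τ`-part of the associator. On `(τ ⊗ τ) ⊗ τ` it is the `F`-matrix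
`((φ⁻¹, φ^(-1/2)), (φ^(-1/2), -φ⁻¹))` in the bases given by the intermediate summand `𝟏` or `τ`;
all other `F`-symbols are `1`. -/
def assoc1 : Matrix (T1 A₀ A₁ (T0 B₀ B₁ C₀ C₁) (T1 B₀ B₁ C₀ C₁))
    (T1 (T0 A₀ A₁ B₀ B₁) (T1 A₀ A₁ B₀ B₁) C₀ C₁) ℂ
  | inl (a, inl (b, c)) => Pi.single (inl (inl (a, b), c)) 1
  | inl (a, inr (inl (b, c))) => Pi.single (inr (inl (inl (a, b), c))) 1
  | inl (a, inr (inr (b, c))) => Pi.single (inr (inr (inl (a, b), c))) 1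
  | inr (inl (a, inl (b, c))) => Pi.single (inr (inl (inr (inl (a, b)), c))) 1
  | inr (inr (a, inl (b, c))) => Pi.single (inr (inr (inr (inl (a, b)), c))) 1
  | inr (inr (a, inr (inl (b, c)))) => Pi.single (inr (inl (inr (inr (a, b)), c))) 1
  | inr (inl (a, inr (b, c))) =>
      Pi.single (inl (inr (a, b), c)) p + Pi.single (inr (inr (inr (inr (a, b)), c))) (q)
  | inr (inr (a, inr (inr (b, c)))) =>
      Pi.single (inl (inr (a, b), c)) q + Pi.single (inr (inr (inr (inr (a, b)), c))) (-p)

/-- The inverse of `assoc1`. -/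
def assocInv1 : Matrix (T1 (T0 A₀ A₁ B₀ B₁) (T1 A₀ A₁ B₀ B₁) C₀ C₁)
    (T1 A₀ A₁ (T0 B₀ B₁ C₀ C₁) (T1 B₀ B₁ C₀ C₁)) ℂ
  | inl (inl (a, b), c) => Pi.single (inl (a, inl (b, c))) 1
  | inr (inl (inl (a, b), c)) => Pi.single (inl (a, inr (inl (b, c)))) 1
  | inr (inr (inl (a, b), c)) => Pi.single (inl (a, inr (inr (b, c)))) 1
  | inr (inl (inr (inl (a, b)), c)) => Pi.single (inr (inl (a, inl (b, c)))) 1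
  | inr (inr (inr (inl (a, b)), c)) => Pi.single (inr (inr (a, inl (b, c)))) 1
  | inr (inl (inr (inr (a, b)), c)) => Pi.single (inr (inr (a, inr (inl (b, c))))) 1
  | inl (inr (a, b), c) =>
      Pi.single (inr (inl (a, inr (b, c)))) p + Pi.single (inr (inr (a, inr (inr (b, c))))) (q)
  | inr (inr (inr (inr (a, b)), c)) =>
      Pi.single (inr (inl (a, inr (b, c)))) q + Pi.single (inr (inr (a, inr (inr (b, c))))) (-p)

/-- The `𝟏`-part of the braiding `A ⊗ B ⟶ B ⊗ A`, the scalar `r` standing on `τ ⊗ τ`. -/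
def braid0 (r : ℂ) : Matrix (T0 B₀ B₁ A₀ A₁) (T0 A₀ A₁ B₀ B₁) ℂ
  | inl (b, a) => Pi.single (inl (a, b)) 1
  | inr (b, a) => Pi.single (inr (a, b)) r

/-- The `τ`-part of the braiding `A ⊗ B ⟶ B ⊗ A`, the scalar `r` standing on `τ ⊗ τ`. -/
def braid1 (r : ℂ) : Matrix (T1 B₀ B₁ A₀ A₁) (T1 A₀ A₁ B₀ B₁) ℂ
  | inl (b, a) => Pi.single (inr (inl (a, b))) 1
  | inr (inl (b, a)) => Pi.single (inl (a, b)) 1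
  | inr (inr (b, a)) => Pi.single (inr (inr (a, b))) r

def lunit0 : Matrix A₀ (T0 Unit Empty A₀ A₁) ℂ
  | a => Pi.single (inl ((), a)) 1

def lunit1 : Matrix A₁ (T1 Unit Empty A₀ A₁) ℂ
  | a => Pi.single (inl ((), a)) 1

def lunitInv0 : Matrix (T0 Unit Empty A₀ A₁) A₀ ℂ
  | inl (_, a) => Pi.single a 1

def lunitInv1 : Matrix (T1 Unit Empty A₀ A₁) A₁ ℂ
  | inl (_, a) => Pi.single a 1

def runit0 : Matrix A₀ (T0 A₀ A₁ Unit Empty) ℂ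
  | a => Pi.single (inl (a, ())) 1

def runit1 : Matrix A₁ (T1 A₀ A₁ Unit Empty) ℂ
  | a => Pi.single (inr (inl (a, ()))) 1

def runitInv0 : Matrix (T0 A₀ A₁ Unit Empty) A₀ ℂ
  | inl (a, _) => Pi.single a 1

def runitInv1 : Matrix (T1 A₀ A₁ Unit Empty) A₁ ℂ
  | inr (inl (a, _)) => Pi.single a 1

end Defs

section Lemmas

open Sum Matrix

variable {A₀ A₁ B₀ B₁ C₀ C₁ D₀ D₁ A₀' A₁' B₀' B₁' C₀' C₁' : Type}
  [Fintype A₀] [Fintype A₁] [Fintype B₀] [Fintype B₁] [Fintype C₀] [Fintype C₁]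
  [Fintype D₀] [Fintype D₁]
  [DecidableEq A₀] [DecidableEq A₁] [DecidableEq B₀] [DecidableEq B₁]
  [DecidableEq C₀] [DecidableEq C₁] [DecidableEq D₀] [DecidableEq D₁]
  [Fintype A₀'] [Fintype A₁'] [Fintype B₀'] [Fintype B₁'] [Fintype C₀'] [Fintype C₁']
  [DecidableEq A₀'] [DecidableEq A₁'] [DecidableEq B₀'] [DecidableEq B₁']
  [DecidableEq C₀'] [DecidableEq C₁']

theorem ext_act {a b : Type} [Fintype a] {M N : Matrix b a ℂ}
    (h : ∀ v i, (M *ᵥ v) i = (N *ᵥ v) i) : M = N :=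
  Matrix.ext_iff_mulVec.2 fun v => funext (h v)

theorem kron_act {a b c d : Type} [Fintype a] [Fintype b]
    (A : Matrix c a ℂ) (B : Matrix d b ℂ) (v : a × b → ℂ) (i : c) (j : d) :
    ((A ⊗ₖ B) *ᵥ v) (i, j) = (A *ᵥ fun x => (B *ᵥ fun y => v (x, y)) j) i := by
  simp [Matrix.mulVec, dotProduct, Fintype.sum_prod_type, Finset.mul_sum, mul_assoc]

theorem act_comb {a b : Type} [Fintype a] (M : Matrix b a ℂ) (s t : ℂ) (u w : a → ℂ) (i : b) :
    (M *ᵥ fun x => s * u x + t * w x) i = s * (M *ᵥ u) i + t * (M *ᵥ w) i := by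
  simp [mulVec, dotProduct, Finset.mul_sum, mul_add, Finset.sum_add_distrib, mul_left_comm]

theorem act_scal {a b : Type} [Fintype a] (M : Matrix b a ℂ) (s : ℂ) (u : a → ℂ) (i : b) :
    (M *ᵥ fun x => s * u x) i = s * (M *ᵥ u) i := by
  simp [mulVec, dotProduct, Finset.mul_sum, mul_left_comm]

theorem ten_act (f₀ : Matrix A₀' A₀ ℂ) (f₁ : Matrix A₁' A₁ ℂ) (g₀ : Matrix B₀' B₀ ℂ)
    (g₁ : Matrix B₁' B₁ ℂ) :
    (∀ v i j, (ten0 f₀ f₁ g₀ g₁ *ᵥ v) (inl (i, j)) =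
      (f₀ *ᵥ fun x => (g₀ *ᵥ fun y => v (inl (x, y))) j) i) ∧
    (∀ v i j, (ten0 f₀ f₁ g₀ g₁ *ᵥ v) (inr (i, j)) =
      (f₁ *ᵥ fun x => (g₁ *ᵥ fun y => v (inr (x, y))) j) i) ∧
    (∀ v i j, (ten1 f₀ f₁ g₀ g₁ *ᵥ v) (inl (i, j)) =
      (f₀ *ᵥ fun x => (g₁ *ᵥ fun y => v (inl (x, y))) j) i) ∧
    (∀ v i j, (ten1 f₀ f₁ g₀ g₁ *ᵥ v) (inr (inl (i, j))) =
      (f₁ *ᵥ fun x => (g₀ *ᵥ fun y => v (inr (inl (x, y)))) j) i) ∧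
    (∀ v i j, (ten1 f₀ f₁ g₀ g₁ *ᵥ v) (inr (inr (i, j))) =
      (f₁ *ᵥ fun x => (g₁ *ᵥ fun y => v (inr (inr (x, y)))) j) i) := by
  refine ⟨?_, ?_, ?_, ?_, ?_⟩ <;> intros <;> simp [ten0, ten1, fromBlocks_mulVec, kron_act]

theorem act_swap {a b c d : Type} [Fintype a] [Fintype b] (M : Matrix c a ℂ) (N : Matrix d b ℂ)
    (v : a → b → ℂ) (i : c) (j : d) :
    (M *ᵥ fun x => (N *ᵥ fun y => v x y) j) i = (N *ᵥ fun y => (M *ᵥ fun x => v x y) i) j := by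
  simp only [mulVec, dotProduct, Finset.mul_sum]
  rw [Finset.sum_comm]
  exact Finset.sum_congr rfl fun _ _ => Finset.sum_congr rfl fun _ _ => mul_left_comm _ _ _

theorem assoc_act :
    (∀ (v : T0 (T0 A₀ A₁ B₀ B₁) (T1 A₀ A₁ B₀ B₁) C₀ C₁ → ℂ) (a b c), (assoc0 A₀ A₁ B₀ B₁ C₀ C₁ *ᵥ v) (inl (a, inl (b, c))) = v (inl (inl (a, b), c))) ∧
    (∀ (v : T0 (T0 A₀ A₁ B₀ B₁) (T1 A₀ A₁ B₀ B₁) C₀ C₁ → ℂ) (a b c), (assoc0 A₀ A₁ B₀ B₁ C₀ C₁ *ᵥ v) (inl (a, inr (b, c))) = v (inr (inl (a, b), c))) ∧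
    (∀ (v : T0 (T0 A₀ A₁ B₀ B₁) (T1 A₀ A₁ B₀ B₁) C₀ C₁ → ℂ) (a b c), (assoc0 A₀ A₁ B₀ B₁ C₀ C₁ *ᵥ v) (inr (a, inl (b, c))) = v (inr (inr (inl (a, b)), c))) ∧
    (∀ (v : T0 (T0 A₀ A₁ B₀ B₁) (T1 A₀ A₁ B₀ B₁) C₀ C₁ → ℂ) (a b c), (assoc0 A₀ A₁ B₀ B₁ C₀ C₁ *ᵥ v) (inr (a, inr (inl (b, c)))) = v (inl (inr (a, b), c))) ∧
    (∀ (v : T0 (T0 A₀ A₁ B₀ B₁) (T1 A₀ A₁ B₀ B₁) C₀ C₁ → ℂ) (a b c), (assoc0 A₀ A₁ B₀ B₁ C₀ C₁ *ᵥ v) (inr (a, inr (inr (b, c)))) = v (inr (inr (inr (a, b)), c))) ∧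
    (∀ (w : T1 (T0 A₀ A₁ B₀ B₁) (T1 A₀ A₁ B₀ B₁) C₀ C₁ → ℂ) (a b c), (assoc1 A₀ A₁ B₀ B₁ C₀ C₁ *ᵥ w) (inl (a, inl (b, c))) = w (inl (inl (a, b), c))) ∧
    (∀ (w : T1 (T0 A₀ A₁ B₀ B₁) (T1 A₀ A₁ B₀ B₁) C₀ C₁ → ℂ) (a b c), (assoc1 A₀ A₁ B₀ B₁ C₀ C₁ *ᵥ w) (inl (a, inr (inl (b, c)))) = w (inr (inl (inl (a, b), c)))) ∧
    (∀ (w : T1 (T0 A₀ A₁ B₀ B₁) (T1 A₀ A₁ B₀ B₁) C₀ C₁ → ℂ) (a b c), (assoc1 A₀ A₁ B₀ B₁ C₀ C₁ *ᵥ w) (inl (a, inr (inr (b, c)))) = w (inr (inr (inl (a, b), c)))) ∧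
    (∀ (w : T1 (T0 A₀ A₁ B₀ B₁) (T1 A₀ A₁ B₀ B₁) C₀ C₁ → ℂ) (a b c), (assoc1 A₀ A₁ B₀ B₁ C₀ C₁ *ᵥ w) (inr (inl (a, inl (b, c)))) = w (inr (inl (inr (inl (a, b)), c)))) ∧
    (∀ (w : T1 (T0 A₀ A₁ B₀ B₁) (T1 A₀ A₁ B₀ B₁) C₀ C₁ → ℂ) (a b c), (assoc1 A₀ A₁ B₀ B₁ C₀ C₁ *ᵥ w) (inr (inr (a, inl (b, c)))) = w (inr (inr (inr (inl (a, b)), c)))) ∧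
    (∀ (w : T1 (T0 A₀ A₁ B₀ B₁) (T1 A₀ A₁ B₀ B₁) C₀ C₁ → ℂ) (a b c), (assoc1 A₀ A₁ B₀ B₁ C₀ C₁ *ᵥ w) (inr (inr (a, inr (inl (b, c))))) = w (inr (inl (inr (inr (a, b)), c)))) ∧
    (∀ (w : T1 (T0 A₀ A₁ B₀ B₁) (T1 A₀ A₁ B₀ B₁) C₀ C₁ → ℂ) (a b c), (assoc1 A₀ A₁ B₀ B₁ C₀ C₁ *ᵥ w) (inr (inl (a, inr (b, c)))) = p * w (inl (inr (a, b), c)) + q * w (inr (inr (inr (inr (a, b)), c)))) ∧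
    (∀ (w : T1 (T0 A₀ A₁ B₀ B₁) (T1 A₀ A₁ B₀ B₁) C₀ C₁ → ℂ) (a b c), (assoc1 A₀ A₁ B₀ B₁ C₀ C₁ *ᵥ w) (inr (inr (a, inr (inr (b, c))))) = q * w (inl (inr (a, b), c)) + (-p) * w (inr (inr (inr (inr (a, b)), c)))) :=
  ⟨fun _ _ _ _ => (single_dotProduct _ _ _).trans (one_mul _),
    fun _ _ _ _ => (single_dotProduct _ _ _).trans (one_mul _),
    fun _ _ _ _ => (single_dotProduct _ _ _).trans (one_mul _),
    fun _ _ _ _ => (single_dotProduct _ _ _).trans (one_mul _),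
    fun _ _ _ _ => (single_dotProduct _ _ _).trans (one_mul _),
    fun _ _ _ _ => (single_dotProduct _ _ _).trans (one_mul _),
    fun _ _ _ _ => (single_dotProduct _ _ _).trans (one_mul _),
    fun _ _ _ _ => (single_dotProduct _ _ _).trans (one_mul _),
    fun _ _ _ _ => (single_dotProduct _ _ _).trans (one_mul _),
    fun _ _ _ _ => (single_dotProduct _ _ _).trans (one_mul _),
    fun _ _ _ _ => (single_dotProduct _ _ _).trans (one_mul _),
    fun _ _ _ _ => (add_dotProduct _ _ _).trans
    (congrArg₂ _ (single_dotProduct _ _ _) (single_dotProduct _ _ _)),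
    fun _ _ _ _ => (add_dotProduct _ _ _).trans
    (congrArg₂ _ (single_dotProduct _ _ _) (single_dotProduct _ _ _))⟩

theorem assocInv_act :
    (∀ (v' : T0 A₀ A₁ (T0 B₀ B₁ C₀ C₁) (T1 B₀ B₁ C₀ C₁) → ℂ) (a b c), (assocInv0 A₀ A₁ B₀ B₁ C₀ C₁ *ᵥ v') (inl (inl (a, b), c)) = v' (inl (a, inl (b, c)))) ∧
    (∀ (v' : T0 A₀ A₁ (T0 B₀ B₁ C₀ C₁) (T1 B₀ B₁ C₀ C₁) → ℂ) (a b c), (assocInv0 A₀ A₁ B₀ B₁ C₀ C₁ *ᵥ v') (inr (inl (a, b), c)) = v' (inl (a, inr (b, c)))) ∧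
    (∀ (v' : T0 A₀ A₁ (T0 B₀ B₁ C₀ C₁) (T1 B₀ B₁ C₀ C₁) → ℂ) (a b c), (assocInv0 A₀ A₁ B₀ B₁ C₀ C₁ *ᵥ v') (inr (inr (inl (a, b)), c)) = v' (inr (a, inl (b, c)))) ∧
    (∀ (v' : T0 A₀ A₁ (T0 B₀ B₁ C₀ C₁) (T1 B₀ B₁ C₀ C₁) → ℂ) (a b c), (assocInv0 A₀ A₁ B₀ B₁ C₀ C₁ *ᵥ v') (inl (inr (a, b), c)) = v' (inr (a, inr (inl (b, c))))) ∧
    (∀ (v' : T0 A₀ A₁ (T0 B₀ B₁ C₀ C₁) (T1 B₀ B₁ C₀ C₁) → ℂ) (a b c), (assocInv0 A₀ A₁ B₀ B₁ C₀ C₁ *ᵥ v') (inr (inr (inr (a, b)), c)) = v' (inr (a, inr (inr (b, c))))) ∧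
    (∀ (w' : T1 A₀ A₁ (T0 B₀ B₁ C₀ C₁) (T1 B₀ B₁ C₀ C₁) → ℂ) (a b c), (assocInv1 A₀ A₁ B₀ B₁ C₀ C₁ *ᵥ w') (inl (inl (a, b), c)) = w' (inl (a, inl (b, c)))) ∧
    (∀ (w' : T1 A₀ A₁ (T0 B₀ B₁ C₀ C₁) (T1 B₀ B₁ C₀ C₁) → ℂ) (a b c), (assocInv1 A₀ A₁ B₀ B₁ C₀ C₁ *ᵥ w') (inr (inl (inl (a, b), c))) = w' (inl (a, inr (inl (b, c))))) ∧
    (∀ (w' : T1 A₀ A₁ (T0 B₀ B₁ C₀ C₁) (T1 B₀ B₁ C₀ C₁) → ℂ) (a b c), (assocInv1 A₀ A₁ B₀ B₁ C₀ C₁ *ᵥ w') (inr (inr (inl (a, b), c))) = w' (inl (a, inr (inr (b, c))))) ∧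
    (∀ (w' : T1 A₀ A₁ (T0 B₀ B₁ C₀ C₁) (T1 B₀ B₁ C₀ C₁) → ℂ) (a b c), (assocInv1 A₀ A₁ B₀ B₁ C₀ C₁ *ᵥ w') (inr (inl (inr (inl (a, b)), c))) = w' (inr (inl (a, inl (b, c))))) ∧
    (∀ (w' : T1 A₀ A₁ (T0 B₀ B₁ C₀ C₁) (T1 B₀ B₁ C₀ C₁) → ℂ) (a b c), (assocInv1 A₀ A₁ B₀ B₁ C₀ C₁ *ᵥ w') (inr (inr (inr (inl (a, b)), c))) = w' (inr (inr (a, inl (b, c))))) ∧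
    (∀ (w' : T1 A₀ A₁ (T0 B₀ B₁ C₀ C₁) (T1 B₀ B₁ C₀ C₁) → ℂ) (a b c), (assocInv1 A₀ A₁ B₀ B₁ C₀ C₁ *ᵥ w') (inr (inl (inr (inr (a, b)), c))) = w' (inr (inr (a, inr (inl (b, c)))))) ∧
    (∀ (w' : T1 A₀ A₁ (T0 B₀ B₁ C₀ C₁) (T1 B₀ B₁ C₀ C₁) → ℂ) (a b c), (assocInv1 A₀ A₁ B₀ B₁ C₀ C₁ *ᵥ w') (inl (inr (a, b), c)) = p * w' (inr (inl (a, inr (b, c)))) + q * w' (inr (inr (a, inr (inr (b, c)))))) ∧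
    (∀ (w' : T1 A₀ A₁ (T0 B₀ B₁ C₀ C₁) (T1 B₀ B₁ C₀ C₁) → ℂ) (a b c), (assocInv1 A₀ A₁ B₀ B₁ C₀ C₁ *ᵥ w') (inr (inr (inr (inr (a, b)), c))) = q * w' (inr (inl (a, inr (b, c)))) + (-p) * w' (inr (inr (a, inr (inr (b, c)))))) :=
  ⟨fun _ _ _ _ => (single_dotProduct _ _ _).trans (one_mul _),
    fun _ _ _ _ => (single_dotProduct _ _ _).trans (one_mul _),
    fun _ _ _ _ => (single_dotProduct _ _ _).trans (one_mul _),
    fun _ _ _ _ => (single_dotProduct _ _ _).trans (one_mul _),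
    fun _ _ _ _ => (single_dotProduct _ _ _).trans (one_mul _),
    fun _ _ _ _ => (single_dotProduct _ _ _).trans (one_mul _),
    fun _ _ _ _ => (single_dotProduct _ _ _).trans (one_mul _),
    fun _ _ _ _ => (single_dotProduct _ _ _).trans (one_mul _),
    fun _ _ _ _ => (single_dotProduct _ _ _).trans (one_mul _),
    fun _ _ _ _ => (single_dotProduct _ _ _).trans (one_mul _),
    fun _ _ _ _ => (single_dotProduct _ _ _).trans (one_mul _),
    fun _ _ _ _ => (add_dotProduct _ _ _).trans
    (congrArg₂ _ (single_dotProduct _ _ _) (single_dotProduct _ _ _)),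
    fun _ _ _ _ => (add_dotProduct _ _ _).trans
    (congrArg₂ _ (single_dotProduct _ _ _) (single_dotProduct _ _ _))⟩

theorem braid_act (r : ℂ) :
    (∀ (x : T0 A₀ A₁ B₀ B₁ → ℂ) (a b), (braid0 A₀ A₁ B₀ B₁ r *ᵥ x) (inl (b, a)) = x (inl (a, b))) ∧
    (∀ (x : T0 A₀ A₁ B₀ B₁ → ℂ) (a b), (braid0 A₀ A₁ B₀ B₁ r *ᵥ x) (inr (b, a)) = r * x (inr (a, b))) ∧
    (∀ (y : T1 A₀ A₁ B₀ B₁ → ℂ) (a b), (braid1 A₀ A₁ B₀ B₁ r *ᵥ y) (inl (b, a)) = y (inr (inl (a, b)))) ∧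
    (∀ (y : T1 A₀ A₁ B₀ B₁ → ℂ) (a b), (braid1 A₀ A₁ B₀ B₁ r *ᵥ y) (inr (inl (b, a))) = y (inl (a, b))) ∧
    (∀ (y : T1 A₀ A₁ B₀ B₁ → ℂ) (a b), (braid1 A₀ A₁ B₀ B₁ r *ᵥ y) (inr (inr (b, a))) = r * y (inr (inr (a, b)))) :=
  ⟨fun _ _ _ => (single_dotProduct _ _ _).trans (one_mul _),
    fun _ _ _ => single_dotProduct _ _ _,
    fun _ _ _ => (single_dotProduct _ _ _).trans (one_mul _),
    fun _ _ _ => (single_dotProduct _ _ _).trans (one_mul _),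
    fun _ _ _ => single_dotProduct _ _ _⟩

theorem unit_act :
    (∀ (z : T0 Unit Empty A₀ A₁ → ℂ) (a), (lunit0 A₀ A₁ *ᵥ z) a = z (inl ((), a))) ∧
    (∀ (z : A₀ → ℂ) (u a), (lunitInv0 A₀ A₁ *ᵥ z) (inl (u, a)) = z a) ∧
    (∀ (z : T0 A₀ A₁ Unit Empty → ℂ) (a), (runit0 A₀ A₁ *ᵥ z) a = z (inl (a, ()))) ∧
    (∀ (z : A₀ → ℂ) (u a), (runitInv0 A₀ A₁ *ᵥ z) (inl (a, u)) = z a) ∧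
    (∀ (z : T1 Unit Empty A₀ A₁ → ℂ) (a), (lunit1 A₀ A₁ *ᵥ z) a = z (inl ((), a))) ∧
    (∀ (z : A₁ → ℂ) (u a), (lunitInv1 A₀ A₁ *ᵥ z) (inl (u, a)) = z a) ∧
    (∀ (z : T1 A₀ A₁ Unit Empty → ℂ) (a), (runit1 A₀ A₁ *ᵥ z) a = z (inr (inl (a, ())))) ∧
    (∀ (z : A₁ → ℂ) (u a), (runitInv1 A₀ A₁ *ᵥ z) (inr (inl (a, u))) = z a) :=
  ⟨fun _ _ => (single_dotProduct _ _ _).trans (one_mul _),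
    fun _ _ _ => (single_dotProduct _ _ _).trans (one_mul _),
    fun _ _ => (single_dotProduct _ _ _).trans (one_mul _),
    fun _ _ _ => (single_dotProduct _ _ _).trans (one_mul _),
    fun _ _ => (single_dotProduct _ _ _).trans (one_mul _),
    fun _ _ _ => (single_dotProduct _ _ _).trans (one_mul _),
    fun _ _ => (single_dotProduct _ _ _).trans (one_mul _),
    fun _ _ _ => (single_dotProduct _ _ _).trans (one_mul _)⟩

theorem ten_id0 :
    ten0 (1 : Matrix A₀ A₀ ℂ) (1 : Matrix A₁ A₁ ℂ) (1 : Matrix B₀ B₀ ℂ) (1 : Matrix B₁ B₁ ℂ) =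
    1 := by
  refine ext_act fun v i => ?_
  rcases i with (⟨a, b⟩ | ⟨a, b⟩)
  all_goals simp only [act_comb, act_scal, one_mulVec, ← mulVec_mulVec, ten_act, assoc_act, assocInv_act, braid_act, unit_act]

theorem ten_comp0 {X₀ X₁ Y₀ Y₁ : Type} (f₀ : Matrix A₀' A₀ ℂ) (f₁ : Matrix A₁' A₁ ℂ)(g₀ : Matrix B₀' B₀ ℂ) (g₁ : Matrix B₁' B₁ ℂ)(f₀' : Matrix X₀ A₀' ℂ) (f₁' : Matrix X₁ A₁' ℂ) (g₀' : Matrix Y₀ B₀' ℂ) (g₁' : Matrix Y₁ B₁' ℂ) :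
    ten0 f₀' f₁' g₀' g₁' * ten0 f₀ f₁ g₀ g₁ =
    ten0 (f₀' * f₀) (f₁' * f₁) (g₀' * g₀) (g₁' * g₁) := by
  simp [ten0, ten1, fromBlocks_multiply, mul_kronecker_mul]

theorem assoc_inv0 :
    assocInv0 A₀ A₁ B₀ B₁ C₀ C₁ * assoc0 A₀ A₁ B₀ B₁ C₀ C₁ =
    1 := by
  refine ext_act fun v i => ?_
  rcases i with (⟨(⟨a, b⟩ | ⟨a, b⟩), c⟩ | ⟨(⟨a, b⟩ | ⟨a, b⟩ | ⟨a, b⟩), c⟩)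
  all_goals simp only [act_comb, act_scal, one_mulVec, ← mulVec_mulVec, ten_act, assoc_act, assocInv_act, braid_act, unit_act]

theorem inv_assoc0 :
    assoc0 A₀ A₁ B₀ B₁ C₀ C₁ * assocInv0 A₀ A₁ B₀ B₁ C₀ C₁ =
    1 := by
  refine ext_act fun v i => ?_
  rcases i with (⟨a, (⟨b, c⟩ | ⟨b, c⟩)⟩ | ⟨a, (⟨b, c⟩ | ⟨b, c⟩ | ⟨b, c⟩)⟩)
  all_goals simp only [act_comb, act_scal, one_mulVec, ← mulVec_mulVec, ten_act, assoc_act, assocInv_act, braid_act, unit_act]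

theorem assoc_nat0 (f₀ : Matrix A₀' A₀ ℂ) (f₁ : Matrix A₁' A₁ ℂ)(g₀ : Matrix B₀' B₀ ℂ) (g₁ : Matrix B₁' B₁ ℂ)(h₀ : Matrix C₀' C₀ ℂ) (h₁ : Matrix C₁' C₁ ℂ) :
    assoc0 A₀' A₁' B₀' B₁' C₀' C₁' * ten0 (ten0 f₀ f₁ g₀ g₁) (ten1 f₀ f₁ g₀ g₁) h₀ h₁ =
    ten0 f₀ f₁ (ten0 g₀ g₁ h₀ h₁) (ten1 g₀ g₁ h₀ h₁) * assoc0 A₀ A₁ B₀ B₁ C₀ C₁ := by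
  refine ext_act fun v i => ?_
  rcases i with (⟨a, (⟨b, c⟩ | ⟨b, c⟩)⟩ | ⟨a, (⟨b, c⟩ | ⟨b, c⟩ | ⟨b, c⟩)⟩)
  all_goals simp only [act_comb, act_scal, one_mulVec, ← mulVec_mulVec, ten_act, assoc_act, assocInv_act, braid_act, unit_act]

theorem pentagon0 :
    ten0 (1 : Matrix A₀ A₀ ℂ) (1 : Matrix A₁ A₁ ℂ) (assoc0 B₀ B₁ C₀ C₁ D₀ D₁) (assoc1 B₀ B₁ C₀ C₁ D₀ D₁) * assoc0 A₀ A₁ (T0 B₀ B₁ C₀ C₁) (T1 B₀ B₁ C₀ C₁) D₀ D₁ *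
      ten0 (assoc0 A₀ A₁ B₀ B₁ C₀ C₁) (assoc1 A₀ A₁ B₀ B₁ C₀ C₁) (1 : Matrix D₀ D₀ ℂ) (1 : Matrix D₁ D₁ ℂ) =
    assoc0 A₀ A₁ B₀ B₁ (T0 C₀ C₁ D₀ D₁) (T1 C₀ C₁ D₀ D₁) * assoc0 (T0 A₀ A₁ B₀ B₁) (T1 A₀ A₁ B₀ B₁) C₀ C₁ D₀ D₁ := by
  refine ext_act fun v i => ?_
  rcases i with (⟨a, (⟨b, (⟨c, d⟩ | ⟨c, d⟩)⟩ | ⟨b, (⟨c, d⟩ | ⟨c, d⟩ | ⟨c, d⟩)⟩)⟩ | ⟨a, (⟨b, (⟨c, d⟩ | ⟨c, d⟩ | ⟨c, d⟩)⟩ | ⟨b, (⟨c, d⟩ | ⟨c, d⟩)⟩ | ⟨b, (⟨c, d⟩ | ⟨c, d⟩ | ⟨c, d⟩)⟩)⟩)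
  all_goals simp only [act_comb, act_scal, one_mulVec, ← mulVec_mulVec, ten_act, assoc_act, assocInv_act, braid_act, unit_act]
  all_goals grind [p_mul_p, q_mul_q]

theorem lunit_nat0 (f₀ : Matrix A₀' A₀ ℂ) (f₁ : Matrix A₁' A₁ ℂ) :
    lunit0 A₀' A₁' * ten0 (1 : Matrix Unit Unit ℂ) (1 : Matrix Empty Empty ℂ) f₀ f₁ =
    f₀ * lunit0 A₀ A₁ := by
  refine ext_act fun v i => ?_
  simp only [act_comb, act_scal, one_mulVec, ← mulVec_mulVec, ten_act, assoc_act, assocInv_act, braid_act, unit_act]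
  congr 2; funext a; simp only [unit_act]

theorem runit_nat0 (f₀ : Matrix A₀' A₀ ℂ) (f₁ : Matrix A₁' A₁ ℂ) :
    runit0 A₀' A₁' * ten0 f₀ f₁ (1 : Matrix Unit Unit ℂ) (1 : Matrix Empty Empty ℂ) =
    f₀ * runit0 A₀ A₁ := by
  refine ext_act fun v i => ?_
  simp only [act_comb, act_scal, one_mulVec, ← mulVec_mulVec, ten_act, assoc_act, assocInv_act, braid_act, unit_act]
  congr 2; funext a; simp only [unit_act]

theorem lunit_inv0 :
    lunit0 A₀ A₁ * lunitInv0 A₀ A₁ =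
    1 := by
  refine ext_act fun v i => ?_
  simp only [act_comb, act_scal, one_mulVec, ← mulVec_mulVec, ten_act, assoc_act, assocInv_act, braid_act, unit_act]

theorem runit_inv0 :
    runit0 A₀ A₁ * runitInv0 A₀ A₁ =
    1 := by
  refine ext_act fun v i => ?_
  simp only [act_comb, act_scal, one_mulVec, ← mulVec_mulVec, ten_act, assoc_act, assocInv_act, braid_act, unit_act]

theorem inv_lunit0 :
    lunitInv0 A₀ A₁ * lunit0 A₀ A₁ =
    1 := by
  refine ext_act fun v i => ?_
  rcases i with (⟨⟨⟩, a⟩ | ⟨⟨⟩, a⟩)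
  all_goals simp only [act_comb, act_scal, one_mulVec, ← mulVec_mulVec, ten_act, assoc_act, assocInv_act, braid_act, unit_act]

theorem inv_runit0 :
    runitInv0 A₀ A₁ * runit0 A₀ A₁ =
    1 := by
  refine ext_act fun v i => ?_
  rcases i with (⟨a, ⟨⟩⟩ | ⟨a, ⟨⟩⟩)
  all_goals simp only [act_comb, act_scal, one_mulVec, ← mulVec_mulVec, ten_act, assoc_act, assocInv_act, braid_act, unit_act]

theorem triangle0 :
    ten0 (1 : Matrix A₀ A₀ ℂ) (1 : Matrix A₁ A₁ ℂ) (lunit0 B₀ B₁) (lunit1 B₀ B₁) * assoc0 A₀ A₁ Unit Empty B₀ B₁ =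
    ten0 (runit0 A₀ A₁) (runit1 A₀ A₁) (1 : Matrix B₀ B₀ ℂ) (1 : Matrix B₁ B₁ ℂ) := by
  refine ext_act fun v i => ?_
  rcases i with (⟨a, b⟩ | ⟨a, b⟩)
  all_goals simp only [act_comb, act_scal, one_mulVec, ← mulVec_mulVec, ten_act, assoc_act, assocInv_act, braid_act, unit_act]

theorem braid_nat0 (r : ℂ) (f₀ : Matrix A₀' A₀ ℂ) (f₁ : Matrix A₁' A₁ ℂ)(g₀ : Matrix B₀' B₀ ℂ) (g₁ : Matrix B₁' B₁ ℂ) :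
    braid0 A₀' A₁' B₀' B₁' r * ten0 f₀ f₁ g₀ g₁ =
    ten0 g₀ g₁ f₀ f₁ * braid0 A₀ A₁ B₀ B₁ r := by
  refine ext_act fun v i => ?_
  rcases i with (⟨b, a⟩ | ⟨b, a⟩)
  all_goals simp only [act_comb, act_scal, one_mulVec, ← mulVec_mulVec, ten_act, assoc_act, assocInv_act, braid_act, unit_act]
  all_goals rw [act_swap]

theorem braid_inv0 (r s : ℂ) (hrs : r * s = 1) :
    braid0 B₀ B₁ A₀ A₁ s * braid0 A₀ A₁ B₀ B₁ r =
    1 := by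
  refine ext_act fun v i => ?_
  rcases i with (⟨a, b⟩ | ⟨a, b⟩)
  all_goals simp only [act_comb, act_scal, one_mulVec, ← mulVec_mulVec, ten_act, assoc_act, assocInv_act, braid_act, unit_act]
  all_goals grind

theorem hexf0 :
    assoc0 B₀ B₁ C₀ C₁ A₀ A₁ * braid0 A₀ A₁ (T0 B₀ B₁ C₀ C₁) (T1 B₀ B₁ C₀ C₁) R1 * assoc0 A₀ A₁ B₀ B₁ C₀ C₁ =
    ten0 (1 : Matrix B₀ B₀ ℂ) (1 : Matrix B₁ B₁ ℂ) (braid0 A₀ A₁ C₀ C₁ R1) (braid1 A₀ A₁ C₀ C₁ Rt) * assoc0 B₀ B₁ A₀ A₁ C₀ C₁ * ten0 (braid0 A₀ A₁ B₀ B₁ R1) (braid1 A₀ A₁ B₀ B₁ Rt) (1 : Matrix C₀ C₀ ℂ) (1 : Matrix C₁ C₁ ℂ) := by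
  refine ext_act fun v i => ?_
  rcases i with (⟨b, (⟨c, a⟩ | ⟨c, a⟩)⟩ | ⟨b, (⟨c, a⟩ | ⟨c, a⟩ | ⟨c, a⟩)⟩)
  all_goals simp only [act_comb, act_scal, one_mulVec, ← mulVec_mulVec, ten_act, assoc_act, assocInv_act, braid_act, unit_act]
  all_goals grind [p_mul_p, q_mul_q, R1_eq, Rt_sq]

theorem hexr0 :
    assocInv0 C₀ C₁ A₀ A₁ B₀ B₁ * braid0 (T0 A₀ A₁ B₀ B₁) (T1 A₀ A₁ B₀ B₁) C₀ C₁ R1 * assocInv0 A₀ A₁ B₀ B₁ C₀ C₁ =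
    ten0 (braid0 A₀ A₁ C₀ C₁ R1) (braid1 A₀ A₁ C₀ C₁ Rt) (1 : Matrix B₀ B₀ ℂ) (1 : Matrix B₁ B₁ ℂ) * assocInv0 A₀ A₁ C₀ C₁ B₀ B₁ * ten0 (1 : Matrix A₀ A₀ ℂ) (1 : Matrix A₁ A₁ ℂ) (braid0 B₀ B₁ C₀ C₁ R1) (braid1 B₀ B₁ C₀ C₁ Rt) := by
  refine ext_act fun v i => ?_
  rcases i with (⟨(⟨c, a⟩ | ⟨c, a⟩), b⟩ | ⟨(⟨c, a⟩ | ⟨c, a⟩ | ⟨c, a⟩), b⟩)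
  all_goals simp only [act_comb, act_scal, one_mulVec, ← mulVec_mulVec, ten_act, assoc_act, assocInv_act, braid_act, unit_act]
  all_goals grind [p_mul_p, q_mul_q, R1_eq, Rt_sq]

theorem ten_id1 :
    ten1 (1 : Matrix A₀ A₀ ℂ) (1 : Matrix A₁ A₁ ℂ) (1 : Matrix B₀ B₀ ℂ) (1 : Matrix B₁ B₁ ℂ) =
    1 := by
  refine ext_act fun v i => ?_
  rcases i with (⟨a, b⟩ | ⟨a, b⟩ | ⟨a, b⟩)
  all_goals simp only [act_comb, act_scal, one_mulVec, ← mulVec_mulVec, ten_act, assoc_act, assocInv_act, braid_act, unit_act]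

theorem ten_comp1 {X₀ X₁ Y₀ Y₁ : Type} (f₀ : Matrix A₀' A₀ ℂ) (f₁ : Matrix A₁' A₁ ℂ)(g₀ : Matrix B₀' B₀ ℂ) (g₁ : Matrix B₁' B₁ ℂ)(f₀' : Matrix X₀ A₀' ℂ) (f₁' : Matrix X₁ A₁' ℂ) (g₀' : Matrix Y₀ B₀' ℂ) (g₁' : Matrix Y₁ B₁' ℂ) :
    ten1 f₀' f₁' g₀' g₁' * ten1 f₀ f₁ g₀ g₁ =
    ten1 (f₀' * f₀) (f₁' * f₁) (g₀' * g₀) (g₁' * g₁) := by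
  simp [ten0, ten1, fromBlocks_multiply, mul_kronecker_mul]

theorem assoc_inv1 :
    assocInv1 A₀ A₁ B₀ B₁ C₀ C₁ * assoc1 A₀ A₁ B₀ B₁ C₀ C₁ =
    1 := by
  refine ext_act fun v i => ?_
  rcases i with (⟨(⟨a, b⟩ | ⟨a, b⟩), c⟩ | ⟨(⟨a, b⟩ | ⟨a, b⟩ | ⟨a, b⟩), c⟩ | ⟨(⟨a, b⟩ | ⟨a, b⟩ | ⟨a, b⟩), c⟩)
  all_goals simp only [act_comb, act_scal, one_mulVec, ← mulVec_mulVec, ten_act, assoc_act, assocInv_act, braid_act, unit_act]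
  all_goals grind [p_mul_p, q_mul_q]

theorem inv_assoc1 :
    assoc1 A₀ A₁ B₀ B₁ C₀ C₁ * assocInv1 A₀ A₁ B₀ B₁ C₀ C₁ =
    1 := by
  refine ext_act fun v i => ?_
  rcases i with (⟨a, (⟨b, c⟩ | ⟨b, c⟩ | ⟨b, c⟩)⟩ | ⟨a, (⟨b, c⟩ | ⟨b, c⟩)⟩ | ⟨a, (⟨b, c⟩ | ⟨b, c⟩ | ⟨b, c⟩)⟩)
  all_goals simp only [act_comb, act_scal, one_mulVec, ← mulVec_mulVec, ten_act, assoc_act, assocInv_act, braid_act, unit_act]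
  all_goals grind [p_mul_p, q_mul_q]

theorem assoc_nat1 (f₀ : Matrix A₀' A₀ ℂ) (f₁ : Matrix A₁' A₁ ℂ)(g₀ : Matrix B₀' B₀ ℂ) (g₁ : Matrix B₁' B₁ ℂ)(h₀ : Matrix C₀' C₀ ℂ) (h₁ : Matrix C₁' C₁ ℂ) :
    assoc1 A₀' A₁' B₀' B₁' C₀' C₁' * ten1 (ten0 f₀ f₁ g₀ g₁) (ten1 f₀ f₁ g₀ g₁) h₀ h₁ =
    ten1 f₀ f₁ (ten0 g₀ g₁ h₀ h₁) (ten1 g₀ g₁ h₀ h₁) * assoc1 A₀ A₁ B₀ B₁ C₀ C₁ := by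
  refine ext_act fun v i => ?_
  rcases i with (⟨a, (⟨b, c⟩ | ⟨b, c⟩ | ⟨b, c⟩)⟩ | ⟨a, (⟨b, c⟩ | ⟨b, c⟩)⟩ | ⟨a, (⟨b, c⟩ | ⟨b, c⟩ | ⟨b, c⟩)⟩)
  all_goals simp only [act_comb, act_scal, one_mulVec, ← mulVec_mulVec, ten_act, assoc_act, assocInv_act, braid_act, unit_act]

theorem pentagon1 :
    ten1 (1 : Matrix A₀ A₀ ℂ) (1 : Matrix A₁ A₁ ℂ) (assoc0 B₀ B₁ C₀ C₁ D₀ D₁) (assoc1 B₀ B₁ C₀ C₁ D₀ D₁) * assoc1 A₀ A₁ (T0 B₀ B₁ C₀ C₁) (T1 B₀ B₁ C₀ C₁) D₀ D₁ *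
      ten1 (assoc0 A₀ A₁ B₀ B₁ C₀ C₁) (assoc1 A₀ A₁ B₀ B₁ C₀ C₁) (1 : Matrix D₀ D₀ ℂ) (1 : Matrix D₁ D₁ ℂ) =
    assoc1 A₀ A₁ B₀ B₁ (T0 C₀ C₁ D₀ D₁) (T1 C₀ C₁ D₀ D₁) * assoc1 (T0 A₀ A₁ B₀ B₁) (T1 A₀ A₁ B₀ B₁) C₀ C₁ D₀ D₁ := by
  refine ext_act fun v i => ?_
  rcases i with (⟨a, (⟨b, (⟨c, d⟩ | ⟨c, d⟩ | ⟨c, d⟩)⟩ | ⟨b, (⟨c, d⟩ | ⟨c, d⟩)⟩ | ⟨b, (⟨c, d⟩ | ⟨c, d⟩ | ⟨c, d⟩)⟩)⟩ | ⟨a, (⟨b, (⟨c, d⟩ | ⟨c, d⟩)⟩ | ⟨b, (⟨c, d⟩ | ⟨c, d⟩ | ⟨c, d⟩)⟩)⟩ | ⟨a, (⟨b, (⟨c, d⟩ | ⟨c, d⟩ | ⟨c, d⟩)⟩ | ⟨b, (⟨c, d⟩ | ⟨c, d⟩)⟩ | ⟨b, (⟨c, d⟩ | ⟨c, d⟩ |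 ⟨c, d⟩)⟩)⟩)
  all_goals simp only [act_comb, act_scal, one_mulVec, ← mulVec_mulVec, ten_act, assoc_act, assocInv_act, braid_act, unit_act]
  all_goals grind [p_mul_p, q_mul_q]

theorem lunit_nat1 (f₀ : Matrix A₀' A₀ ℂ) (f₁ : Matrix A₁' A₁ ℂ) :
    lunit1 A₀' A₁' * ten1 (1 : Matrix Unit Unit ℂ) (1 : Matrix Empty Empty ℂ) f₀ f₁ =
    f₁ * lunit1 A₀ A₁ := by
  refine ext_act fun v i => ?_
  simp only [act_comb, act_scal, one_mulVec, ← mulVec_mulVec, ten_act, assoc_act, assocInv_act, braid_act, unit_act]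
  congr 2; funext a; simp only [unit_act]

theorem runit_nat1 (f₀ : Matrix A₀' A₀ ℂ) (f₁ : Matrix A₁' A₁ ℂ) :
    runit1 A₀' A₁' * ten1 f₀ f₁ (1 : Matrix Unit Unit ℂ) (1 : Matrix Empty Empty ℂ) =
    f₁ * runit1 A₀ A₁ := by
  refine ext_act fun v i => ?_
  simp only [act_comb, act_scal, one_mulVec, ← mulVec_mulVec, ten_act, assoc_act, assocInv_act, braid_act, unit_act]
  congr 2; funext a; simp only [unit_act]

theorem lunit_inv1 :
    lunit1 A₀ A₁ * lunitInv1 A₀ A₁ =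
    1 := by
  refine ext_act fun v i => ?_
  simp only [act_comb, act_scal, one_mulVec, ← mulVec_mulVec, ten_act, assoc_act, assocInv_act, braid_act, unit_act]

theorem runit_inv1 :
    runit1 A₀ A₁ * runitInv1 A₀ A₁ =
    1 := by
  refine ext_act fun v i => ?_
  simp only [act_comb, act_scal, one_mulVec, ← mulVec_mulVec, ten_act, assoc_act, assocInv_act, braid_act, unit_act]

theorem inv_lunit1 :
    lunitInv1 A₀ A₁ * lunit1 A₀ A₁ =
    1 := by
  refine ext_act fun v i => ?_
  rcases i with (⟨⟨⟩, a⟩ | ⟨⟨⟩, a⟩ | ⟨⟨⟩, a⟩)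
  all_goals simp only [act_comb, act_scal, one_mulVec, ← mulVec_mulVec, ten_act, assoc_act, assocInv_act, braid_act, unit_act]

theorem inv_runit1 :
    runitInv1 A₀ A₁ * runit1 A₀ A₁ =
    1 := by
  refine ext_act fun v i => ?_
  rcases i with (⟨a, ⟨⟩⟩ | ⟨a, ⟨⟩⟩ | ⟨a, ⟨⟩⟩)
  all_goals simp only [act_comb, act_scal, one_mulVec, ← mulVec_mulVec, ten_act, assoc_act, assocInv_act, braid_act, unit_act]

theorem triangle1 :
    ten1 (1 : Matrix A₀ A₀ ℂ) (1 : Matrix A₁ A₁ ℂ) (lunit0 B₀ B₁) (lunit1 B₀ B₁) * assoc1 A₀ A₁ Unit Empty B₀ B₁ =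
    ten1 (runit0 A₀ A₁) (runit1 A₀ A₁) (1 : Matrix B₀ B₀ ℂ) (1 : Matrix B₁ B₁ ℂ) := by
  refine ext_act fun v i => ?_
  rcases i with (⟨a, b⟩ | ⟨a, b⟩ | ⟨a, b⟩)
  all_goals simp only [act_comb, act_scal, one_mulVec, ← mulVec_mulVec, ten_act, assoc_act, assocInv_act, braid_act, unit_act]

theorem braid_nat1 (r : ℂ) (f₀ : Matrix A₀' A₀ ℂ) (f₁ : Matrix A₁' A₁ ℂ)(g₀ : Matrix B₀' B₀ ℂ) (g₁ : Matrix B₁' B₁ ℂ) :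
    braid1 A₀' A₁' B₀' B₁' r * ten1 f₀ f₁ g₀ g₁ =
    ten1 g₀ g₁ f₀ f₁ * braid1 A₀ A₁ B₀ B₁ r := by
  refine ext_act fun v i => ?_
  rcases i with (⟨b, a⟩ | ⟨b, a⟩ | ⟨b, a⟩)
  all_goals simp only [act_comb, act_scal, one_mulVec, ← mulVec_mulVec, ten_act, assoc_act, assocInv_act, braid_act, unit_act]
  all_goals rw [act_swap]

theorem braid_inv1 (r s : ℂ) (hrs : r * s = 1) :
    braid1 B₀ B₁ A₀ A₁ s * braid1 A₀ A₁ B₀ B₁ r =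
    1 := by
  refine ext_act fun v i => ?_
  rcases i with (⟨a, b⟩ | ⟨a, b⟩ | ⟨a, b⟩)
  all_goals simp only [act_comb, act_scal, one_mulVec, ← mulVec_mulVec, ten_act, assoc_act, assocInv_act, braid_act, unit_act]
  all_goals grind

theorem hexf1 :
    assoc1 B₀ B₁ C₀ C₁ A₀ A₁ * braid1 A₀ A₁ (T0 B₀ B₁ C₀ C₁) (T1 B₀ B₁ C₀ C₁) Rt * assoc1 A₀ A₁ B₀ B₁ C₀ C₁ =
    ten1 (1 : Matrix B₀ B₀ ℂ) (1 : Matrix B₁ B₁ ℂ) (braid0 A₀ A₁ C₀ C₁ R1) (braid1 A₀ A₁ C₀ C₁ Rt) * assoc1 B₀ B₁ A₀ A₁ C₀ C₁ * ten1 (braid0 A₀ A₁ B₀ B₁ R1) (braid1 A₀ A₁ B₀ B₁ Rt) (1 : Matrix C₀ C₀ ℂ) (1 : Matrix C₁ C₁ ℂ) := by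
  refine ext_act fun v i => ?_
  rcases i with (⟨b, (⟨c, a⟩ | ⟨c, a⟩ | ⟨c, a⟩)⟩ | ⟨b, (⟨c, a⟩ | ⟨c, a⟩)⟩ | ⟨b, (⟨c, a⟩ | ⟨c, a⟩ | ⟨c, a⟩)⟩)
  all_goals simp only [act_comb, act_scal, one_mulVec, ← mulVec_mulVec, ten_act, assoc_act, assocInv_act, braid_act, unit_act]
  all_goals grind [p_mul_p, q_mul_q, R1_eq, Rt_sq]

theorem hexr1 :
    assocInv1 C₀ C₁ A₀ A₁ B₀ B₁ * braid1 (T0 A₀ A₁ B₀ B₁) (T1 A₀ A₁ B₀ B₁) C₀ C₁ Rt * assocInv1 A₀ A₁ B₀ B₁ C₀ C₁ =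
    ten1 (braid0 A₀ A₁ C₀ C₁ R1) (braid1 A₀ A₁ C₀ C₁ Rt) (1 : Matrix B₀ B₀ ℂ) (1 : Matrix B₁ B₁ ℂ) * assocInv1 A₀ A₁ C₀ C₁ B₀ B₁ * ten1 (1 : Matrix A₀ A₀ ℂ) (1 : Matrix A₁ A₁ ℂ) (braid0 B₀ B₁ C₀ C₁ R1) (braid1 B₀ B₁ C₀ C₁ Rt) := by
  refine ext_act fun v i => ?_
  rcases i with (⟨(⟨c, a⟩ | ⟨c, a⟩), b⟩ | ⟨(⟨c, a⟩ | ⟨c, a⟩ | ⟨c, a⟩), b⟩ | ⟨(⟨c, a⟩ | ⟨c, a⟩ | ⟨c, a⟩), b⟩)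
  all_goals simp only [act_comb, act_scal, one_mulVec, ← mulVec_mulVec, ten_act, assoc_act, assocInv_act, braid_act, unit_act]
  all_goals grind [p_mul_p, q_mul_q, R1_eq, Rt_sq]
end Lemmas

section Bilinear

variable {A₀ A₁ B₀ B₁ A₀' A₁' B₀' B₁' : Type} (f₀ f₀' : Matrix A₀' A₀ ℂ) (f₁ f₁' : Matrix A₁' A₁ ℂ)
  (g₀ g₀' : Matrix B₀' B₀ ℂ) (g₁ g₁' : Matrix B₁' B₁ ℂ) (c : ℂ)

theorem ten_zero0 : ten0 f₀ f₁ (0 : Matrix B₀' B₀ ℂ) (0 : Matrix B₁' B₁ ℂ) = 0 := by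
  simp [ten0]

theorem zero_ten0 : ten0 (0 : Matrix A₀' A₀ ℂ) (0 : Matrix A₁' A₁ ℂ) g₀ g₁ = 0 := by
  simp [ten0]

theorem ten_add0 :
    ten0 f₀ f₁ (g₀ + g₀') (g₁ + g₁') = ten0 f₀ f₁ g₀ g₁ + ten0 f₀ f₁ g₀' g₁' := by
  simp [ten0, Matrix.kronecker_add, Matrix.fromBlocks_add]

theorem add_ten0 :
    ten0 (f₀ + f₀') (f₁ + f₁') g₀ g₁ = ten0 f₀ f₁ g₀ g₁ + ten0 f₀' f₁' g₀ g₁ := by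
  simp [ten0, Matrix.add_kronecker, Matrix.fromBlocks_add]

theorem ten_smul0 : ten0 f₀ f₁ (c • g₀) (c • g₁) = c • ten0 f₀ f₁ g₀ g₁ := by
  simp [ten0, Matrix.kronecker_smul, Matrix.fromBlocks_smul]

theorem smul_ten0 : ten0 (c • f₀) (c • f₁) g₀ g₁ = c • ten0 f₀ f₁ g₀ g₁ := by
  simp [ten0, Matrix.smul_kronecker, Matrix.fromBlocks_smul]

theorem ten_zero1 : ten1 f₀ f₁ (0 : Matrix B₀' B₀ ℂ) (0 : Matrix B₁' B₁ ℂ) = 0 := by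
  simp [ten1]

theorem zero_ten1 : ten1 (0 : Matrix A₀' A₀ ℂ) (0 : Matrix A₁' A₁ ℂ) g₀ g₁ = 0 := by
  simp [ten1]

theorem ten_add1 :
    ten1 f₀ f₁ (g₀ + g₀') (g₁ + g₁') = ten1 f₀ f₁ g₀ g₁ + ten1 f₀ f₁ g₀' g₁' := by
  simp [ten1, Matrix.kronecker_add, Matrix.fromBlocks_add]

theorem add_ten1 :
    ten1 (f₀ + f₀') (f₁ + f₁') g₀ g₁ = ten1 f₀ f₁ g₀ g₁ + ten1 f₀' f₁' g₀ g₁ := by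
  simp [ten1, Matrix.add_kronecker, Matrix.fromBlocks_add]

theorem ten_smul1 : ten1 f₀ f₁ (c • g₀) (c • g₁) = c • ten1 f₀ f₁ g₀ g₁ := by
  simp [ten1, Matrix.kronecker_smul, Matrix.fromBlocks_smul]

theorem smul_ten1 : ten1 (c • f₀) (c • f₁) g₀ g₁ = c • ten1 f₀ f₁ g₀ g₁ := by
  simp [ten1, Matrix.smul_kronecker, Matrix.fromBlocks_smul]

end Bilinear

end FibMat

/-- An object of the Fibonacci category: the finite index sets of its copies of `𝟏` and of `τ`. -/
structure Fib where
  one : Type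
  tau : Type
  [fintypeOne : Fintype one]
  [fintypeTau : Fintype tau]
  [decEqOne : DecidableEq one]
  [decEqTau : DecidableEq tau]

namespace Fib

open FibMat

attribute [instance] fintypeOne fintypeTau decEqOne decEqTau

/-- A morphism: a matrix for each of the two simple objects, rows indexed by the target. -/
@[ext]
structure Hom (X Y : Fib) where
  one : Matrix Y.one X.one ℂ
  tau : Matrix Y.tau X.tau ℂ

instance : Category Fib where
  Hom := Hom
  id _ := ⟨1, 1⟩
  comp f g := ⟨g.one * f.one, g.tau * f.tau⟩
  id_comp f := by cases f; simp
  comp_id f := by cases f; simp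
  assoc f g h := by simp [Matrix.mul_assoc]

variable {X Y Z X' Y' : Fib}

@[ext]
theorem hom_ext {f g : X ⟶ Y} (h₁ : f.one = g.one) (h₂ : f.tau = g.tau) : f = g := Hom.ext h₁ h₂

@[simp] theorem id_one : Hom.one (𝟙 X) = 1 := rfl
@[simp] theorem id_tau : Hom.tau (𝟙 X) = 1 := rfl
@[simp] theorem comp_one (f : X ⟶ Y) (g : Y ⟶ Z) : (f ≫ g).one = g.one * f.one := rfl
@[simp] theorem comp_tau (f : X ⟶ Y) (g : Y ⟶ Z) : (f ≫ g).tau = g.tau * f.tau := rfl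

/-- The linear structure on morphisms is entrywise. -/
def homEquiv (X Y : Fib) :
    (X ⟶ Y) ≃ Matrix Y.one X.one ℂ × Matrix Y.tau X.tau ℂ where
  toFun f := (f.one, f.tau)
  invFun m := ⟨m.1, m.2⟩
  left_inv _ := rfl
  right_inv _ := rfl

instance : Preadditive Fib where
  homGroup X Y := (homEquiv X Y).addCommGroup
  add_comp _ _ _ _ _ _ := hom_ext (Matrix.mul_add _ _ _) (Matrix.mul_add _ _ _)
  comp_add _ _ _ _ _ _ := hom_ext (Matrix.add_mul _ _ _) (Matrix.add_mul _ _ _)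

@[simp] theorem add_one (f g : X ⟶ Y) : (f + g).one = f.one + g.one := rfl
@[simp] theorem add_tau (f g : X ⟶ Y) : (f + g).tau = f.tau + g.tau := rfl
@[simp] theorem zero_one : Hom.one (0 : X ⟶ Y) = 0 := rfl
@[simp] theorem zero_tau : Hom.tau (0 : X ⟶ Y) = 0 := rfl

instance : Linear ℂ Fib where
  homModule X Y := (homEquiv X Y).module ℂ
  smul_comp _ _ _ _ _ _ := hom_ext (Matrix.mul_smul _ _ _) (Matrix.mul_smul _ _ _)
  comp_smul _ _ _ _ _ _ := hom_ext (Matrix.smul_mul _ _ _) (Matrix.smul_mul _ _ _)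

@[simp] theorem smul_one (c : ℂ) (f : X ⟶ Y) : (c • f).one = c • f.one := rfl
@[simp] theorem smul_tau (c : ℂ) (f : X ⟶ Y) : (c • f).tau = c • f.tau := rfl

/-- The tensor product of objects. -/
def tensor (X Y : Fib) : Fib where
  one := T0 X.one X.tau Y.one Y.tau
  tau := T1 X.one X.tau Y.one Y.tau

/-- The tensor product of morphisms. -/
def tensorMap (f : X ⟶ X') (g : Y ⟶ Y') : tensor X Y ⟶ tensor X' Y' where
  one := ten0 f.one f.tau g.one g.tau
  tau := ten1 f.one f.tau g.one g.tau

/-- The object `𝟏`. -/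
def unit : Fib where
  one := Unit
  tau := Empty

instance : MonoidalCategoryStruct Fib where
  tensorObj := tensor
  tensorHom := tensorMap
  whiskerLeft X _ _ f := tensorMap (𝟙 X) f
  whiskerRight f Y := tensorMap f (𝟙 Y)
  tensorUnit := unit
  associator _ _ _ :=
    { hom := ⟨assoc0 _ _ _ _ _ _, assoc1 _ _ _ _ _ _⟩
      inv := ⟨assocInv0 _ _ _ _ _ _, assocInv1 _ _ _ _ _ _⟩
      hom_inv_id := hom_ext assoc_inv0 assoc_inv1
      inv_hom_id := hom_ext inv_assoc0 inv_assoc1 }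
  leftUnitor _ :=
    { hom := ⟨lunit0 _ _, lunit1 _ _⟩
      inv := ⟨lunitInv0 _ _, lunitInv1 _ _⟩
      hom_inv_id := hom_ext inv_lunit0 inv_lunit1
      inv_hom_id := hom_ext lunit_inv0 lunit_inv1 }
  rightUnitor _ :=
    { hom := ⟨runit0 _ _, runit1 _ _⟩
      inv := ⟨runitInv0 _ _, runitInv1 _ _⟩
      hom_inv_id := hom_ext inv_runit0 inv_runit1
      inv_hom_id := hom_ext runit_inv0 runit_inv1 }

instance : MonoidalCategory Fib :=
  .ofTensorHom
    (id_tensorHom_id := fun _ _ => hom_ext ten_id0 ten_id1)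
    (id_tensorHom := fun _ _ _ _ => rfl)
    (tensorHom_id := fun _ _ => rfl)
    (tensorHom_comp_tensorHom := fun _ _ _ _ => hom_ext (ten_comp0 _ _ _ _ _ _ _ _)
      (ten_comp1 _ _ _ _ _ _ _ _))
    (associator_naturality := fun _ _ _ => hom_ext (assoc_nat0 _ _ _ _ _ _)
      (assoc_nat1 _ _ _ _ _ _))
    (leftUnitor_naturality := fun _ => hom_ext (lunit_nat0 _ _) (lunit_nat1 _ _))
    (rightUnitor_naturality := fun _ => hom_ext (runit_nat0 _ _) (runit_nat1 _ _))
    (pentagon := fun _ _ _ _ => hom_ext pentagon0 pentagon1)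
    (triangle := fun _ _ => hom_ext triangle0 triangle1)

instance : BraidedCategory Fib where
  braiding _ _ :=
    { hom := ⟨braid0 _ _ _ _ R1, braid1 _ _ _ _ Rt⟩
      inv := ⟨braid0 _ _ _ _ R1⁻¹, braid1 _ _ _ _ Rt⁻¹⟩
      hom_inv_id := hom_ext (braid_inv0 _ _ (mul_inv_cancel₀ R1_ne))
        (braid_inv1 _ _ (mul_inv_cancel₀ Rt_ne))
      inv_hom_id := hom_ext (braid_inv0 _ _ (inv_mul_cancel₀ R1_ne))
        (braid_inv1 _ _ (inv_mul_cancel₀ Rt_ne)) }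
  braiding_naturality_right _ _ _ _ := hom_ext (braid_nat0 _ _ _ _ _) (braid_nat1 _ _ _ _ _)
  braiding_naturality_left _ _ := hom_ext (braid_nat0 _ _ _ _ _) (braid_nat1 _ _ _ _ _)
  hexagon_forward _ _ _ := hom_ext hexf0 hexf1
  hexagon_reverse _ _ _ := hom_ext hexr0 hexr1

instance : MonoidalPreadditive Fib where
  whiskerLeft_zero := hom_ext (ten_zero0 _ _) (ten_zero1 _ _)
  zero_whiskerRight := hom_ext (zero_ten0 _ _) (zero_ten1 _ _)
  whiskerLeft_add _ _ := hom_ext (ten_add0 _ _ _ _ _ _) (ten_add1 _ _ _ _ _ _)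
  add_whiskerRight _ _ := hom_ext (add_ten0 _ _ _ _ _ _) (add_ten1 _ _ _ _ _ _)

instance : MonoidalLinear ℂ Fib where
  whiskerLeft_smul _ _ _ _ _ := hom_ext (ten_smul0 _ _ _ _ _) (ten_smul1 _ _ _ _ _)
  smul_whiskerRight _ _ _ _ _ := hom_ext (smul_ten0 _ _ _ _ _) (smul_ten1 _ _ _ _ _)

end Fib

/-! ### The tensor product of modules over a bimonoid in a braided category -/

namespace ModTensor

open MonObj ComonObj

universe v u

variable {C : Type u} [Category.{v} C] [MonoidalCategory C]

section
variable {A : C} [MonObj A]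

/-- The action map of a module. -/
def act (M : Mod C A) : A ⊗ M.X ⟶ M.X := ModObj.smul (M := A) (X := M.X)

/-- A module from its action map. -/
def mkMod {X : C} (r : A ⊗ X ⟶ X) (h₁ : η[A] ▷ X ≫ r = (λ_ X).hom)
    (h₂ : μ[A] ▷ X ≫ r = (α_ A A X).hom ≫ A ◁ r ≫ r) : Mod C A :=
  letI : ModObj A X := { smul := r, one_smul := h₁, mul_smul := h₂ }
  ⟨X⟩

theorem one_act (M : Mod C A) : η[A] ▷ M.X ≫ act M = (λ_ M.X).hom :=
  ModObj.one_smul_self A M.X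

theorem mul_act (M : Mod C A) :
    μ[A] ▷ M.X ≫ act M = (α_ A A M.X).hom ≫ A ◁ act M ≫ act M :=
  ModObj.mul_smul_self A M.X

theorem act_hom {M N : Mod C A} (f : M ⟶ N) : act M ≫ f.hom = A ◁ f.hom ≫ act N :=
  f.isModHom.smul_hom

/-- A module morphism from its underlying morphism. -/
def mkHom {M N : Mod C A} (f : M.X ⟶ N.X) (h : act M ≫ f = A ◁ f ≫ act N) : M ⟶ N :=
  Mod.Hom.mk' f h

@[simp] theorem mkHom_hom {M N : Mod C A} (f : M.X ⟶ N.X) (h) :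
    (mkHom (M := M) (N := N) f h).hom = f := rfl

/-- A module isomorphism from its underlying isomorphism. -/
def mkIso {M N : Mod C A} (e : M.X ≅ N.X) (h : act M ≫ e.hom = A ◁ e.hom ≫ act N) : M ≅ N where
  hom := mkHom e.hom h
  inv := mkHom e.inv (by
    rw [Iso.comp_inv_eq, Category.assoc, h, ← MonoidalCategory.whiskerLeft_comp_assoc]; simp)
  hom_inv_id := by ext; exact e.hom_inv_id
  inv_hom_id := by ext; exact e.inv_hom_id

@[simp] theorem mkIso_hom {M N : Mod C A} (e : M.X ≅ N.X) (h) :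
    (mkIso (M := M) (N := N) e h).hom.hom = e.hom := rfl

@[simp] theorem mkIso_inv {M N : Mod C A} (e : M.X ≅ N.X) (h) :
    (mkIso (M := M) (N := N) e h).inv.hom = e.inv := rfl

end

section
variable [BraidedCategory C] {A : C} [BimonObj A]

/-- The action of `A` on `X ⊗ Y` through the comultiplication and the braiding. -/
def tensorAct {X Y : C} (r : A ⊗ X ⟶ X) (s : A ⊗ Y ⟶ Y) : A ⊗ X ⊗ Y ⟶ X ⊗ Y :=
  Δ[A] ▷ (X ⊗ Y) ≫ tensorμ A A X Y ≫ (r ⊗ₘ s)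

/-- The trivial action of `A` on the unit object through the counit. -/
def unitAct (A : C) [BimonObj A] : A ⊗ 𝟙_ C ⟶ 𝟙_ C := (ρ_ A).hom ≫ ε[A]

theorem one_tensorAct (M N : Mod C A) :
    η[A] ▷ (M.X ⊗ N.X) ≫ tensorAct (act M) (act N) = (λ_ (M.X ⊗ N.X)).hom := by
  have h : η[A] ≫ Δ[A] = (λ_ (𝟙_ C)).inv ≫ (η[A] ⊗ₘ η[A]) := by
    rw [BimonObj.one_comul]; rfl
  rw [tensorAct, ← comp_whiskerRight_assoc, h, comp_whiskerRight_assoc, tensorμ_natural_left_assoc,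
    tensorHom_comp_tensorHom, one_act, one_act, tensor_left_unitality]

theorem mul_tensorAct (M N : Mod C A) :
    μ[A] ▷ (M.X ⊗ N.X) ≫ tensorAct (act M) (act N) =
      (α_ A A (M.X ⊗ N.X)).hom ≫ A ◁ tensorAct (act M) (act N) ≫ tensorAct (act M) (act N) := by
  have h1 : (Δ[A] ⊗ₘ Δ[A]) ▷ (M.X ⊗ N.X) ≫ (α_ (A ⊗ A) (A ⊗ A) (M.X ⊗ N.X)).hom =
      (α_ A A (M.X ⊗ N.X)).hom ≫ A ◁ Δ[A] ▷ (M.X ⊗ N.X) ≫ Δ[A] ▷ ((A ⊗ A) ⊗ M.X ⊗ N.X) := by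
    rw [← tensorHom_id, associator_naturality, tensorHom_id, tensorHom_def']
  calc
    _ = (Δ[A] ⊗ₘ Δ[A]) ▷ (M.X ⊗ N.X) ≫ (tensorμ A A A A ▷ (M.X ⊗ N.X) ≫
          tensorμ (A ⊗ A) (A ⊗ A) M.X N.X ≫
            ((α_ A A M.X).hom ⊗ₘ (α_ A A N.X).hom)) ≫
              (A ◁ act M ⊗ₘ A ◁ act N) ≫ (act M ⊗ₘ act N) := by
      rw [tensorAct, ← comp_whiskerRight_assoc, BimonObj.mul_comul]
      simp only [comp_whiskerRight, Category.assoc, tensorμ_natural_left_assoc,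
        tensorHom_comp_tensorHom, mul_act]
    _ = _ := by
      rw [tensor_associativity]
      simp only [Category.assoc]
      rw [reassoc_of% h1, ← tensorμ_natural_right_assoc]
      simp only [tensorAct, MonoidalCategory.whiskerLeft_comp, Category.assoc]
      rw [← whisker_exchange_assoc, ← whisker_exchange_assoc]

theorem one_unitAct : η[A] ▷ 𝟙_ C ≫ unitAct A = (λ_ (𝟙_ C)).hom := by
  rw [unitAct, rightUnitor_naturality_assoc, BimonObj.one_counit, Category.comp_id, unitors_equal]

theorem mul_unitAct :
    μ[A] ▷ 𝟙_ C ≫ unitAct A = (α_ A A (𝟙_ C)).hom ≫ A ◁ unitAct A ≫ unitAct A := by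
  have h : μ[A] ≫ ε[A] = (ε[A] ⊗ₘ ε[A]) ≫ (λ_ (𝟙_ C)).hom := by
    rw [BimonObj.mul_counit]; rfl
  rw [unitAct, rightUnitor_naturality_assoc, h, tensorHom_def'_assoc, unitors_equal,
    rightUnitor_naturality]
  simp

theorem tensorAct_natural {X X' Y Y' : C} {r : A ⊗ X ⟶ X} {r' : A ⊗ X' ⟶ X'} {s : A ⊗ Y ⟶ Y}
    {s' : A ⊗ Y' ⟶ Y'} {f : X ⟶ X'} {g : Y ⟶ Y'} (hf : r ≫ f = A ◁ f ≫ r')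
    (hg : s ≫ g = A ◁ g ≫ s') :
    tensorAct r s ≫ (f ⊗ₘ g) = A ◁ (f ⊗ₘ g) ≫ tensorAct r' s' := by
  simp only [tensorAct, Category.assoc, tensorHom_comp_tensorHom, hf, hg]
  rw [← tensorHom_comp_tensorHom, ← tensorμ_natural_right_assoc, whisker_exchange_assoc]

theorem associator_act {X Y Z : C} (r : A ⊗ X ⟶ X) (s : A ⊗ Y ⟶ Y) (t : A ⊗ Z ⟶ Z) :
    tensorAct (tensorAct r s) t ≫ (α_ X Y Z).hom =
      A ◁ (α_ X Y Z).hom ≫ tensorAct r (tensorAct s t) := by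
  have h1 : tensorAct r s ⊗ₘ t =
      (Δ[A] ▷ (X ⊗ Y) ⊗ₘ 𝟙 A ▷ Z) ≫ tensorμ A A X Y ▷ (A ⊗ Z) ≫ ((r ⊗ₘ s) ⊗ₘ t) := by
    rw [← tensorHom_id (tensorμ A A X Y) (A ⊗ Z), tensorHom_comp_tensorHom,
      tensorHom_comp_tensorHom]
    simp [tensorAct]
  have h2 : r ⊗ₘ tensorAct s t =
      (𝟙 A ▷ X ⊗ₘ Δ[A] ▷ (Y ⊗ Z)) ≫ (A ⊗ X) ◁ tensorμ A A Y Z ≫ (r ⊗ₘ (s ⊗ₘ t)) := by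
    rw [← id_tensorHom (A ⊗ X) (tensorμ A A Y Z), tensorHom_comp_tensorHom,
      tensorHom_comp_tensorHom]
    simp [tensorAct]
  calc
    _ = (Δ[A] ≫ Δ[A] ▷ A) ▷ ((X ⊗ Y) ⊗ Z) ≫ (tensorμ (A ⊗ A) A (X ⊗ Y) Z ≫
          tensorμ A A X Y ▷ (A ⊗ Z) ≫ (α_ (A ⊗ X) (A ⊗ Y) (A ⊗ Z)).hom) ≫ (r ⊗ₘ (s ⊗ₘ t)) := by
      rw [tensorAct, h1, comp_whiskerRight]
      simp only [Category.assoc, associator_naturality]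
      rw [← tensorμ_natural_left_assoc, tensorHom_id]
    _ = (Δ[A] ≫ Δ[A] ▷ A ≫ (α_ A A A).hom) ▷ ((X ⊗ Y) ⊗ Z) ≫
          (A ⊗ A ⊗ A) ◁ (α_ X Y Z).hom ≫ tensorμ A (A ⊗ A) X (Y ⊗ Z) ≫
            (A ⊗ X) ◁ tensorμ A A Y Z ≫ (r ⊗ₘ (s ⊗ₘ t)) := by
      rw [associator_monoidal, MonoidalCategory.tensorHom_def]
      simp only [comp_whiskerRight, Category.assoc]
    _ = _ := by
      rw [← ComonObj.comul_assoc, tensorAct, h2, comp_whiskerRight, ← tensorμ_natural_left_assoc,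
        id_tensorHom, Category.assoc, ← whisker_exchange_assoc,
        ← whisker_exchange_assoc]

theorem leftUnitor_act {X : C} (r : A ⊗ X ⟶ X) :
    tensorAct (unitAct A) r ≫ (λ_ X).hom = A ◁ (λ_ X).hom ≫ r := by
  have h : unitAct A ⊗ₘ r = (ε[A] ▷ 𝟙_ C ⊗ₘ 𝟙 A ▷ X) ≫ ((λ_ (𝟙_ C)).hom ⊗ₘ r) := by
    rw [tensorHom_comp_tensorHom]; simp [unitAct, unitors_equal]
  have h' : ((λ_ (𝟙_ C)).hom ⊗ₘ r) ≫ (λ_ X).hom =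
      (λ_ (𝟙_ C)).hom ▷ (A ⊗ X) ≫ (λ_ _).hom ≫ r := by
    rw [← leftUnitor_naturality, MonoidalCategory.tensorHom_def, Category.assoc]
  have h'' := leftUnitor_monoidal A X
  rw [tensorAct, h, ← tensorμ_natural_left_assoc, Category.assoc, Category.assoc, Category.assoc,
    h', ← Category.assoc (_ ▷ _) (λ_ (A ⊗ X)).hom r, ← Category.assoc (tensorμ _ _ _ _), ← h'',
    tensorHom_id, ← comp_whiskerRight_assoc, counit_comul,
    MonoidalCategory.tensorHom_def, Category.assoc, inv_hom_whiskerRight_assoc]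

theorem rightUnitor_act {X : C} (r : A ⊗ X ⟶ X) :
    tensorAct r (unitAct A) ≫ (ρ_ X).hom = A ◁ (ρ_ X).hom ≫ r := by
  have h : r ⊗ₘ unitAct A = (𝟙 A ▷ X ⊗ₘ ε[A] ▷ 𝟙_ C) ≫ (r ⊗ₘ (λ_ (𝟙_ C)).hom) := by
    rw [tensorHom_comp_tensorHom]; simp [unitAct, unitors_equal]
  have h' : (r ⊗ₘ (λ_ (𝟙_ C)).hom) ≫ (ρ_ X).hom =
      (A ⊗ X) ◁ (λ_ (𝟙_ C)).hom ≫ (ρ_ _).hom ≫ r := by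
    rw [← rightUnitor_naturality, MonoidalCategory.tensorHom_def', Category.assoc]
  have h'' := rightUnitor_monoidal A X
  rw [tensorAct, h, ← tensorμ_natural_left_assoc, Category.assoc, Category.assoc, Category.assoc,
    h', ← Category.assoc (_ ◁ _) (ρ_ (A ⊗ X)).hom r, ← Category.assoc (tensorμ _ _ _ _), ← h'',
    id_tensorHom, ← comp_whiskerRight_assoc, comul_counit,
    MonoidalCategory.tensorHom_def, Category.assoc, inv_hom_whiskerRight_assoc]

/-- The tensor product of two modules. -/
def tensorMod (M N : Mod C A) : Mod C A :=
  mkMod (tensorAct (act M) (act N)) (one_tensorAct M N) (mul_tensorAct M N)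

/-- The trivial module. -/
def unitMod (A : C) [BimonObj A] : Mod C A :=
  mkMod (unitAct A) one_unitAct mul_unitAct

/-- The tensor product of module morphisms. -/
def tensorModHom {M M' N N' : Mod C A} (f : M ⟶ M') (g : N ⟶ N') :
    tensorMod M N ⟶ tensorMod M' N' :=
  mkHom (M := tensorMod M N) (N := tensorMod M' N') (f.hom ⊗ₘ g.hom)
    (tensorAct_natural (act_hom f) (act_hom g))

instance : MonoidalCategoryStruct (Mod C A) where
  tensorObj := tensorMod
  tensorHom := tensorModHom
  whiskerLeft M _ _ g := tensorModHom (𝟙 M) g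
  whiskerRight f N := tensorModHom f (𝟙 N)
  tensorUnit := unitMod A
  associator M N K := mkIso (α_ M.X N.X K.X) (associator_act (act M) (act N) (act K))
  leftUnitor M := mkIso (λ_ M.X) (leftUnitor_act (act M))
  rightUnitor M := mkIso (ρ_ M.X) (rightUnitor_act (act M))

instance : MonoidalCategory (Mod C A) :=
  .ofTensorHom
    (id_tensorHom_id := fun M N => Mod.hom_ext _ _ (id_tensorHom_id M.X N.X))
    (id_tensorHom := fun _ _ _ _ => rfl)
    (tensorHom_id := fun _ _ => rfl)
    (tensorHom_comp_tensorHom := fun f g h k => Mod.hom_ext _ _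
      (tensorHom_comp_tensorHom f.hom g.hom h.hom k.hom))
    (associator_naturality := fun f g h => Mod.hom_ext _ _
      (associator_naturality f.hom g.hom h.hom))
    (leftUnitor_naturality := fun f => Mod.hom_ext _ _
      ((congrArg (· ≫ _) (id_tensorHom _ f.hom)).trans (leftUnitor_naturality f.hom)))
    (rightUnitor_naturality := fun f => Mod.hom_ext _ _
      ((congrArg (· ≫ _) (tensorHom_id f.hom _)).trans (rightUnitor_naturality f.hom)))
    (pentagon := fun M N K L => Mod.hom_ext _ _ (by
      have := pentagon M.X N.X K.X L.X
      rw [← tensorHom_id, ← id_tensorHom] at this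
      exact this))
    (triangle := fun M N => Mod.hom_ext _ _ (by
      have := triangle M.X N.X
      rw [← tensorHom_id, ← id_tensorHom] at this
      exact this))

end
end ModTensor

/-! ### Linear structures on module categories and on the Drinfeld center -/

section LinearStructures

universe v u

variable {C : Type u} [Category.{v} C] [Preadditive C] [MonoidalCategory C] [MonoidalPreadditive C]

namespace ModTensor

variable {A : C} [MonObj A] {M N : Mod C A}

instance : Add (M ⟶ N) where
  add f g := mkHom (f.hom + g.hom) (by simp [act_hom])

instance : Zero (M ⟶ N) where
  zero := mkHom 0 (by simp)

instance : Neg (M ⟶ N) where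
  neg f := mkHom (-f.hom) (by
    rw [Preadditive.comp_neg, act_hom, ← Preadditive.neg_comp]
    congr 1
    exact ((tensorLeft A).map_neg (f := f.hom)).symm)

instance : AddCommGroup (M ⟶ N) where
  add_assoc f g h := Mod.hom_ext _ _ (add_assoc f.hom g.hom h.hom)
  zero_add f := Mod.hom_ext _ _ (zero_add f.hom)
  add_zero f := Mod.hom_ext _ _ (add_zero f.hom)
  add_comm f g := Mod.hom_ext _ _ (add_comm f.hom g.hom)
  neg_add_cancel f := Mod.hom_ext _ _ (neg_add_cancel f.hom)
  nsmul := nsmulRec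
  zsmul := zsmulRec

theorem add_hom (f g : M ⟶ N) : (f + g).hom = f.hom + g.hom := rfl

instance : Preadditive (Mod C A) where
  add_comp _ _ _ f g h := Mod.hom_ext _ _ (by
    simp only [Mod.comp_hom', add_hom, Preadditive.add_comp])
  comp_add _ _ _ f g h := Mod.hom_ext _ _ (by
    simp only [Mod.comp_hom', add_hom, Preadditive.comp_add])

variable {R : Type*} [Semiring R] [Linear R C] [MonoidalLinear R C]

instance : SMul R (M ⟶ N) where
  smul r f := mkHom (r • f.hom) (by simp [act_hom])

theorem smul_hom (r : R) (f : M ⟶ N) : (r • f).hom = r • f.hom := rfl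

instance : Module R (M ⟶ N) where
  one_smul f := Mod.hom_ext _ _ (one_smul R f.hom)
  mul_smul r s f := Mod.hom_ext _ _ (mul_smul r s f.hom)
  smul_zero r := Mod.hom_ext _ _ (smul_zero r)
  smul_add r f g := Mod.hom_ext _ _ (smul_add r f.hom g.hom)
  add_smul r s f := Mod.hom_ext _ _ (add_smul r s f.hom)
  zero_smul f := Mod.hom_ext _ _ (zero_smul R f.hom)

instance : Linear R (Mod C A) where
  smul_comp _ _ _ r f g := Mod.hom_ext _ _ (by
    simp only [Mod.comp_hom', smul_hom, Linear.smul_comp])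
  comp_smul _ _ _ f r g := Mod.hom_ext _ _ (by
    simp only [Mod.comp_hom', smul_hom, Linear.comp_smul])

end ModTensor

namespace CenterLinear

variable {X Y : Center C}

instance : Add (X ⟶ Y) where
  add f g := ⟨f.f + g.f, fun U => by simp⟩

instance : Zero (X ⟶ Y) where
  zero := ⟨0, fun U => by simp⟩

instance : Neg (X ⟶ Y) where
  neg f := ⟨-f.f, fun U => by
    have h1 : (-f.f) ▷ U = -(f.f ▷ U) := (tensorRight U).map_neg (f := f.f)
    have h2 : U ◁ (-f.f) = -(U ◁ f.f) := (tensorLeft U).map_neg (f := f.f)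
    simp [h1, h2]⟩

instance : AddCommGroup (X ⟶ Y) where
  add_assoc f g h := Center.ext _ _ (add_assoc f.f g.f h.f)
  zero_add f := Center.ext _ _ (zero_add f.f)
  add_zero f := Center.ext _ _ (add_zero f.f)
  add_comm f g := Center.ext _ _ (add_comm f.f g.f)
  neg_add_cancel f := Center.ext _ _ (neg_add_cancel f.f)
  nsmul := nsmulRec
  zsmul := zsmulRec

instance : Preadditive (Center C) where
  add_comp _ _ _ f g h := Center.ext _ _ (Preadditive.add_comp _ _ _ f.f g.f h.f)
  comp_add _ _ _ f g h := Center.ext _ _ (Preadditive.comp_add _ _ _ f.f g.f h.f)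

variable {R : Type*} [Semiring R] [Linear R C] [MonoidalLinear R C]

instance : SMul R (X ⟶ Y) where
  smul r f := ⟨r • f.f, fun U => by simp⟩

instance : Module R (X ⟶ Y) where
  one_smul f := Center.ext _ _ (one_smul R f.f)
  mul_smul r s f := Center.ext _ _ (mul_smul r s f.f)
  smul_zero r := Center.ext _ _ (smul_zero r)
  smul_add r f g := Center.ext _ _ (smul_add r f.f g.f)
  add_smul r s f := Center.ext _ _ (add_smul r s f.f)
  zero_smul f := Center.ext _ _ (zero_smul R f.f)

instance : Linear R (Center C) where
  smul_comp _ _ _ r f g := Center.ext _ _ (Linear.smul_comp _ _ _ r f.f g.f)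
  comp_smul _ _ _ f r g := Center.ext _ _ (Linear.comp_smul _ _ _ f.f r g.f)

end CenterLinear

end LinearStructures

/-! ### General notions -/

section Notions

universe v u

variable {C : Type u} [Category.{v} C] [MonoidalCategory C] [BraidedCategory C]

open MonObj ComonObj

/-- `Λ : 𝟙 ⟶ H` is a two-sided integral in `H`: `Λ h = ε(h) Λ = h Λ`. -/
def IsTwoSidedIntegral {H : C} [BimonObj H] (Λ : 𝟙_ C ⟶ H) : Prop :=
  Λ ▷ H ≫ μ[H] = (λ_ H).hom ≫ ε[H] ≫ Λ ∧ H ◁ Λ ≫ μ[H] = (ρ_ H).hom ≫ ε[H] ≫ Λ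

/-- The module `M` is the object `X` with the action `r : A ⊗ X ⟶ X`. -/
def IsModuleWithAction {A : C} [MonObj A] (M : Mod C A) {X : C} (r : A ⊗ X ⟶ X) : Prop :=
  ∃ m : ModObj A X, m.smul = r ∧ M = { X := X, mod := m }

/-- Every object is a finite direct sum of simple objects. -/
def EveryObjectSemisimple (D : Type u) [Category.{v} D] [Preadditive D] : Prop :=
  ∀ M : D, ∃ (n : ℕ) (S : Fin n → D), (∀ i, Simple (S i)) ∧
    ∃ b : Limits.Bicone S, Nonempty b.IsBilimit ∧ Nonempty (b.pt ≅ M)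

end Notions

/-! ### The objects and the structure maps

A morphism is written through its matrix entries. An index `inl (i, j)` of the `𝟏`-part of `X ⊗ Y`
is the copy of `𝟏` inside `𝟏ᵢ ⊗ 𝟏ⱼ`, and `inr (i, j)` is the one inside `τᵢ ⊗ τⱼ`; for the
`τ`-part, `inl (i, j)` lies inside `𝟏ᵢ ⊗ τⱼ`, `inr (inl (i, j))` inside `τᵢ ⊗ 𝟏ⱼ`, and
`inr (inr (i, j))` inside `τᵢ ⊗ τⱼ`. Rows are indexed by the target, columns by the source. -/

namespace Fib

open FibMat Sum

/-- The golden ratio. -/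
local notation "φ" => Real.goldenRatio

/-- The object `2 + τ`; its two copies `𝟏₁`, `𝟏₂` of `𝟏` have the indices `0`, `1`. -/
def twoPlusTau : Fib where
  one := Fin 2
  tau := Unit

/-- The simple object `τ`. -/
def tauObj : Fib where
  one := Empty
  tau := Unit

/-- The object `𝟏 + τ`. -/
def onePlusTau : Fib where
  one := Unit
  tau := Unit

/-- The multiplication of `2 + τ`. -/
def hopfMul : twoPlusTau ⊗ twoPlusTau ⟶ twoPlusTau where
  one := fun (k : Fin 2) (x : T0 (Fin 2) Unit (Fin 2) Unit) => match k, x with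
    | 0, inl (0, 0) => 1
    | 1, inl (0, 1) => 1
    | 1, inl (1, 0) => 1
    | 0, inl (1, 1) => 1
    | 0, inr _ => 1
    | 1, inr _ => -1
    | _, _ => 0
  tau := fun (_ : Unit) (x : T1 (Fin 2) Unit (Fin 2) Unit) => match x with
    | inl (0, _) => 1
    | inl (1, _) => -1
    | inr (inl (_, 0)) => 1
    | inr (inl (_, 1)) => -1
    | inr (inr _) => -((√2 * φ ^ (-(3 / 4) : ℝ) : ℝ) : ℂ)

/-- The coefficient of `τ ⊗ τ` in the comultiplication of `𝟏₂`. -/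
def coeffV : ℂ :=
  -((φ ^ (-2 : ℝ) / 2 : ℝ) : ℂ) +
    (((5 : ℝ) ^ (1 / 4 : ℝ) * φ ^ (-(1 / 2) : ℝ) / 2 : ℝ) : ℂ) * Complex.I

/-- Minus the coefficient of `τ ⊗ τ` in the comultiplication of `τ`; the complex fourth root is
the principal one. -/
def coeffU : ℂ :=
  Complex.I *
    (5 * (((-9 + 4 * √5 : ℝ) : ℂ) - Complex.I * ((√(1525 - 682 * √5) : ℝ) : ℂ))) ^ (1 / 4 : ℂ) /
      (((2 : ℝ) ^ (3 / 4 : ℝ) : ℝ) : ℂ)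

/-- The comultiplication of `2 + τ`. -/
def hopfComul : twoPlusTau ⟶ twoPlusTau ⊗ twoPlusTau where
  one := fun (x : T0 (Fin 2) Unit (Fin 2) Unit) (k : Fin 2) => match k, x with
    | 0, inl (0, 0) => 1
    | 1, inl (0, 0) => -((1 / (2 * φ) : ℝ) : ℂ)
    | 1, inl (0, 1) => ((1 / (2 * φ) : ℝ) : ℂ)
    | 1, inl (1, 0) => ((1 / (2 * φ) : ℝ) : ℂ)
    | 1, inl (1, 1) => ((√5 / (2 * φ) : ℝ) : ℂ)
    | 1, inr _ => coeffV
    | _, _ => 0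
  tau := fun (x : T1 (Fin 2) Unit (Fin 2) Unit) (_ : Unit) => match x with
    | inl (0, _) => ((1 / (2 * φ) : ℝ) : ℂ)
    | inl (1, _) => ((√5 / (2 * φ) : ℝ) : ℂ)
    | inr (inl (_, 0)) => ((1 / (2 * φ) : ℝ) : ℂ)
    | inr (inl (_, 1)) => ((√5 / (2 * φ) : ℝ) : ℂ)
    | inr (inr _) => -coeffU

/-- The unit of `2 + τ`. -/
def hopfUnit : 𝟙_ Fib ⟶ twoPlusTau where
  one := fun (k : Fin 2) (_ : Unit) => match k with
    | 0 => 1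
    | 1 => 0
  tau := 0

/-- The counit of `2 + τ`. -/
def hopfCounit : twoPlusTau ⟶ 𝟙_ Fib where
  one := fun _ _ => 1
  tau := 0

/-- The antipode of `2 + τ`. -/
def hopfAntipode : twoPlusTau ⟶ twoPlusTau where
  one := 1
  tau := fun _ _ =>
    -(((φ⁻¹ / 2 : ℝ) : ℂ) +
      (((5 : ℝ) ^ (1 / 4 : ℝ) * φ ^ (1 / 2 : ℝ) / 2 : ℝ) : ℂ) * Complex.I)

/-- The action of `2 + τ` on `𝟏` through the counit. -/
def action0 : twoPlusTau ⊗ 𝟙_ Fib ⟶ 𝟙_ Fib :=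
  (ρ_ twoPlusTau).hom ≫ hopfCounit

/-- The first action of `2 + τ` on `τ`. -/
def action1 : twoPlusTau ⊗ tauObj ⟶ tauObj where
  one := 0
  tau := fun (_ : Unit) (x : T1 (Fin 2) Unit Empty Unit) => match x with
    | inl _ => 1
    | inr (inl _) => 0
    | inr (inr _) => 0

/-- The second action of `2 + τ` on `τ`. -/
def action2 : twoPlusTau ⊗ tauObj ⟶ tauObj where
  one := 0
  tau := fun (_ : Unit) (x : T1 (Fin 2) Unit Empty Unit) => match x with
    | inl (0, _) => 1
    | inl (1, _) => -1
    | inr (inl _) => 0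
    | inr (inr _) => ((√2 * φ ^ (1 / 4 : ℝ) : ℝ) : ℂ)

/-- The action of `2 + τ` on `𝟏 + τ`. -/
def action3 : twoPlusTau ⊗ onePlusTau ⟶ onePlusTau where
  one := fun (_ : Unit) (x : T0 (Fin 2) Unit Unit Unit) => match x with
    | inl (0, _) => 1
    | inl (1, _) => -1
    | inr _ => 1
  tau := fun (_ : Unit) (x : T1 (Fin 2) Unit Unit Unit) => match x with
    | inl (0, _) => 1
    | inl (1, _) => -1
    | inr (inl _) => 2
    | inr (inr _) => -(((4 * √5 - 8) ^ (1 / 4 : ℝ) : ℝ) : ℂ)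

end Fib

end

/-! Every constant of the statement is a polynomial in `p` = φ⁻¹, `q` = φ^(-1/2), `w` = √2 φ^(-3/4)
and `Rt` = e^(3πi/5): V is `p * Rt`, U is `(Rt + 1) * q * w / 2`, and the antipode acts on τ by `-(p
+ Rt)`, which is the inverse of `Rt`. The only relations needed are p² = 1 - p, q² = p, w² = 2pq,
Rt² = -p Rt - 1 and R1 = Rt². Morphisms are pairs of matrices, so each Hopf axiom, applied to a
generic vector, is a list of polynomial identities modulo these relations.

Uniqueness. In a basis 1, x of the two copies of 𝟏 with 1 the unit and ε(x) = 0, the unit and counit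
laws leave ten numbers: x² = a x, xτ = b τ, τx = c τ and u, v for ττ → τ, x; dually d, f, g, h, e
for the comultiplication. Associativity, coassociativity and five coefficients of the bialgebra law
determine the products k = ad, m = ev, n = uh, which do not change when x and τ are rescaled
(`param_solve`). The antipode serves to exclude a degenerate branch. Rescaling x and τ then brings
any solution to one normal form. H has the same normal form by the same argument, which gives the
isomorphism.

Center. H = 𝟏 ⊕ τ ⊗ τ is the coend of the objects U* ⊗ U over the category: it carries a natural
coaction U → U ⊗ H through which H represents natural families U ⊗ X → U ⊗ Y (`UniversalCoaction`).
A half-braiding on X, composed with the braiding, is a natural family U ⊗ X → U ⊗ X, hence a map r :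
H ⊗ X → X. The hexagon becomes associativity of r, composition of families becomes Δ, and
invertibility comes from the antipode. So modules and objects of the center are the same data, and
the tensor products agree because Δ encodes two successive half-braidings. For Fib it is enough to
look at 𝟏 and τ (`eq_of_coactAct_eq`, `exists_eq_coactAct`).

Modules. A module consists of five matrices: the actions G₀, G₁ of the second copy of 𝟏 and the
actions C, D, E of τ, subject to `IsAction`. Both G₀ and G₁ are involutions, and the
eigenprojections (1 ± G)/2, refined by D C, split the identity into pieces factoring through M₀, M₁,
M₂, M₃ (`exists_factorsThrough`). Nonzero maps among these four are isomorphisms, and a Schur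
argument (`exists_bicone`, `simple_of_bicones`) yields semisimplicity and the classification of
simple modules. -/

noncomputable section

open scoped Matrix Kronecker

set_option synthInstance.maxSize 1000
set_option linter.unusedSectionVars false
set_option linter.unusedSimpArgs false


/-! ### The structure constants as polynomials in `p`, `q`, `w`, `Rt` -/

namespace FibMat

local notation "φ" => Real.goldenRatio

/-- `√2 φ^(-3/4)`. -/
def w : ℂ := ((√2 * φ ^ (-(3 / 4) : ℝ) : ℝ) : ℂ)

/-- The imaginary part of `Rt`. -/
def sinR : ℝ := (5 : ℝ) ^ (1 / 4 : ℝ) * φ ^ (1 / 2 : ℝ) / 2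

theorem sinR_nonneg : 0 ≤ sinR := by
  have := Real.goldenRatio_pos
  rw [sinR]; positivity

theorem inv_golden_sq : (φ⁻¹ : ℝ) * φ⁻¹ = 1 - φ⁻¹ := by
  rw [Real.inv_goldenRatio]
  linear_combination Real.goldenConj_sq

theorem golden_eq : φ = 1 + φ⁻¹ := by
  have h : φ * φ⁻¹ = 1 := mul_inv_cancel₀ Real.goldenRatio_ne_zero
  linear_combination -φ * inv_golden_sq + (φ⁻¹ - 1 + 1 + 1) * h

theorem sqrt_five_eq : √5 = 1 + 2 * φ⁻¹ := by
  rw [Real.inv_goldenRatio, Real.goldenConj]; ring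

theorem sinR_sq : sinR * sinR = (3 + φ⁻¹) / 4 := by
  have h5 : (5 : ℝ) ^ (1 / 4 : ℝ) * (5 : ℝ) ^ (1 / 4 : ℝ) = √5 := by
    rw [← Real.rpow_add (by norm_num), Real.sqrt_eq_rpow]; norm_num
  have h6 : φ ^ (1 / 2 : ℝ) * φ ^ (1 / 2 : ℝ) = φ := by
    rw [← Real.rpow_add Real.goldenRatio_pos]; norm_num
  have h7 : φ * φ⁻¹ = 1 := mul_inv_cancel₀ Real.goldenRatio_ne_zero
  have h8 := golden_eq
  have h9 := sqrt_five_eq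
  rw [sinR]
  linear_combination (5 : ℝ) ^ (1 / 4 : ℝ) * (5 : ℝ) ^ (1 / 4 : ℝ) / 4 * h6 + φ / 4 * h5 +
    φ / 4 * h9 + h7 / 2 + h8 / 4

theorem golden_rpow_neg_half : φ ^ (-(1 / 2) : ℝ) = φ⁻¹ * φ ^ (1 / 2 : ℝ) := by
  rw [← Real.rpow_neg_one, ← Real.rpow_add Real.goldenRatio_pos]; norm_num

/-- V and the antipode are stated through real and imaginary parts; this identity turns both into
polynomials in `p` and `Rt`. -/
theorem Rt_eq : Rt = -(p / 2) + (sinR : ℂ) * Complex.I := by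
  have hc : Real.cos (3 * Real.pi / 5) = -(φ⁻¹ / 2) := by
    have h2 : Real.cos (3 * Real.pi / 5) = -Real.cos (2 * (Real.pi / 5)) := by
      rw [← Real.cos_pi_sub]; congr 1; ring
    rw [h2, Real.cos_two_mul, Real.cos_pi_div_five, Real.inv_goldenRatio, Real.goldenConj]
    have := Real.mul_self_sqrt (show (0:ℝ) ≤ 5 by norm_num)
    linear_combination (-1/8) * this
  have hs : Real.sin (3 * Real.pi / 5) = sinR := by
    -- The squares of the two sides agree by sin² + cos² = 1, so only the sign has to be known.
    have h0 : 0 ≤ Real.sin (3 * Real.pi / 5) :=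
      Real.sin_nonneg_of_nonneg_of_le_pi (by positivity) (by linarith [Real.pi_pos])
    rw [← abs_of_nonneg h0, ← abs_of_nonneg sinR_nonneg, ← sq_eq_sq_iff_abs_eq_abs]
    have h1 := Real.sin_sq_add_cos_sq (3 * Real.pi / 5)
    rw [hc] at h1
    have h2 := sinR_sq
    have h3 := inv_golden_sq
    linear_combination h1 - h2 - h3 / 4
  have h := Complex.exp_mul_I ((3 * Real.pi / 5 : ℝ) : ℂ)
  rw [← Complex.ofReal_cos, ← Complex.ofReal_sin, hc, hs] at h
  rw [Rt, p]
  convert h using 2 <;> push_cast <;> ring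

theorem w_mul_w : w * w = 2 * p * q := by
  have h : (√2 * φ ^ (-(3 / 4) : ℝ)) * (√2 * φ ^ (-(3 / 4) : ℝ)) = 2 * φ⁻¹ * √(φ⁻¹) := by
    have h1 : √2 * √2 = (2 : ℝ) := Real.mul_self_sqrt (by norm_num)
    have h2 : φ ^ (-(3 / 4) : ℝ) * φ ^ (-(3 / 4) : ℝ) = φ⁻¹ * √(φ⁻¹) := by
      rw [Real.sqrt_eq_rpow, ← Real.rpow_neg_one, ← Real.rpow_mul Real.goldenRatio_pos.le,
        ← Real.rpow_add Real.goldenRatio_pos, ← Real.rpow_add Real.goldenRatio_pos]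
      norm_num
    linear_combination φ ^ (-(3 / 4) : ℝ) * φ ^ (-(3 / 4) : ℝ) * h1 + 2 * h2
  simp only [w, p, q]; exact_mod_cast h

theorem p_ne : p ≠ 0 := by
  simp only [p]; exact_mod_cast inv_ne_zero Real.goldenRatio_ne_zero

theorem q_ne : q ≠ 0 := fun h => p_ne (by rw [← q_mul_q, h, zero_mul])

theorem w_ne : w ≠ 0 := fun h => by
  have := w_mul_w
  rw [h, zero_mul] at this
  exact mul_ne_zero (mul_ne_zero two_ne_zero p_ne) q_ne this.symm

theorem half_inv_golden : ((1 / (2 * φ) : ℝ) : ℂ) = p / 2 := by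
  rw [p, show (1 / (2 * φ) : ℝ) = φ⁻¹ / 2 by field_simp]; push_cast; rfl

theorem half_sqrt_five : ((√5 / (2 * φ) : ℝ) : ℂ) = (2 - p) / 2 := by
  have h : √5 / (2 * φ) = (2 - φ⁻¹) / 2 := by
    have h2 := inv_golden_sq
    rw [sqrt_five_eq, show (1 + 2 * φ⁻¹) / (2 * φ) = (1 + 2 * φ⁻¹) * φ⁻¹ / 2 by field_simp]
    linear_combination h2
  rw [h, p]; push_cast; rfl

theorem coeffV_eq : Fib.coeffV = p * Rt := by
  have h2 : (φ ^ (-2 : ℝ) : ℝ) = φ⁻¹ * φ⁻¹ := by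
    rw [← Real.rpow_neg_one, ← Real.rpow_add Real.goldenRatio_pos]; norm_num
  rw [Fib.coeffV, golden_rpow_neg_half, h2, Rt_eq, sinR, p]
  push_cast; ring

theorem antipode_coeff_eq : -(((φ⁻¹ / 2 : ℝ) : ℂ) +
      (((5 : ℝ) ^ (1 / 4 : ℝ) * φ ^ (1 / 2 : ℝ) / 2 : ℝ) : ℂ) * Complex.I) = -(p + Rt) := by
  rw [Rt_eq, sinR, p]
  push_cast; ring

theorem action2_coeff_eq : ((√2 * φ ^ (1 / 4 : ℝ) : ℝ) : ℂ) = (1 + p) * w := by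
  have h : φ ^ (1 / 4 : ℝ) = φ * φ ^ (-(3 / 4) : ℝ) := by
    rw [← Real.rpow_one_add' Real.goldenRatio_pos.le (by norm_num)]; norm_num
  have h1 : (1 + p : ℂ) = ((φ : ℝ) : ℂ) := by
    rw [p, ← Complex.ofReal_one, ← Complex.ofReal_add, ← golden_eq]
  rw [h, h1, w]; push_cast; ring

/-- Since 4√5 - 8 = 4φ⁻³, the radicand is the fourth power of the positive number √2 φ^(-3/4). -/
theorem action3_coeff_eq : (((4 * √5 - 8) ^ (1 / 4 : ℝ) : ℝ) : ℂ) = w := by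
  have h : 4 * √5 - 8 = (√2 * φ ^ (-(3 / 4) : ℝ)) ^ (4 : ℝ) := by
    have h1 : √2 ^ (4 : ℝ) = (4 : ℝ) := by
      rw [Real.sqrt_eq_rpow, ← Real.rpow_mul (by norm_num)]
      norm_num
    have h3 : (φ ^ (-(3 / 4) : ℝ)) ^ (4 : ℝ) = φ⁻¹ * φ⁻¹ * φ⁻¹ := by
      rw [← Real.rpow_neg_one, ← Real.rpow_mul Real.goldenRatio_pos.le,
        ← Real.rpow_add Real.goldenRatio_pos, ← Real.rpow_add Real.goldenRatio_pos]
      norm_num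
    have h2 := inv_golden_sq
    rw [Real.mul_rpow (by positivity) (Real.rpow_nonneg Real.goldenRatio_pos.le _), h1, h3,
      sqrt_five_eq]
    linear_combination (-4 * φ⁻¹ + 4) * h2
  have h0 : 0 ≤ √2 * φ ^ (-(3 / 4) : ℝ) :=
    mul_nonneg (by positivity) (Real.rpow_nonneg Real.goldenRatio_pos.le _)
  rw [h, ← Real.rpow_mul h0, w]
  norm_num

/-- A principal fourth root is identified by two facts: the candidate has the right fourth power,
and its argument lies in (-π/4, π/4]. -/
theorem coeffU_eq : Fib.coeffU = (Rt + 1) * q * w / 2 := by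
  have hp0 : (0 : ℝ) < φ⁻¹ := inv_pos.2 Real.goldenRatio_pos
  set a : ℝ := (2 : ℝ) ^ (3 / 4 : ℝ) with ha
  have ha0 : 0 < a := by rw [ha]; positivity
  have ha4 : (a : ℂ) ^ 4 = 8 := by
    have : a ^ (4 : ℕ) = 8 := by
      rw [ha, ← Real.rpow_natCast, ← Real.rpow_mul (by norm_num)]; norm_num
    exact_mod_cast this
  -- The candidate root, obtained by solving the definition of `coeffU` for the root; `a` is
  -- 2^(3/4).
  set z : ℂ := -Complex.I * a * ((Rt + 1) * q * w / 2) with hz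
  have hz4 : z ^ 4 = 5 * (((-9 + 4 * √5 : ℝ) : ℂ) -
      Complex.I * ((√(1525 - 682 * √5) : ℝ) : ℂ)) := by
    have hs : √(1525 - 682 * √5) = 2 * φ⁻¹ ^ 8 * sinR := by
      -- With √5 = 1 + 2p the left side is 843 - 1364p, which is p¹⁶(3 + p); the factor 3 + p comes
      -- from `sinR_sq`.
      have h3 : 1525 - 682 * √5 = (2 * φ⁻¹ ^ 8 * sinR) ^ 2 := by
        have h2 := inv_golden_sq
        have h4 := sinR_sq
        rw [sqrt_five_eq]
        grind
      rw [h3, Real.sqrt_sq (mul_nonneg (by positivity) sinR_nonneg)]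
    have e1 : z ^ 4 = 10 * p ^ 7 * (-p * Rt - 1) := by
      have hI : Complex.I ^ 4 = 1 := Complex.I_pow_four
      have : z ^ 4 = Complex.I ^ 4 * (a : ℂ) ^ 4 * ((Rt + 1) ^ 4 * (q * q) ^ 2 * (w * w) ^ 2 / 16) := by
        rw [hz]; ring
      rw [this, hI, ha4, w_mul_w, q_mul_q]
      have hR := Rt_sq
      have hp := p_mul_p
      have hq := q_mul_q
      -- (Rt + 1)² = (2 - p) Rt and (2 - p)² = 5p²; the last factor is Rt² in reduced form.
      have h1 : (Rt + 1) ^ 4 = 5 * p ^ 2 * (-p * Rt - 1) := by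
        grind
      rw [h1]
      linear_combination (10 : ℂ) * p ^ 6 * (-p * Rt - 1) * hq
    rw [e1, hs, sqrt_five_eq, Rt_eq]
    have hp := p_mul_p
    have hpc : ((φ⁻¹ : ℝ) : ℂ) = p := rfl
    push_cast [-Complex.ofReal_inv]
    rw [hpc]
    have h7 : p ^ 7 = 13 * p - 8 := by grind
    have h8 : p ^ 8 = 13 - 21 * p := by grind
    have h9 : p ^ 9 = 34 * p - 21 := by grind
    linear_combination 5 * h9 - 10 * h7
  have harg : Complex.arg z = -(Real.pi / 5) := by
    have hw : (0 : ℝ) < √2 * φ ^ (-(3 / 4) : ℝ) :=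
      mul_pos (by positivity) (Real.rpow_pos_of_pos Real.goldenRatio_pos _)
    have hc : 0 < Real.cos (3 * Real.pi / 10) :=
      Real.cos_pos_of_mem_Ioo ⟨by linarith [Real.pi_pos], by linarith [Real.pi_pos]⟩
    have hz' : z = ((a * (√(φ⁻¹) * (√2 * φ ^ (-(3 / 4) : ℝ))) * Real.cos (3 * Real.pi / 10) : ℝ) : ℂ) *
        (Complex.cos (-(Real.pi / 5) : ℝ) + Complex.sin (-(Real.pi / 5) : ℝ) * Complex.I) := by
      -- Half-angle formula: e^(iθ) + 1 = 2 cos(θ/2) e^(iθ/2). The factor -i then shifts the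
      -- argument 3π/10 to -π/5.
      have h1 : Rt + 1 = Complex.exp (3 * Real.pi / 10 * Complex.I) *
          (2 * Complex.cos (3 * Real.pi / 10)) := by
        rw [Complex.two_cos, mul_add, ← Complex.exp_add, ← Complex.exp_add, Rt]
        congr 1
        · congr 1; ring
        · rw [← Complex.exp_zero]; congr 1; ring
      have h2 : -Complex.I * Complex.exp (3 * Real.pi / 10 * Complex.I) =
          Complex.exp ((-(Real.pi / 5) : ℝ) * Complex.I) := by
        rw [← Complex.exp_neg_pi_div_two_mul_I, ← Complex.exp_add]
        congr 1; push_cast; ring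
      rw [← Complex.exp_mul_I, ← h2, hz, h1, w, q]
      push_cast
      ring
    rw [hz', Complex.arg_mul_cos_add_sin_mul_I (by positivity)
      ⟨by linarith [Real.pi_pos], by linarith [Real.pi_pos]⟩]
  have hroot : (5 * (((-9 + 4 * √5 : ℝ) : ℂ) -
      Complex.I * ((√(1525 - 682 * √5) : ℝ) : ℂ))) ^ (1 / 4 : ℂ) = z := by
    rw [← hz4]
    have := Complex.pow_cpow_ofNat_inv (x := z) (n := 4) (by rw [harg]; norm_num; linarith [Real.pi_pos])
      (by rw [harg]; norm_num; linarith [Real.pi_pos])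
    rw [one_div]; exact this
  rw [Fib.coeffU, hroot, hz]
  have ha0' : (a : ℂ) ≠ 0 := by exact_mod_cast ha0.ne'
  field_simp
  rw [Complex.I_sq]; ring

end FibMat

/-! ### The Hopf axioms of `2 + τ` as matrix identities -/

namespace FibMat

open Matrix Sum

section TensorMu

variable (A₀ A₁ B₀ B₁ C₀ C₁ D₀ D₁ : Type)
  [Fintype A₀] [Fintype A₁] [Fintype B₀] [Fintype B₁] [Fintype C₀] [Fintype C₁]
  [Fintype D₀] [Fintype D₁]
  [DecidableEq A₀] [DecidableEq A₁] [DecidableEq B₀] [DecidableEq B₁]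
  [DecidableEq C₀] [DecidableEq C₁] [DecidableEq D₀] [DecidableEq D₁]

/-- The `𝟏`-part of `tensorμ A B C D`. -/
def mu0 : Matrix (T0 (T0 A₀ A₁ C₀ C₁) (T1 A₀ A₁ C₀ C₁) (T0 B₀ B₁ D₀ D₁) (T1 B₀ B₁ D₀ D₁))
    (T0 (T0 A₀ A₁ B₀ B₁) (T1 A₀ A₁ B₀ B₁) (T0 C₀ C₁ D₀ D₁) (T1 C₀ C₁ D₀ D₁)) ℂ :=
  assocInv0 A₀ A₁ C₀ C₁ (T0 B₀ B₁ D₀ D₁) (T1 B₀ B₁ D₀ D₁) *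
    ten0 (1 : Matrix A₀ A₀ ℂ) (1 : Matrix A₁ A₁ ℂ) (assoc0 C₀ C₁ B₀ B₁ D₀ D₁)
      (assoc1 C₀ C₁ B₀ B₁ D₀ D₁) *
    ten0 (1 : Matrix A₀ A₀ ℂ) (1 : Matrix A₁ A₁ ℂ)
      (ten0 (braid0 B₀ B₁ C₀ C₁ R1) (braid1 B₀ B₁ C₀ C₁ Rt) (1 : Matrix D₀ D₀ ℂ)
        (1 : Matrix D₁ D₁ ℂ))
      (ten1 (braid0 B₀ B₁ C₀ C₁ R1) (braid1 B₀ B₁ C₀ C₁ Rt) (1 : Matrix D₀ D₀ ℂ)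
        (1 : Matrix D₁ D₁ ℂ)) *
    ten0 (1 : Matrix A₀ A₀ ℂ) (1 : Matrix A₁ A₁ ℂ) (assocInv0 B₀ B₁ C₀ C₁ D₀ D₁)
      (assocInv1 B₀ B₁ C₀ C₁ D₀ D₁) *
    assoc0 A₀ A₁ B₀ B₁ (T0 C₀ C₁ D₀ D₁) (T1 C₀ C₁ D₀ D₁)

/-- The `τ`-part of `tensorμ A B C D`. -/
def mu1 : Matrix (T1 (T0 A₀ A₁ C₀ C₁) (T1 A₀ A₁ C₀ C₁) (T0 B₀ B₁ D₀ D₁) (T1 B₀ B₁ D₀ D₁))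
    (T1 (T0 A₀ A₁ B₀ B₁) (T1 A₀ A₁ B₀ B₁) (T0 C₀ C₁ D₀ D₁) (T1 C₀ C₁ D₀ D₁)) ℂ :=
  assocInv1 A₀ A₁ C₀ C₁ (T0 B₀ B₁ D₀ D₁) (T1 B₀ B₁ D₀ D₁) *
    ten1 (1 : Matrix A₀ A₀ ℂ) (1 : Matrix A₁ A₁ ℂ) (assoc0 C₀ C₁ B₀ B₁ D₀ D₁)
      (assoc1 C₀ C₁ B₀ B₁ D₀ D₁) *
    ten1 (1 : Matrix A₀ A₀ ℂ) (1 : Matrix A₁ A₁ ℂ)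
      (ten0 (braid0 B₀ B₁ C₀ C₁ R1) (braid1 B₀ B₁ C₀ C₁ Rt) (1 : Matrix D₀ D₀ ℂ)
        (1 : Matrix D₁ D₁ ℂ))
      (ten1 (braid0 B₀ B₁ C₀ C₁ R1) (braid1 B₀ B₁ C₀ C₁ Rt) (1 : Matrix D₀ D₀ ℂ)
        (1 : Matrix D₁ D₁ ℂ)) *
    ten1 (1 : Matrix A₀ A₀ ℂ) (1 : Matrix A₁ A₁ ℂ) (assocInv0 B₀ B₁ C₀ C₁ D₀ D₁)
      (assocInv1 B₀ B₁ C₀ C₁ D₀ D₁) *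
    assoc1 A₀ A₁ B₀ B₁ (T0 C₀ C₁ D₀ D₁) (T1 C₀ C₁ D₀ D₁)

end TensorMu

/-! The matrices of the structure maps of `2 + τ`: `M`, `D`, `E`, `N`, `S` stand for the
multiplication, the comultiplication, the counit, the unit and the antipode. -/

def M0 : Matrix (Fin 2) (T0 (Fin 2) Unit (Fin 2) Unit) ℂ
  | 0 => Pi.single (inl (0, 0)) 1 + Pi.single (inl (1, 1)) 1 + Pi.single (inr ((), ())) 1
  | 1 => Pi.single (inl (0, 1)) 1 + Pi.single (inl (1, 0)) 1 - Pi.single (inr ((), ())) 1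

def M1 : Matrix Unit (T1 (Fin 2) Unit (Fin 2) Unit) ℂ
  | _ => Pi.single (inl (0, ())) 1 - Pi.single (inl (1, ())) 1 + Pi.single (inr (inl ((), 0))) 1 -
      Pi.single (inr (inl ((), 1))) 1 - Pi.single (inr (inr ((), ()))) w

def D0 : Matrix (T0 (Fin 2) Unit (Fin 2) Unit) (Fin 2) ℂ
  | inl (0, 0) => Pi.single 0 1 - Pi.single 1 (p / 2)
  | inl (0, 1) => Pi.single 1 (p / 2)
  | inl (1, 0) => Pi.single 1 (p / 2)
  | inl (1, 1) => Pi.single 1 ((2 - p) / 2)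
  | inr _ => Pi.single 1 (p * Rt)

def D1 : Matrix (T1 (Fin 2) Unit (Fin 2) Unit) Unit ℂ
  | inl (0, _) => Pi.single () (p / 2)
  | inl (1, _) => Pi.single () ((2 - p) / 2)
  | inr (inl (_, 0)) => Pi.single () (p / 2)
  | inr (inl (_, 1)) => Pi.single () ((2 - p) / 2)
  | inr (inr _) => Pi.single () (-((Rt + 1) * q * w / 2))

def E0 : Matrix Unit (Fin 2) ℂ
  | _ => Pi.single 0 1 + Pi.single 1 1

def E1 : Matrix Empty Unit ℂ := 0

def N0 : Matrix (Fin 2) Unit ℂ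
  | 0 => Pi.single () 1
  | 1 => 0

def N1 : Matrix Unit Empty ℂ := 0

def S0 : Matrix (Fin 2) (Fin 2) ℂ := 1

def S1 : Matrix Unit Unit ℂ
  | _ => Pi.single () (-(p + Rt))

theorem hopfMul_eq : Fib.hopfMul = ⟨M0, M1⟩ := by
  refine Fib.hom_ext (funext fun i => funext fun j => ?_) (funext fun i => funext fun j => ?_)
  · revert i j
    change ∀ (i : Fin 2) (j : T0 (Fin 2) Unit (Fin 2) Unit), _
    simp [Fin.forall_fin_two, Fib.hopfMul, M0, Pi.single_apply]
  · revert i j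
    change ∀ (i : Unit) (j : T1 (Fin 2) Unit (Fin 2) Unit), _
    simp [Fin.forall_fin_two, Fib.hopfMul, M1, Pi.single_apply]
    simp [w]

theorem hopfComul_eq : Fib.hopfComul = ⟨D0, D1⟩ := by
  refine Fib.hom_ext (funext fun i => funext fun j => ?_) (funext fun i => funext fun j => ?_)
  · revert i j
    change ∀ (i : T0 (Fin 2) Unit (Fin 2) Unit) (j : Fin 2), _
    simp only [Sum.forall, Prod.forall, Fin.forall_fin_two, Fib.hopfComul, half_inv_golden,
      half_sqrt_five, coeffV_eq]
    simp [D0, Pi.single_apply]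
  · revert i j
    change ∀ (i : T1 (Fin 2) Unit (Fin 2) Unit) (j : Unit), _
    simp only [Sum.forall, Prod.forall, Fin.forall_fin_two, Fib.hopfComul, half_inv_golden,
      half_sqrt_five, coeffU_eq]
    simp [D1, Pi.single_apply]

theorem hopfCounit_eq : Fib.hopfCounit = ⟨E0, E1⟩ := by
  refine Fib.hom_ext (funext fun i => funext fun j => ?_) rfl
  revert i j
  change ∀ (i : Unit) (j : Fin 2), _
  simp [Fib.hopfCounit, Fin.forall_fin_two, E0]

theorem hopfUnit_eq : Fib.hopfUnit = ⟨N0, N1⟩ := by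
  refine Fib.hom_ext (funext fun i => funext fun j => ?_) rfl
  revert i j
  change ∀ (i : Fin 2) (j : Unit), _
  simp [Fib.hopfUnit, Fin.forall_fin_two, N0]

theorem hopfAntipode_eq : Fib.hopfAntipode = ⟨S0, S1⟩ := by
  refine Fib.hom_ext rfl (funext fun i => funext fun j => ?_)
  simp only [Fib.hopfAntipode, antipode_coeff_eq]
  exact (Pi.single_eq_same (M := fun _ : Unit => ℂ) () _).symm

/-- The rewriting rules behind all verifications: applied to a generic vector, each axiom turns into
polynomial identities in `p`, `q`, `w`, `Rt`, which `grind` closes with the defining relations. -/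
theorem hopf_act :
    (∀ v : T0 (Fin 2) Unit (Fin 2) Unit → ℂ,
      (M0 *ᵥ v) 0 = v (inl (0, 0)) + v (inl (1, 1)) + v (inr ((), ()))) ∧
    (∀ v : T0 (Fin 2) Unit (Fin 2) Unit → ℂ,
      (M0 *ᵥ v) 1 = v (inl (0, 1)) + v (inl (1, 0)) - v (inr ((), ()))) ∧
    (∀ (v : T1 (Fin 2) Unit (Fin 2) Unit → ℂ) (i : Unit),
      (M1 *ᵥ v) i = v (inl (0, ())) - v (inl (1, ())) + v (inr (inl ((), 0))) -
        v (inr (inl ((), 1))) - w * v (inr (inr ((), ())))) ∧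
    (∀ v : Fin 2 → ℂ, (D0 *ᵥ v) (inl (0, 0)) = v 0 - p / 2 * v 1) ∧
    (∀ v : Fin 2 → ℂ, (D0 *ᵥ v) (inl (0, 1)) = p / 2 * v 1) ∧
    (∀ v : Fin 2 → ℂ, (D0 *ᵥ v) (inl (1, 0)) = p / 2 * v 1) ∧
    (∀ v : Fin 2 → ℂ, (D0 *ᵥ v) (inl (1, 1)) = (2 - p) / 2 * v 1) ∧
    (∀ (v : Fin 2 → ℂ) (i), (D0 *ᵥ v) (inr i) = p * Rt * v 1) ∧
    (∀ (v : Unit → ℂ) (i), (D1 *ᵥ v) (inl (0, i)) = p / 2 * v ()) ∧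
    (∀ (v : Unit → ℂ) (i), (D1 *ᵥ v) (inl (1, i)) = (2 - p) / 2 * v ()) ∧
    (∀ (v : Unit → ℂ) (i), (D1 *ᵥ v) (inr (inl (i, 0))) = p / 2 * v ()) ∧
    (∀ (v : Unit → ℂ) (i), (D1 *ᵥ v) (inr (inl (i, 1))) = (2 - p) / 2 * v ()) ∧
    (∀ (v : Unit → ℂ) (i), (D1 *ᵥ v) (inr (inr i)) = -((Rt + 1) * q * w / 2) * v ()) ∧
    (∀ (v : Fin 2 → ℂ) (i : Unit), (E0 *ᵥ v) i = v 0 + v 1) ∧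
    (∀ (v : Unit → ℂ), (N0 *ᵥ v) 0 = v ()) ∧
    (∀ (v : Unit → ℂ), (N0 *ᵥ v) 1 = 0) ∧
    (∀ (v : Empty → ℂ) i, (N1 *ᵥ v) i = 0) ∧
    (∀ (v : Fin 2 → ℂ) i, (S0 *ᵥ v) i = v i) ∧
    (∀ (v : Unit → ℂ) i, (S1 *ᵥ v) i = -(p + Rt) * v ()) := by
  refine ⟨?_, ?_, ?_, ?_, ?_, ?_, ?_, ?_, ?_, ?_, ?_, ?_, ?_, ?_, ?_, ?_, by simp [N1], ?_, ?_⟩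
  all_goals
    intros
    simp only [mulVec, M0, M1, D0, D1, E0, N0, N1, S0, S1, Matrix.zero_apply, add_dotProduct, sub_dotProduct,
      single_dotProduct, zero_dotProduct, one_mul]
  exact congrFun (one_mulVec _) _

theorem hopf_assoc0 :
    M0 * ten0 M0 M1 (1 : Matrix (Fin 2) (Fin 2) ℂ) (1 : Matrix Unit Unit ℂ) =
    M0 * ten0 (1 : Matrix (Fin 2) (Fin 2) ℂ) (1 : Matrix Unit Unit ℂ) M0 M1 *
      assoc0 (Fin 2) Unit (Fin 2) Unit (Fin 2) Unit := by
  refine ext_act fun v => Fin.forall_fin_two.2 ⟨?_, ?_⟩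
  all_goals simp only [act_comb, act_scal, one_mulVec, ← mulVec_mulVec, ten_act, assoc_act, hopf_act]
  all_goals grind

theorem hopf_assoc1 :
    M1 * ten1 M0 M1 (1 : Matrix (Fin 2) (Fin 2) ℂ) (1 : Matrix Unit Unit ℂ) =
    M1 * ten1 (1 : Matrix (Fin 2) (Fin 2) ℂ) (1 : Matrix Unit Unit ℂ) M0 M1 *
      assoc1 (Fin 2) Unit (Fin 2) Unit (Fin 2) Unit := by
  refine ext_act fun v i => ?_
  simp only [act_comb, act_scal, one_mulVec, ← mulVec_mulVec, ten_act, assoc_act, hopf_act]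
  grind [p_mul_p, q_mul_q, w_mul_w]

theorem hopf_coassoc0 :
    ten0 (1 : Matrix (Fin 2) (Fin 2) ℂ) (1 : Matrix Unit Unit ℂ) D0 D1 * D0 =
    assoc0 (Fin 2) Unit (Fin 2) Unit (Fin 2) Unit * ten0 D0 D1 (1 : Matrix (Fin 2) (Fin 2) ℂ) (1 : Matrix Unit Unit ℂ) * D0 := by
  refine ext_act fun v => ?_
  simp only [Sum.forall, Prod.forall, Fin.forall_fin_two, Unique.forall_iff, forall_const,
    act_comb, act_scal, one_mulVec, ← mulVec_mulVec, mu0, mu1, ten_act, assoc_act, assocInv_act,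
    braid_act, unit_act, hopf_act]
  and_intros <;> grind [p_mul_p, q_mul_q, w_mul_w, R1_eq, Rt_sq]

theorem hopf_bimon0 :
    D0 * M0 =
    ten0 M0 M1 M0 M1 * mu0 (Fin 2) Unit (Fin 2) Unit (Fin 2) Unit (Fin 2) Unit * ten0 D0 D1 D0 D1 := by
  refine ext_act fun v => ?_
  simp only [Sum.forall, Prod.forall, Fin.forall_fin_two, Unique.forall_iff, forall_const,
    act_comb, act_scal, one_mulVec, ← mulVec_mulVec, mu0, mu1, ten_act, assoc_act, assocInv_act,
    braid_act, unit_act, hopf_act]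
  and_intros <;> grind [p_mul_p, q_mul_q, w_mul_w, R1_eq, Rt_sq]

theorem hopf_antipode_left0 :
    M0 * ten0 S0 S1 (1 : Matrix (Fin 2) (Fin 2) ℂ) (1 : Matrix Unit Unit ℂ) * D0 =
    N0 * E0 := by
  refine ext_act fun v => Fin.forall_fin_two.2 ⟨?_, ?_⟩
  all_goals simp only [act_comb, act_scal, one_mulVec, ← mulVec_mulVec, mu0, mu1, ten_act, assoc_act, assocInv_act,
    braid_act, unit_act, hopf_act]
  all_goals grind [p_mul_p, q_mul_q, w_mul_w, R1_eq, Rt_sq]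

theorem hopf_antipode_right0 :
    M0 * ten0 (1 : Matrix (Fin 2) (Fin 2) ℂ) (1 : Matrix Unit Unit ℂ) S0 S1 * D0 =
    N0 * E0 := by
  refine ext_act fun v => Fin.forall_fin_two.2 ⟨?_, ?_⟩
  all_goals simp only [act_comb, act_scal, one_mulVec, ← mulVec_mulVec, mu0, mu1, ten_act, assoc_act, assocInv_act,
    braid_act, unit_act, hopf_act]
  all_goals grind [p_mul_p, q_mul_q, w_mul_w, R1_eq, Rt_sq]

theorem hopf_one_mul0 :
    M0 * ten0 N0 N1 (1 : Matrix (Fin 2) (Fin 2) ℂ) (1 : Matrix Unit Unit ℂ) =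
    lunit0 (Fin 2) Unit := by
  refine ext_act fun v => Fin.forall_fin_two.2 ⟨?_, ?_⟩
  all_goals simp only [act_comb, act_scal, one_mulVec, ← mulVec_mulVec, mu0, mu1, ten_act, assoc_act, assocInv_act,
    braid_act, unit_act, hopf_act]
  all_goals grind [p_mul_p, q_mul_q, w_mul_w, R1_eq, Rt_sq]

theorem hopf_mul_one0 :
    M0 * ten0 (1 : Matrix (Fin 2) (Fin 2) ℂ) (1 : Matrix Unit Unit ℂ) N0 N1 =
    runit0 (Fin 2) Unit := by
  refine ext_act fun v => Fin.forall_fin_two.2 ⟨?_, ?_⟩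
  all_goals simp only [act_comb, act_scal, one_mulVec, ← mulVec_mulVec, mu0, mu1, ten_act, assoc_act, assocInv_act,
    braid_act, unit_act, hopf_act]
  all_goals grind [p_mul_p, q_mul_q, w_mul_w, R1_eq, Rt_sq]

theorem hopf_counit_comul0 :
    ten0 E0 E1 (1 : Matrix (Fin 2) (Fin 2) ℂ) (1 : Matrix Unit Unit ℂ) * D0 =
    lunitInv0 (Fin 2) Unit := by
  refine ext_act fun v => ?_
  simp only [IsEmpty.forall_iff, Sum.forall, Prod.forall, Fin.forall_fin_two, Unique.forall_iff, forall_const,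
    act_comb, act_scal, one_mulVec, ← mulVec_mulVec, mu0, mu1, ten_act, assoc_act, assocInv_act,
    braid_act, unit_act, hopf_act]
  and_intros <;> grind [p_mul_p, q_mul_q, w_mul_w, R1_eq, Rt_sq]

theorem hopf_comul_counit0 :
    ten0 (1 : Matrix (Fin 2) (Fin 2) ℂ) (1 : Matrix Unit Unit ℂ) E0 E1 * D0 =
    runitInv0 (Fin 2) Unit := by
  refine ext_act fun v => ?_
  simp only [IsEmpty.forall_iff, Sum.forall, Prod.forall, Fin.forall_fin_two, Unique.forall_iff, forall_const,
    act_comb, act_scal, one_mulVec, ← mulVec_mulVec, mu0, mu1, ten_act, assoc_act, assocInv_act,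
    braid_act, unit_act, hopf_act]
  and_intros <;> grind [p_mul_p, q_mul_q, w_mul_w, R1_eq, Rt_sq]

theorem hopf_coassoc1 :
    ten1 (1 : Matrix (Fin 2) (Fin 2) ℂ) (1 : Matrix Unit Unit ℂ) D0 D1 * D1 =
    assoc1 (Fin 2) Unit (Fin 2) Unit (Fin 2) Unit * ten1 D0 D1 (1 : Matrix (Fin 2) (Fin 2) ℂ) (1 : Matrix Unit Unit ℂ) * D1 := by
  refine ext_act fun v => ?_
  simp only [Sum.forall, Prod.forall, Fin.forall_fin_two, Unique.forall_iff, forall_const,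
    act_comb, act_scal, one_mulVec, ← mulVec_mulVec, mu0, mu1, ten_act, assoc_act, assocInv_act,
    braid_act, unit_act, hopf_act]
  and_intros <;> grind [p_mul_p, q_mul_q, w_mul_w, R1_eq, Rt_sq]

theorem hopf_bimon1 :
    D1 * M1 =
    ten1 M0 M1 M0 M1 * mu1 (Fin 2) Unit (Fin 2) Unit (Fin 2) Unit (Fin 2) Unit * ten1 D0 D1 D0 D1 := by
  refine ext_act fun v => ?_
  simp only [Sum.forall, Prod.forall, Fin.forall_fin_two, Unique.forall_iff, forall_const,
    act_comb, act_scal, one_mulVec, ← mulVec_mulVec, mu0, mu1, ten_act, assoc_act, assocInv_act,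
    braid_act, unit_act, hopf_act]
  and_intros <;> grind [p_mul_p, q_mul_q, w_mul_w, R1_eq, Rt_sq]

theorem hopf_antipode_left1 :
    M1 * ten1 S0 S1 (1 : Matrix (Fin 2) (Fin 2) ℂ) (1 : Matrix Unit Unit ℂ) * D1 =
    N1 * E1 := by
  refine ext_act fun v i => ?_
  all_goals simp only [act_comb, act_scal, one_mulVec, ← mulVec_mulVec, mu0, mu1, ten_act, assoc_act, assocInv_act,
    braid_act, unit_act, hopf_act]
  all_goals grind [p_mul_p, q_mul_q, w_mul_w, R1_eq, Rt_sq]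

theorem hopf_antipode_right1 :
    M1 * ten1 (1 : Matrix (Fin 2) (Fin 2) ℂ) (1 : Matrix Unit Unit ℂ) S0 S1 * D1 =
    N1 * E1 := by
  refine ext_act fun v i => ?_
  all_goals simp only [act_comb, act_scal, one_mulVec, ← mulVec_mulVec, mu0, mu1, ten_act, assoc_act, assocInv_act,
    braid_act, unit_act, hopf_act]
  all_goals grind [p_mul_p, q_mul_q, w_mul_w, R1_eq, Rt_sq]

theorem hopf_one_mul1 :
    M1 * ten1 N0 N1 (1 : Matrix (Fin 2) (Fin 2) ℂ) (1 : Matrix Unit Unit ℂ) =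
    lunit1 (Fin 2) Unit := by
  refine ext_act fun v i => ?_
  all_goals simp only [act_comb, act_scal, one_mulVec, ← mulVec_mulVec, mu0, mu1, ten_act, assoc_act, assocInv_act,
    braid_act, unit_act, hopf_act]
  all_goals grind [p_mul_p, q_mul_q, w_mul_w, R1_eq, Rt_sq]

theorem hopf_mul_one1 :
    M1 * ten1 (1 : Matrix (Fin 2) (Fin 2) ℂ) (1 : Matrix Unit Unit ℂ) N0 N1 =
    runit1 (Fin 2) Unit := by
  refine ext_act fun v i => ?_
  all_goals simp only [act_comb, act_scal, one_mulVec, ← mulVec_mulVec, mu0, mu1, ten_act, assoc_act, assocInv_act,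
    braid_act, unit_act, hopf_act]
  all_goals grind [p_mul_p, q_mul_q, w_mul_w, R1_eq, Rt_sq]

theorem hopf_counit_comul1 :
    ten1 E0 E1 (1 : Matrix (Fin 2) (Fin 2) ℂ) (1 : Matrix Unit Unit ℂ) * D1 =
    lunitInv1 (Fin 2) Unit := by
  refine ext_act fun v => ?_
  simp only [IsEmpty.forall_iff, Sum.forall, Prod.forall, Fin.forall_fin_two, Unique.forall_iff, forall_const,
    act_comb, act_scal, one_mulVec, ← mulVec_mulVec, mu0, mu1, ten_act, assoc_act, assocInv_act,
    braid_act, unit_act, hopf_act]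
  and_intros <;> grind [p_mul_p, q_mul_q, w_mul_w, R1_eq, Rt_sq]

theorem hopf_comul_counit1 :
    ten1 (1 : Matrix (Fin 2) (Fin 2) ℂ) (1 : Matrix Unit Unit ℂ) E0 E1 * D1 =
    runitInv1 (Fin 2) Unit := by
  refine ext_act fun v => ?_
  simp only [IsEmpty.forall_iff, Sum.forall, Prod.forall, Fin.forall_fin_two, Unique.forall_iff, forall_const,
    act_comb, act_scal, one_mulVec, ← mulVec_mulVec, mu0, mu1, ten_act, assoc_act, assocInv_act,
    braid_act, unit_act, hopf_act]
  and_intros <;> grind [p_mul_p, q_mul_q, w_mul_w, R1_eq, Rt_sq]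

theorem hopf_one_comul0 : D0 * N0 = ten0 N0 N1 N0 N1 * lunitInv0 Unit Empty := by
  refine ext_act fun v => ?_
  simp only [Sum.forall, Prod.forall, Fin.forall_fin_two, Unique.forall_iff, forall_const,
    ← mulVec_mulVec, ten_act, unit_act, hopf_act]
  and_intros <;> grind

theorem hopf_one_comul1 : D1 * N1 = ten1 N0 N1 N0 N1 * lunitInv1 Unit Empty :=
  Matrix.ext fun _ i => i.elim

theorem hopf_mul_counit0 : E0 * M0 = lunit0 Unit Empty * ten0 E0 E1 E0 E1 := by
  refine ext_act fun v i => ?_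
  simp only [← mulVec_mulVec, ten_act, unit_act, hopf_act]
  grind

theorem hopf_mul_counit1 : E1 * M1 = lunit1 Unit Empty * ten1 E0 E1 E0 E1 :=
  Matrix.ext fun i => i.elim

theorem hopf_one_counit0 : E0 * N0 = 1 := by
  refine ext_act fun v i => ?_
  simp only [← mulVec_mulVec, one_mulVec, hopf_act, add_zero]

theorem hopf_one_counit1 : E1 * N1 = 1 := Matrix.ext fun i => i.elim

end FibMat

/-! ### The Hopf algebra `2 + τ` -/

namespace Fib

open FibMat

/-- The monoid `2 + τ`. -/
@[reducible] def monObjTwoPlusTau : MonObj twoPlusTau where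
  one := hopfUnit
  mul := hopfMul
  one_mul := by rw [hopfUnit_eq, hopfMul_eq]; exact hom_ext hopf_one_mul0 hopf_one_mul1
  mul_one := by rw [hopfUnit_eq, hopfMul_eq]; exact hom_ext hopf_mul_one0 hopf_mul_one1
  mul_assoc := by rw [hopfMul_eq]; exact hom_ext hopf_assoc0 hopf_assoc1

attribute [local instance] monObjTwoPlusTau

/-- The comonoid `2 + τ`. -/
@[reducible] def comonObjTwoPlusTau : ComonObj twoPlusTau where
  counit := hopfCounit
  comul := hopfComul
  counit_comul := by
    rw [hopfCounit_eq, hopfComul_eq]; exact hom_ext hopf_counit_comul0 hopf_counit_comul1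
  comul_counit := by
    rw [hopfCounit_eq, hopfComul_eq]; exact hom_ext hopf_comul_counit0 hopf_comul_counit1
  comul_assoc := by rw [hopfComul_eq]; exact hom_ext hopf_coassoc0 hopf_coassoc1

attribute [local instance] comonObjTwoPlusTau

/-- The bimonoid `2 + τ`. -/
@[reducible] def bimonObjTwoPlusTau : BimonObj twoPlusTau where
  mul_comul := by
    change hopfMul ≫ hopfComul = _ ≫ _ ≫ (hopfMul ⊗ₘ hopfMul)
    change _ = (hopfComul ⊗ₘ hopfComul) ≫ _
    rw [hopfMul_eq, hopfComul_eq]; exact hom_ext hopf_bimon0 hopf_bimon1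
  one_comul := by
    change hopfUnit ≫ hopfComul = (λ_ _).inv ≫ (hopfUnit ⊗ₘ hopfUnit)
    rw [hopfUnit_eq, hopfComul_eq]; exact hom_ext hopf_one_comul0 hopf_one_comul1
  mul_counit := by
    change hopfMul ≫ hopfCounit = (hopfCounit ⊗ₘ hopfCounit) ≫ (λ_ _).hom
    rw [hopfMul_eq, hopfCounit_eq]; exact hom_ext hopf_mul_counit0 hopf_mul_counit1
  one_counit := by
    change hopfUnit ≫ hopfCounit = 𝟙 _
    rw [hopfUnit_eq, hopfCounit_eq]; exact hom_ext hopf_one_counit0 hopf_one_counit1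

attribute [local instance] bimonObjTwoPlusTau

/-- The Hopf monoid `2 + τ`. -/
@[reducible] def hopfObjTwoPlusTau : HopfObj twoPlusTau where
  antipode := hopfAntipode
  antipode_left := by
    change hopfComul ≫ hopfAntipode ▷ _ ≫ hopfMul = hopfCounit ≫ hopfUnit
    rw [hopfUnit_eq, hopfComul_eq, hopfMul_eq, hopfCounit_eq, hopfAntipode_eq]
    exact hom_ext hopf_antipode_left0 hopf_antipode_left1
  antipode_right := by
    change hopfComul ≫ _ ◁ hopfAntipode ≫ hopfMul = hopfCounit ≫ hopfUnit
    rw [hopfUnit_eq, hopfComul_eq, hopfMul_eq, hopfCounit_eq, hopfAntipode_eq]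
    exact hom_ext hopf_antipode_right0 hopf_antipode_right1

end Fib

/-! ### Structure maps with ten free parameters -/

namespace FibMat

open Matrix Sum

/-! Structure maps on `2 + τ` in a basis `1, x` of the two copies of `𝟏` where `ε(x) = 0`. -/

/-- Row 0 has a single entry because the counit is multiplicative and kills x and τ: no product of x
with x or of τ with τ has a component along the unit. -/
def pM0 (a v : ℂ) : Matrix (Fin 2) (T0 (Fin 2) Unit (Fin 2) Unit) ℂ
  | 0 => Pi.single (inl (0, 0)) 1
  | 1 => Pi.single (inl (0, 1)) 1 + Pi.single (inl (1, 0)) 1 + Pi.single (inl (1, 1)) a +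
      Pi.single (inr ((), ())) v

def pM1 (b c u : ℂ) : Matrix Unit (T1 (Fin 2) Unit (Fin 2) Unit) ℂ
  | _ => Pi.single (inl (0, ())) 1 + Pi.single (inl (1, ())) b + Pi.single (inr (inl ((), 0))) 1 +
      Pi.single (inr (inl ((), 1))) c + Pi.single (inr (inr ((), ()))) u

/-- Dual to the multiplication: Δ(x) has x ⊗ 1 and 1 ⊗ x with coefficient 1 by the counit laws, and
no term 1 ⊗ 1 because ε(x) = 0. -/
def pD0 (d e : ℂ) : Matrix (T0 (Fin 2) Unit (Fin 2) Unit) (Fin 2) ℂ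
  | inl (0, 0) => Pi.single 0 1
  | inl (0, 1) => Pi.single 1 1
  | inl (1, 0) => Pi.single 1 1
  | inl (1, 1) => Pi.single 1 d
  | inr _ => Pi.single 1 e

def pD1 (f g h : ℂ) : Matrix (T1 (Fin 2) Unit (Fin 2) Unit) Unit ℂ
  | inl (0, _) => Pi.single () 1
  | inl (1, _) => Pi.single () f
  | inr (inl (_, 0)) => Pi.single () 1
  | inr (inl (_, 1)) => Pi.single () g
  | inr (inr _) => Pi.single () h

variable (a b c d e f g h u v : ℂ)

theorem param_act :
    (∀ y : T0 (Fin 2) Unit (Fin 2) Unit → ℂ, (pM0 a v *ᵥ y) 0 = y (inl (0, 0))) ∧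
    (∀ y : T0 (Fin 2) Unit (Fin 2) Unit → ℂ,
      (pM0 a v *ᵥ y) 1 = y (inl (0, 1)) + y (inl (1, 0)) + a * y (inl (1, 1)) +
        v * y (inr ((), ()))) ∧
    (∀ (y : T1 (Fin 2) Unit (Fin 2) Unit → ℂ) (i : Unit),
      (pM1 b c u *ᵥ y) i = y (inl (0, ())) + b * y (inl (1, ())) + y (inr (inl ((), 0))) +
        c * y (inr (inl ((), 1))) + u * y (inr (inr ((), ())))) ∧
    (∀ y : Fin 2 → ℂ, (pD0 d e *ᵥ y) (inl (0, 0)) = y 0) ∧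
    (∀ y : Fin 2 → ℂ, (pD0 d e *ᵥ y) (inl (0, 1)) = y 1) ∧
    (∀ y : Fin 2 → ℂ, (pD0 d e *ᵥ y) (inl (1, 0)) = y 1) ∧
    (∀ y : Fin 2 → ℂ, (pD0 d e *ᵥ y) (inl (1, 1)) = d * y 1) ∧
    (∀ (y : Fin 2 → ℂ) (i), (pD0 d e *ᵥ y) (inr i) = e * y 1) ∧
    (∀ (y : Unit → ℂ) (i), (pD1 f g h *ᵥ y) (inl (0, i)) = y ()) ∧
    (∀ (y : Unit → ℂ) (i), (pD1 f g h *ᵥ y) (inl (1, i)) = f * y ()) ∧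
    (∀ (y : Unit → ℂ) (i), (pD1 f g h *ᵥ y) (inr (inl (i, 0))) = y ()) ∧
    (∀ (y : Unit → ℂ) (i), (pD1 f g h *ᵥ y) (inr (inl (i, 1))) = g * y ()) ∧
    (∀ (y : Unit → ℂ) (i), (pD1 f g h *ᵥ y) (inr (inr i)) = h * y ()) := by
  refine ⟨?_, ?_, ?_, ?_, ?_, ?_, ?_, ?_, ?_, ?_, ?_, ?_, ?_⟩
  all_goals
    intros
    simp only [mulVec, pM0, pM1, pD0, pD1, add_dotProduct, sub_dotProduct, single_dotProduct,
      one_mul]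
end FibMat

/-! ### Transport of a Hopf algebra along an isomorphism -/

section Transport

universe v u

variable {C : Type u} [Category.{v} C] [MonoidalCategory C] [BraidedCategory C]

open MonObj ComonObj

/-- A Hopf algebra structure transported along an isomorphism. -/
abbrev transportHopf {B X : C} [HopfObj B] (e : B ≅ X) : HopfObj X where
  one := η[B] ≫ e.hom
  mul := (e.inv ⊗ₘ e.inv) ≫ μ[B] ≫ e.hom
  counit := e.inv ≫ ε[B]
  comul := e.inv ≫ Δ[B] ≫ (e.hom ⊗ₘ e.hom)
  antipode := e.inv ≫ HopfObj.antipode ≫ e.hom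
  one_mul := by
    have h := MonObj.one_mul B
    -- Pre- or postcomposing with copies of `e` cancels every `e.inv`, so the law reduces to the one
    -- of `B`; the other laws involving tensor powers are treated alike.
    rw [← cancel_epi (𝟙_ C ◁ e.hom)]
    simp only [← tensorHom_id, ← id_tensorHom] at h ⊢
    simp only [tensorHom_comp_tensorHom_assoc, tensorHom_comp_tensorHom, Category.assoc,
      Iso.hom_inv_id, Iso.inv_hom_id, Category.comp_id, Category.id_comp, id_tensorHom_id,
      Iso.hom_inv_id_assoc, Iso.inv_hom_id_assoc]
    simp only [reassoc_of% h, id_tensorHom, leftUnitor_naturality]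
  mul_one := by
    have h := MonObj.mul_one B
    rw [← cancel_epi (e.hom ▷ 𝟙_ C)]
    simp only [← tensorHom_id, ← id_tensorHom] at h ⊢
    simp only [tensorHom_comp_tensorHom_assoc, tensorHom_comp_tensorHom, Category.assoc,
      Iso.hom_inv_id, Iso.inv_hom_id, Category.comp_id, Category.id_comp, id_tensorHom_id,
      Iso.hom_inv_id_assoc, Iso.inv_hom_id_assoc]
    simp only [reassoc_of% h, tensorHom_id, rightUnitor_naturality]
  mul_assoc := by
    rw [← cancel_epi ((e.hom ⊗ₘ e.hom) ⊗ₘ e.hom)]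
    have h := MonObj.mul_assoc B
    simp only [← tensorHom_id, ← id_tensorHom] at h ⊢
    simp only [tensorHom_comp_tensorHom_assoc, tensorHom_comp_tensorHom, Category.assoc,
      Iso.hom_inv_id, Iso.inv_hom_id, Category.comp_id, Category.id_comp, id_tensorHom_id,
      Iso.hom_inv_id_assoc, Iso.inv_hom_id_assoc, associator_naturality_assoc]
    rw [reassoc_of% h]
  counit_comul := by
    have h := ComonObj.counit_comul B
    rw [← cancel_mono (𝟙_ C ◁ e.inv), ← cancel_epi e.hom]
    simp only [← tensorHom_id, ← id_tensorHom] at h ⊢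
    simp only [tensorHom_comp_tensorHom_assoc, tensorHom_comp_tensorHom, Category.assoc,
      Iso.hom_inv_id, Iso.inv_hom_id, Category.comp_id, Category.id_comp, id_tensorHom_id,
      Iso.hom_inv_id_assoc, Iso.inv_hom_id_assoc]
    simp only [h, id_tensorHom, ← leftUnitor_inv_naturality, Iso.hom_inv_id_assoc]
  comul_counit := by
    have h := ComonObj.comul_counit B
    rw [← cancel_mono (e.inv ▷ 𝟙_ C), ← cancel_epi e.hom]
    simp only [← tensorHom_id, ← id_tensorHom] at h ⊢
    simp only [tensorHom_comp_tensorHom_assoc, tensorHom_comp_tensorHom, Category.assoc,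
      Iso.hom_inv_id, Iso.inv_hom_id, Category.comp_id, Category.id_comp, id_tensorHom_id,
      Iso.hom_inv_id_assoc, Iso.inv_hom_id_assoc]
    simp only [h, tensorHom_id, ← rightUnitor_inv_naturality, Iso.hom_inv_id_assoc]
  comul_assoc := by
    rw [← cancel_mono (e.inv ⊗ₘ (e.inv ⊗ₘ e.inv)), ← cancel_epi e.hom]
    have h := ComonObj.comul_assoc B
    simp only [← tensorHom_id, ← id_tensorHom] at h ⊢
    simp only [tensorHom_comp_tensorHom_assoc, tensorHom_comp_tensorHom, Category.assoc,
      Iso.hom_inv_id, Iso.inv_hom_id, Category.comp_id, Category.id_comp, id_tensorHom_id,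
      Iso.hom_inv_id_assoc, Iso.inv_hom_id_assoc, ← associator_naturality]
    exact h
  mul_comul := by
    have h := BimonObj.mul_comul B
    rw [← cancel_epi (e.hom ⊗ₘ e.hom), ← cancel_mono (e.inv ⊗ₘ e.inv)]
    simp only [tensorHom_comp_tensorHom_assoc, tensorHom_comp_tensorHom, Category.assoc,
      Iso.hom_inv_id, Iso.inv_hom_id, Category.comp_id, Category.id_comp, id_tensorHom_id,
      Iso.hom_inv_id_assoc, Iso.inv_hom_id_assoc]
    rw [← tensorHom_comp_tensorHom, Category.assoc, tensorμ_natural_assoc]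
    simp only [tensorHom_comp_tensorHom, tensorHom_comp_tensorHom_assoc, Iso.hom_inv_id,
      id_tensorHom_id, Category.id_comp, ← h]
  one_comul := by
    have h : η[B] ≫ Δ[B] = (λ_ (𝟙_ C)).inv ≫ (η[B] ⊗ₘ η[B]) := BimonObj.one_comul B
    change (η[B] ≫ e.hom) ≫ e.inv ≫ Δ[B] ≫ _ = (λ_ (𝟙_ C)).inv ≫ (η[B] ≫ e.hom ⊗ₘ η[B] ≫ e.hom)
    simp only [tensorHom_comp_tensorHom_assoc, tensorHom_comp_tensorHom, Category.assoc,
      Iso.hom_inv_id, Iso.inv_hom_id, Category.comp_id, Category.id_comp, id_tensorHom_id,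
      Iso.hom_inv_id_assoc, Iso.inv_hom_id_assoc, reassoc_of% h]
  mul_counit := by
    have h : μ[B] ≫ ε[B] = (ε[B] ⊗ₘ ε[B]) ≫ (λ_ (𝟙_ C)).hom := BimonObj.mul_counit B
    change ((e.inv ⊗ₘ e.inv) ≫ μ[B] ≫ e.hom) ≫ e.inv ≫ ε[B] =
      (e.inv ≫ ε[B] ⊗ₘ e.inv ≫ ε[B]) ≫ (λ_ (𝟙_ C)).hom
    simp only [tensorHom_comp_tensorHom_assoc, tensorHom_comp_tensorHom, Category.assoc,
      Iso.hom_inv_id, Iso.inv_hom_id, Category.comp_id, Category.id_comp, id_tensorHom_id,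
      Iso.hom_inv_id_assoc, Iso.inv_hom_id_assoc, h]
  one_counit := by simp
  antipode_left := by
    have h := HopfObj.antipode_left B
    simp only [← tensorHom_id, ← id_tensorHom] at h ⊢
    simp only [tensorHom_comp_tensorHom_assoc, tensorHom_comp_tensorHom, Category.assoc,
      Iso.hom_inv_id, Iso.inv_hom_id, Category.comp_id, Category.id_comp, id_tensorHom_id,
      Iso.hom_inv_id_assoc, Iso.inv_hom_id_assoc, reassoc_of% h]
  antipode_right := by
    have h := HopfObj.antipode_right B
    simp only [← tensorHom_id, ← id_tensorHom] at h ⊢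
    simp only [tensorHom_comp_tensorHom_assoc, tensorHom_comp_tensorHom, Category.assoc,
      Iso.hom_inv_id, Iso.inv_hom_id, Category.comp_id, Category.id_comp, id_tensorHom_id,
      Iso.hom_inv_id_assoc, Iso.inv_hom_id_assoc, reassoc_of% h]

end Transport

/-! ### Equations between the ten parameters -/

namespace FibMat

open Matrix Sum

variable {a b c d e f g h u v : ℂ}

/-- The associativity equations. -/
theorem param_assoc
    (H0 : pM0 a v * ten0 (pM0 a v) (pM1 b c u) (1 : Matrix (Fin 2) (Fin 2) ℂ)
        (1 : Matrix Unit Unit ℂ) =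
      pM0 a v * ten0 (1 : Matrix (Fin 2) (Fin 2) ℂ) (1 : Matrix Unit Unit ℂ) (pM0 a v)
        (pM1 b c u) * assoc0 (Fin 2) Unit (Fin 2) Unit (Fin 2) Unit)
    (H1 : pM1 b c u * ten1 (pM0 a v) (pM1 b c u) (1 : Matrix (Fin 2) (Fin 2) ℂ)
        (1 : Matrix Unit Unit ℂ) =
      pM1 b c u * ten1 (1 : Matrix (Fin 2) (Fin 2) ℂ) (1 : Matrix Unit Unit ℂ) (pM0 a v)
        (pM1 b c u) * assoc1 (Fin 2) Unit (Fin 2) Unit (Fin 2) Unit) :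
    v * b = a * v ∧ a * v = v * c ∧ b * a = b * b ∧ c * a = c * c ∧ u * b = u * c ∧
      b * v = c * v * p + u * u * q := by
  have K0 := fun y => congrFun (congrArg (· *ᵥ y) H0) 1
  have K1 := fun y => congrFun (congrArg (· *ᵥ y) H1) ()
  simp only [act_comb, act_scal, one_mulVec, ← mulVec_mulVec, ten_act, assoc_act,
    param_act a b c 0 0 0 0 0 u v] at K0 K1
  -- Each test vector is one triple product: (xτ)τ, (ττ)x, (xx)τ, (τx)x, (xτ)τ, (τx)τ, (ττ)τ, (ττ)x.
  -- Only the seventh, through the summand 𝟏 of ττ, meets the F-matrix; it yields the last equation.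
  have k1 := K0 (Pi.single (inr (inl (1, ()), ())) 1)
  have k2 := K0 (Pi.single (inl (inr ((), ()), 1)) 1)
  have k3 := K1 (Pi.single (inl (inl (1, 1), ())) 1)
  have k4 := K1 (Pi.single (inr (inl (inr (inl ((), 1)), 1))) 1)
  have k5 := K1 (Pi.single (inr (inr (inl (1, ()), ()))) 1)
  have k6 := K1 (Pi.single (inr (inr (inr (inl ((), 1)), ()))) 1)
  have k7 := K1 (Pi.single (inl (inr ((), ()), ())) 1)
  have k8 := K1 (Pi.single (inr (inl (inr (inr ((), ())), 1))) 1)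
  clear K0 K1 H0 H1
  simp [Pi.single_apply] at k1 k2 k3 k4 k5 k6 k7 k8
  grind

/-- The coassociativity equations. -/
theorem param_coassoc
    (H0 : ten0 (1 : Matrix (Fin 2) (Fin 2) ℂ) (1 : Matrix Unit Unit ℂ) (pD0 d e) (pD1 f g h) *
        pD0 d e =
      assoc0 (Fin 2) Unit (Fin 2) Unit (Fin 2) Unit * ten0 (pD0 d e) (pD1 f g h)
        (1 : Matrix (Fin 2) (Fin 2) ℂ) (1 : Matrix Unit Unit ℂ) * pD0 d e)
    (H1 : ten1 (1 : Matrix (Fin 2) (Fin 2) ℂ) (1 : Matrix Unit Unit ℂ) (pD0 d e) (pD1 f g h) *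
        pD1 f g h =
      assoc1 (Fin 2) Unit (Fin 2) Unit (Fin 2) Unit * ten1 (pD0 d e) (pD1 f g h)
        (1 : Matrix (Fin 2) (Fin 2) ℂ) (1 : Matrix Unit Unit ℂ) * pD1 f g h) :
    e * f = d * e ∧ e * g = d * e ∧ f * f = d * f ∧ g * g = d * g ∧ h * f = h * g ∧
      f * e = g * e * p + h * h * q := by
  -- The sources are x and τ alone, so one input vector for each already gives all coefficients.
  have K0 := fun i => congrFun (congrArg (· *ᵥ Pi.single 1 1) H0) i
  have K1 := fun i => congrFun (congrArg (· *ᵥ fun _ => 1) H1) i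
  simp only [act_comb, act_scal, one_mulVec, ← mulVec_mulVec, ten_act, assoc_act,
    param_act 0 0 0 d e f g h 0 0, Sum.forall, Prod.forall, Fin.forall_fin_two, Unique.forall_iff,
    Pi.single_eq_same, mul_one] at K0 K1
  clear H0 H1
  grind

/-- The bialgebra equations. -/
theorem param_bimon
    (H0 : pD0 d e * pM0 a v = ten0 (pM0 a v) (pM1 b c u) (pM0 a v) (pM1 b c u) *
      mu0 (Fin 2) Unit (Fin 2) Unit (Fin 2) Unit (Fin 2) Unit *
        ten0 (pD0 d e) (pD1 f g h) (pD0 d e) (pD1 f g h))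
    (H1 : pD1 f g h * pM1 b c u = ten1 (pM0 a v) (pM1 b c u) (pM0 a v) (pM1 b c u) *
      mu1 (Fin 2) Unit (Fin 2) Unit (Fin 2) Unit (Fin 2) Unit *
        ten1 (pD0 d e) (pD1 f g h) (pD0 d e) (pD1 f g h)) :
    d * a = 2 + 4 * (a * d) + a * a * (d * d) + v * v * (e * e) * (p * p * R1 + p * Rt) ∧
    e * a = 2 * (b + c) * e + (b * b + c * c) * (e * d) + u * u * (e * e) * (p * q * (R1 - Rt)) ∧
    e * v = R1 * (1 + b * f) * (1 + c * g) + (1 + b * g) * (1 + c * f) +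
      u * h * (Rt * (1 + b * f) + (1 + c * f) + (1 + b * g) + Rt * (1 + c * g)) +
      u * u * (h * h) * (p * R1 + p * p * Rt) ∧
    f * b = b * f + 1 + b * d + a * f * (1 + b * d) + v * e * (p * p * R1 + p * Rt) * (1 + c * g) +
      v * e * (u * h) * (p * p * (Rt + R1 + p * Rt)) ∧
    h * u = Rt * (1 + b * f) * (1 + c * g) + (1 + b * g) * (1 + c * f) +
      u * h * ((p * R1 + p * p * Rt) * (2 + b * f + c * g) - p * (2 + b * g + c * f)) +
      u * u * (h * h) * (p * Rt + p * p * p * p * Rt + p * p * p * R1) := by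
  have K0 := fun y i => congrFun (congrArg (· *ᵥ y) H0) i
  have K1 := fun y i => congrFun (congrArg (· *ᵥ y) H1) i
  simp only [act_comb, act_scal, one_mulVec, ← mulVec_mulVec, mu0, mu1, ten_act, assoc_act,
    assocInv_act, braid_act, unit_act, param_act a b c d e f g h u v] at K0 K1
  -- Five matrix entries of the bialgebra law determine everything: xx → xx, xx → ττ, ττ → ττ
  -- through 𝟏, xτ → xτ, and ττ → ττ through τ.
  have k1 := K0 (Pi.single (inl (1, 1)) 1) (inl (1, 1))
  have k2 := K0 (Pi.single (inl (1, 1)) 1) (inr ((), ()))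
  have k3 := K0 (Pi.single (inr ((), ())) 1) (inr ((), ()))
  have k4 := K1 (Pi.single (inl (1, ())) 1) (inl (1, ()))
  have k5 := K1 (Pi.single (inr (inr ((), ()))) 1) (inr (inr ((), ())))
  clear K0 K1 H0 H1
  simp only [act_comb, act_scal, one_mulVec, ← mulVec_mulVec, mu0, mu1, ten_act, assoc_act,
    assocInv_act, braid_act, unit_act, param_act a b c d e f g h u v] at k1 k2 k3 k4 k5
  simp [Pi.single_apply] at k1 k2 k3 k4 k5
  have hq := q_mul_q
  refine ⟨?_, ?_, ?_, ?_, ?_⟩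
  · rw [k1]; grind
  · rw [k2]; grind
  · rw [k3]; grind
  · rw [k4]; grind
  · rw [k5]; grind

end FibMat

/-! ### Solving the equations -/

namespace FibMat

variable {a b c d e f g h u v : ℂ}

theorem Rt_ne_neg_one : Rt + 1 ≠ 0 := fun H => by
  have h1 := Rt_sq
  have h2 : Rt = -1 := by linear_combination H
  rw [h2] at h1
  have h3 : p = 2 := by linear_combination -h1
  have h4 := p_mul_p
  rw [h3] at h4
  norm_num at h4

theorem Rt_ne_one : Rt - 1 ≠ 0 := fun H => by
  have h1 := Rt_sq
  have h2 : Rt = 1 := by linear_combination H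
  rw [h2] at h1
  have h3 : p = -2 := by linear_combination h1
  have h4 := p_mul_p
  rw [h3] at h4
  norm_num at h4

/-- The solutions of the equations of a Hopf algebra structure on `2 + τ`. -/
theorem param_solve {s t : ℂ}
    (A : v * b = a * v ∧ a * v = v * c ∧ b * a = b * b ∧ c * a = c * c ∧ u * b = u * c ∧
      b * v = c * v * p + u * u * q)
    (B : e * f = d * e ∧ e * g = d * e ∧ f * f = d * f ∧ g * g = d * g ∧ h * f = h * g ∧
      f * e = g * e * p + h * h * q)
    (h1 : d * a = 2 + 4 * (a * d) + a * a * (d * d) + v * v * (e * e) * (p * p * R1 + p * Rt))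
    (h2 : e * a = 2 * (b + c) * e + (b * b + c * c) * (e * d) +
      u * u * (e * e) * (p * q * (R1 - Rt)))
    (h3 : e * v = R1 * (1 + b * f) * (1 + c * g) + (1 + b * g) * (1 + c * f) +
      u * h * (Rt * (1 + b * f) + (1 + c * f) + (1 + b * g) + Rt * (1 + c * g)) +
      u * u * (h * h) * (p * R1 + p * p * Rt))
    (h4 : f * b = b * f + 1 + b * d + a * f * (1 + b * d) +
      v * e * (p * p * R1 + p * Rt) * (1 + c * g) +
      v * e * (u * h) * (p * p * (Rt + R1 + p * Rt)))
    (h5 : h * u = Rt * (1 + b * f) * (1 + c * g) + (1 + b * g) * (1 + c * f) +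
      u * h * ((p * R1 + p * p * Rt) * (2 + b * f + c * g) - p * (2 + b * g + c * f)) +
      u * u * (h * h) * (p * Rt + p * p * p * p * Rt + p * p * p * R1))
    (hs : s + 1 + d * s * a + e * t * v = 0) :
    a ≠ 0 ∧ v ≠ 0 ∧ b = a ∧ c = a ∧ f = d ∧ g = d ∧ u * u = a * v * (p * q) ∧ a * d = p - 2 ∧
      e * v = -(p * Rt) ∧ u * h = p * p * (Rt + 1) := by
  obtain ⟨A1, A2, A3, A4, A5, A6⟩ := A
  obtain ⟨B1, B2, B3, B4, B5, B6⟩ := B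
  have hp := p_mul_p
  have hq := q_mul_q
  have hR := Rt_sq
  have hR1 := R1_eq
  have np := p_ne
  have nq := q_ne
  have nR := Rt_ne
  have nR1 := Rt_ne_neg_one
  have nR2 := Rt_ne_one
  -- the values of `b f`, `c g`, ... in the degenerate cases
  have key : u * h = 0 → e * v = 0 → False := by
    intro huh hev
    have E1 : R1 * ((1 + b * f) * (1 + c * g)) + (1 + b * g) * (1 + c * f) = 0 := by
      linear_combination -h3 + hev - (Rt * (1 + b * f) + (1 + c * f) + (1 + b * g) +
        Rt * (1 + c * g) + u * h * (p * R1 + p * p * Rt)) * huh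
    have E2 : Rt * ((1 + b * f) * (1 + c * g)) + (1 + b * g) * (1 + c * f) = 0 := by
      linear_combination -h5 + (1 - ((p * R1 + p * p * Rt) * (2 + b * f + c * g) -
        p * (2 + b * g + c * f)) - u * h * (p * Rt + p * p * p * p * Rt + p * p * p * R1)) * huh
    -- The two ττ-equations differ only in the coefficients R1 = Rt² and Rt of the same product, and
    -- Rt ≠ 0, 1.
    have E3 : (1 + b * f) * (1 + c * g) = 0 := by
      have : Rt * (Rt - 1) * ((1 + b * f) * (1 + c * g)) = 0 := by
        linear_combination E1 - E2 - hR1 * ((1 + b * f) * (1 + c * g))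
      simpa [nR, nR2] using this
    have E4 : 1 + a * d = 0 := by
      -- A vanishing factor forces both of its scalars to be nonzero; the relations b a = b b and f
      -- f = d f (or their mirror images) then identify them with `a` and `d`.
      have cancel : ∀ {x y z t : ℂ}, x * y = x * x → z * z = t * z → 1 + x * z = 0 →
          1 + y * t = 0 := by
        intro x y z t hxy hzt hxz
        have hx : x ≠ 0 := by rintro rfl; simp at hxz
        have hz : z ≠ 0 := by rintro rfl; simp at hxz
        rw [mul_left_cancel₀ hx hxy, ← mul_right_cancel₀ hz hzt]
        exact hxz
      rcases mul_eq_zero.1 E3 with H | H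
      · exact cancel A3 B3 H
      · exact cancel A4 B4 H
    -- The only use of the antipode: with ad = -1 and ev = 0 its equation reads 1 = 0. This discards
    -- degenerate solutions of the other equations.
    have : s * (1 + a * d) + 1 + e * v * t = 0 := by linear_combination hs
    rw [E4, hev] at this
    norm_num at this
  have hv : v ≠ 0 := by
    intro hv
    have : u = 0 := by
      have : u * u * q = 0 := by rw [hv] at A6; linear_combination -A6
      simpa [nq] using this
    exact key (by rw [this, zero_mul]) (by rw [hv, mul_zero])
  have he : e ≠ 0 := by
    intro he
    have : h = 0 := by
      have : h * h * q = 0 := by rw [he] at B6; linear_combination -B6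
      simpa [nq] using this
    exact key (by rw [this, mul_zero]) (by rw [he, zero_mul])
  -- Since `v` and `e` are nonzero, x acts and coacts on τ from both sides by the same scalars as on
  -- itself.
  have hb : b = a := mul_left_cancel₀ hv (by linear_combination A1)
  have hc : c = a := mul_left_cancel₀ hv (by linear_combination -A2)
  have hf : f = d := mul_left_cancel₀ he (by linear_combination B1)
  have hg : g = d := mul_left_cancel₀ he (by linear_combination B2)
  clear key hs A1 A2 A3 A4 A5 B1 B2 B3 B4 B5
  rw [hb, hc] at A6
  rw [hf, hg] at B6
  rw [hb, hc] at h2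
  rw [hb, hc, hf, hg] at h3 h5
  rw [hb, hc, hf, hg] at h4
  have U : u * u = a * v * (p * q) := mul_right_cancel₀ nq (by
    linear_combination -A6 - a * v * hp - a * v * p * hq)
  have W : h * h = e * d * (p * q) := mul_right_cancel₀ nq (by
    linear_combination -B6 - e * d * hp - e * d * p * hq)
  -- If a = 0 then u = 0, and the last bialgebra equation collapses to Rt + 1 = 0.
  have ha : a ≠ 0 := by
    intro ha
    have hu : u = 0 := by
      rw [ha] at U
      simpa using U
    rw [ha, hu] at h5
    exact nR1 (by linear_combination -h5)
  -- The three products are invariant under rescaling x and τ, and the remaining equations can be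
  -- written in them alone.
  obtain ⟨k, hk⟩ : ∃ k, k = a * d := ⟨_, rfl⟩
  obtain ⟨m, hm⟩ : ∃ m, m = e * v := ⟨_, rfl⟩
  obtain ⟨n, hn⟩ : ∃ n, n = u * h := ⟨_, rfl⟩
  have N : n * n = k * m * (p * p * p) := by
    rw [hk, hm, hn]
    linear_combination h * h * U + a * v * (p * q) * W + a * v * e * d * (p * p) * hq
  have K1 : k = 2 + 4 * k + k * k + m * m * (p * p * (Rt - 1)) := by
    rw [hk, hm]
    linear_combination h1 + v * v * (e * e) * (p * p * hR1 + p * p * hR + (-p * Rt) * hp)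
  have K2 : 3 + 2 * k + m * (p * p * p) * (Rt * Rt - Rt) = 0 := by
    rw [hk, hm]
    refine mul_left_cancel₀ (mul_ne_zero ha he) ?_
    linear_combination -h2 - e * e * (p * q * (R1 - Rt)) * U -
      a * v * (p * p) * (e * e) * (R1 - Rt) * hq - a * v * e * e * p * p * p * hR1
  have K4 : (1 + k) * (1 + k) + m * (p * p * (Rt - 1)) * (1 + k) +
      m * n * (p * p) * (Rt - 1) = 0 := by
    rw [hk, hm, hn]
    linear_combination -h4 - v * e * (1 + a * d) * (p * p * hR1 + p * p * hR + (-p * Rt) * hp) -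
      v * e * (u * h) * (p * p) * (hR1 + hR)
  rw [← hk, ← hm, ← hn]
  -- Gives the inverse of Rt² - Rt, by which `K2` is solved for `m`.
  have hz : p * Rt * (Rt * Rt - Rt) = 1 := by
    linear_combination (p * Rt - p * p - p) * hR + (p * Rt + 1) * hp
  clear hn hm hk h1 h2 h3 h4 h5 A6 B6 W
  -- Eliminating `m` between `K1` and `K2` leaves a quadratic equation for `k`, whose discriminant
  -- is a square because p³ = 2p - 1.
  have S : (2 * k + 3 - (2 * p - 1)) * (2 * k + 3 + (2 * p - 1)) = 0 := by
    have hp3 : p * p * p = 2 * p - 1 := by linear_combination (p - 1) * hp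
    have Y1 : (2 * k + 3) * (2 * k + 3) + (k * k + 3 * k + 2) * (p * p * p) = 0 := by
      linear_combination (2 * k + 3 - m * (p * p * p) * (Rt * Rt - Rt)) * K2 -
        p * p * p * K1 + m * m * (p * p * p * p * p) * (Rt - 1) * hz
    have Y2 : (3 + 2 * p) * (k * k + 3 * k + 2) + 1 = 0 := by
      linear_combination Y1 - (k * k + 3 * k + 2) * hp3
    linear_combination 4 * (2 * p - 1) * Y2 - (16 * (k * k + 3 * k + 2) + 4) * hp
  have hcase : k = p - 2 ∨ k = -1 - p := by
    rcases mul_eq_zero.1 S with H | H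
    · left; linear_combination H / 2
    · right; linear_combination H / 2
  rcases hcase with rfl | rfl
  · have M : m = -(p * Rt) := by
      have hp3 : p * p * p = 2 * p - 1 := by linear_combination (p - 1) * hp
      have : p * p * p * (m * (Rt * Rt - Rt) + 1) = 0 := by linear_combination K2 + hp3
      have : m * (Rt * Rt - Rt) + 1 = 0 := by simpa [np] using this
      linear_combination p * Rt * this - m * hz
    subst M
    refine ⟨ha, hv, hb, hc, hf, hg, U, rfl, rfl, ?_⟩
    have K : p * p * (n - p * p * (Rt + 1)) = 0 := by
      linear_combination -Rt * K4 - p * p * (p - 1 + n) * hz - (Rt * (p * p + 1 - p) + p * p) * hp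
    have : n - p * p * (Rt + 1) = 0 := by simpa [np] using K
    linear_combination this
  -- At the other root `m` and `n` are forced as well, but n² = k m p³ then makes Rt equal to -1/(2
  -- + p), against its quadratic equation.
  · exfalso
    have M : m = p * Rt := by
      have hp3 : p * p * p = 2 * p - 1 := by linear_combination (p - 1) * hp
      have : p * p * p * (m * (Rt * Rt - Rt) - 1) = 0 := by linear_combination K2 - hp3
      have : m * (Rt * Rt - Rt) - 1 = 0 := by simpa [np] using this
      linear_combination p * Rt * this - m * hz
    subst M
    have K : n = p - Rt := by
      have : p * p * (n - (p - Rt)) = 0 := by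
        linear_combination Rt * K4 - (n * p * p - p * p * p) * hz
      have : n - (p - Rt) = 0 := by simpa [np] using this
      linear_combination this
    rw [K] at N
    have L : Rt * (2 + p) + 1 = 0 := by
      have : p * (Rt * (2 + p) + 1) = 0 := by
        linear_combination -N + hR + (1 + Rt * (p * p * p) + p * Rt) * hp
      simpa [np] using this
    have h0 : p * 2 + 5 = 0 := by
      linear_combination (-(Rt * (2 + p)) + 1 - p*(2+p)) * L + (2 + p) * (2 + p) * hR
    have h1 : (1 : ℂ) = 0 := by
      linear_combination (4 / 11) * hp - (4 / 11) * (p / 2 - 3 / 4) * h0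
    norm_num at h1

end FibMat

/-! ### Reduction of an arbitrary structure to the ten parameters -/

namespace FibMat

open Matrix Sum

def pE0 : Matrix Unit (Fin 2) ℂ
  | _ => Pi.single 0 1

theorem unit_counit_act :
    (∀ (y : Fin 2 → ℂ) (i : Unit), (pE0 *ᵥ y) i = y 0) ∧
    (∀ (y : Unit → ℂ), (N0 *ᵥ y) 0 = y ()) ∧
    (∀ (y : Unit → ℂ), (N0 *ᵥ y) 1 = 0) ∧
    (∀ (y : Empty → ℂ) i, (N1 *ᵥ y) i = 0) := by
  refine ⟨?_, ?_, ?_, by simp [N1]⟩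
  all_goals
    intros
    simp only [mulVec, pE0, N0, single_dotProduct, zero_dotProduct, one_mul]

theorem sum_act {n : Type} (m : Matrix n (T0 (Fin 2) Unit (Fin 2) Unit) ℂ) (y) (k : n) :
    (m *ᵥ y) k = m k (inl (0, 0)) * y (inl (0, 0)) + m k (inl (0, 1)) * y (inl (0, 1)) +
      m k (inl (1, 0)) * y (inl (1, 0)) + m k (inl (1, 1)) * y (inl (1, 1)) +
      m k (inr ((), ())) * y (inr ((), ())) := by
  simp [mulVec, dotProduct, Fintype.sum_sum_type, Fintype.sum_prod_type, add_assoc]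

theorem sum_act' {n : Type} (m : Matrix n (T1 (Fin 2) Unit (Fin 2) Unit) ℂ) (y) (k : n) :
    (m *ᵥ y) k = m k (inl (0, ())) * y (inl (0, ())) + m k (inl (1, ())) * y (inl (1, ())) +
      m k (inr (inl ((), 0))) * y (inr (inl ((), 0))) +
      m k (inr (inl ((), 1))) * y (inr (inl ((), 1))) +
      m k (inr (inr ((), ()))) * y (inr (inr ((), ()))) := by
  simp [mulVec, dotProduct, Fintype.sum_sum_type, Fintype.sum_prod_type, add_assoc]

theorem sum_act2 {n : Type} (m : Matrix n (Fin 2) ℂ) (y) (k : n) :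
    (m *ᵥ y) k = m k 0 * y 0 + m k 1 * y 1 := by
  simp [mulVec, dotProduct]

theorem sum_act1 {n : Type} (m : Matrix n Unit ℂ) (y) (k : n) :
    (m *ᵥ y) k = m k () * y () := by
  simp [mulVec, dotProduct]

/-- The unit laws fix all coefficients with a factor 1, and multiplicativity of the counit removes
the unit component of xx and ττ; five numbers remain. -/
theorem mul_params (m0 : Matrix (Fin 2) (T0 (Fin 2) Unit (Fin 2) Unit) ℂ)
    (m1 : Matrix Unit (T1 (Fin 2) Unit (Fin 2) Unit) ℂ)
    (l0 : m0 * ten0 N0 N1 (1 : Matrix (Fin 2) (Fin 2) ℂ) (1 : Matrix Unit Unit ℂ) =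
      lunit0 (Fin 2) Unit)
    (l1 : m1 * ten1 N0 N1 (1 : Matrix (Fin 2) (Fin 2) ℂ) (1 : Matrix Unit Unit ℂ) =
      lunit1 (Fin 2) Unit)
    (r0 : m0 * ten0 (1 : Matrix (Fin 2) (Fin 2) ℂ) (1 : Matrix Unit Unit ℂ) N0 N1 =
      runit0 (Fin 2) Unit)
    (r1 : m1 * ten1 (1 : Matrix (Fin 2) (Fin 2) ℂ) (1 : Matrix Unit Unit ℂ) N0 N1 =
      runit1 (Fin 2) Unit)
    (e : pE0 * m0 = lunit0 Unit Empty * ten0 pE0 E1 pE0 E1) :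
    ∃ a b c u v, m0 = pM0 a v ∧ m1 = pM1 b c u := by
  have L0 := fun y k => congrFun (congrArg (· *ᵥ y) l0) k
  have L1 := fun y => congrFun (congrArg (· *ᵥ y) l1) ()
  have R0 := fun y k => congrFun (congrArg (· *ᵥ y) r0) k
  have R1 := fun y => congrFun (congrArg (· *ᵥ y) r1) ()
  have E := fun y => congrFun (congrArg (· *ᵥ y) e) ()
  simp only [← mulVec_mulVec, sum_act m0, sum_act' m1, ten_act, unit_act, unit_counit_act,
    one_mulVec, act_scal] at L0 L1 R0 R1 E
  have l00 := L0 (Pi.single (inl ((), 0)) 1)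
  have l01 := L0 (Pi.single (inl ((), 1)) 1)
  have l1 := L1 (Pi.single (inl ((), ())) 1)
  have r00 := R0 (Pi.single (inl (0, ())) 1)
  have r01 := R0 (Pi.single (inl (1, ())) 1)
  have r1 := R1 (Pi.single (inr (inl ((), ()))) 1)
  have e1 := E (Pi.single (inl (1, 1)) 1)
  have e2 := E (Pi.single (inr ((), ())) 1)
  simp only [Fin.forall_fin_two] at l00 l01 r00 r01
  simp [Pi.single_apply] at l00 l01 l1 r00 r01 r1 e1 e2
  refine ⟨m0 1 (inl (1, 1)), m1 () (inl (1, ())), m1 () (inr (inl ((), 1))),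
    m1 () (inr (inr ((), ()))), m0 1 (inr ((), ())), funext fun i => funext fun j => ?_,
    funext fun i => funext fun j => ?_⟩
  · revert i j
    simp [Fin.forall_fin_two, pM0, Pi.single_apply, *]
  · revert i j
    simp [Fin.forall_fin_two, pM1, Pi.single_apply, *]

/-- The dual count: the counit laws fix the coefficients with a factor 1 on either side, and Δ(1) =
1 ⊗ 1 fixes the column of the unit. -/
theorem comul_params (d0 : Matrix (T0 (Fin 2) Unit (Fin 2) Unit) (Fin 2) ℂ)
    (d1 : Matrix (T1 (Fin 2) Unit (Fin 2) Unit) Unit ℂ)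
    (l0 : ten0 pE0 E1 (1 : Matrix (Fin 2) (Fin 2) ℂ) (1 : Matrix Unit Unit ℂ) * d0 =
      lunitInv0 (Fin 2) Unit)
    (l1 : ten1 pE0 E1 (1 : Matrix (Fin 2) (Fin 2) ℂ) (1 : Matrix Unit Unit ℂ) * d1 =
      lunitInv1 (Fin 2) Unit)
    (r0 : ten0 (1 : Matrix (Fin 2) (Fin 2) ℂ) (1 : Matrix Unit Unit ℂ) pE0 E1 * d0 =
      runitInv0 (Fin 2) Unit)
    (r1 : ten1 (1 : Matrix (Fin 2) (Fin 2) ℂ) (1 : Matrix Unit Unit ℂ) pE0 E1 * d1 =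
      runitInv1 (Fin 2) Unit)
    (e : d0 * N0 = ten0 N0 N1 N0 N1 * lunitInv0 Unit Empty) :
    ∃ d e f g h, d0 = pD0 d e ∧ d1 = pD1 f g h := by
  have L0 := fun y k => congrFun (congrArg (· *ᵥ y) l0) k
  have L1 := fun y k => congrFun (congrArg (· *ᵥ y) l1) k
  have R0 := fun y k => congrFun (congrArg (· *ᵥ y) r0) k
  have R1 := fun y k => congrFun (congrArg (· *ᵥ y) r1) k
  have E := fun k => congrFun (congrArg (· *ᵥ fun _ => 1) e) k
  have l1' := L1 (fun _ => 1) (inl ((), ()))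
  have r1' := R1 (fun _ => 1) (inr (inl ((), ())))
  have l00 := fun k : Fin 2 => L0 (Pi.single 0 1) (inl ((), k))
  have l01 := fun k : Fin 2 => L0 (Pi.single 1 1) (inl ((), k))
  have r00 := fun k : Fin 2 => R0 (Pi.single 0 1) (inl (k, ()))
  have r01 := fun k : Fin 2 => R0 (Pi.single 1 1) (inl (k, ()))
  have e1 := E (inl (1, 1))
  have e2 := E (inr ((), ()))
  simp only [Fin.forall_fin_two] at l00 l01 r00 r01
  simp only [← mulVec_mulVec, sum_act2 d0, sum_act1 d1, ten_act, unit_act, unit_counit_act,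
    one_mulVec, act_scal] at l00 l01 l1' r00 r01 r1' e1 e2
  simp at l00 l01 l1' r00 r01 r1' e1 e2
  refine ⟨d0 (inl (1, 1)) 1, d0 (inr ((), ())) 1, d1 (inl (1, ())) (), d1 (inr (inl ((), 1))) (),
    d1 (inr (inr ((), ()))) (), funext fun i => funext fun j => ?_,
    funext fun i => funext fun j => ?_⟩
  · revert i j
    simp [Fin.forall_fin_two, pD0, Pi.single_apply, *]
  · revert i j
    simp [Fin.forall_fin_two, pD1, Pi.single_apply, *]

variable {a d e v : ℂ}

/-- The equation of the antipode on the second copy of `𝟏`. -/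
theorem param_antipode (s0 : Matrix (Fin 2) (Fin 2) ℂ) (s1 : Matrix Unit Unit ℂ)
    (H : pM0 a v * ten0 s0 s1 (1 : Matrix (Fin 2) (Fin 2) ℂ) (1 : Matrix Unit Unit ℂ) *
      pD0 d e = N0 * pE0)
    (Hu : s0 * N0 = N0) (He : pE0 * s0 = pE0) :
    ∃ s t, s + 1 + d * s * a + e * t * v = 0 := by
  -- An antipode preserves unit and counit, so its 𝟏-part is diagonal with entries 1 and `s`; on τ
  -- it is the scalar `t`.
  refine ⟨s0 1 1, s1 () (), ?_⟩
  have K := congrFun (congrArg (· *ᵥ Pi.single 1 1) H) 1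
  have U := congrFun (congrArg (· *ᵥ fun _ => 1) Hu)
  have E := congrFun (congrArg (· *ᵥ Pi.single 1 1) He) ()
  simp only [Fin.forall_fin_two] at U
  simp only [← mulVec_mulVec, sum_act2 s0, sum_act1 s1, ten_act, unit_act, unit_counit_act,
    one_mulVec, act_scal, param_act a 0 0 d e 0 0 0 0 v] at K U E
  simp at K U E
  simp [E, U.1, U.2] at K
  linear_combination K

end FibMat

/-! ### Rescaling to the normal form -/

namespace FibMat

open Matrix Sum

variable {a d e h u v : ℂ}

/-- Rescaling of the second copy of `𝟏`. -/
def scale0 (s : ℂ) : Matrix (Fin 2) (Fin 2) ℂ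
  | 0 => Pi.single 0 1
  | 1 => Pi.single 1 s

/-- Rescaling of `τ`. -/
def scale1 (t : ℂ) : Matrix Unit Unit ℂ
  | _ => Pi.single () t

theorem scale_act (s t : ℂ) : (∀ y : Fin 2 → ℂ, (scale0 s *ᵥ y) 0 = y 0) ∧
    (∀ y : Fin 2 → ℂ, (scale0 s *ᵥ y) 1 = s * y 1) ∧
    (∀ (y : Unit → ℂ) i, (scale1 t *ᵥ y) i = t * y ()) := by
  refine ⟨?_, ?_, ?_⟩
  all_goals
    intros
    simp only [mulVec, scale0, scale1, single_dotProduct, one_mul]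

theorem scale0_mul {s t : ℂ} (hst : s * t = 1) : scale0 s * scale0 t = 1 := by
  refine ext_act fun y => Fin.forall_fin_two.2 ⟨?_, ?_⟩
  all_goals simp only [one_mulVec, ← mulVec_mulVec, scale_act s 0, scale_act t 0]
  linear_combination y 1 * hst

theorem scale1_mul {s t : ℂ} (hst : s * t = 1) : scale1 s * scale1 t = 1 := by
  refine ext_act fun y => ?_
  simp only [one_mulVec, ← mulVec_mulVec, scale_act 0 s, scale_act 0 t]
  rintro ⟨⟩
  linear_combination y () * hst

/-- The choice s = a/2 makes the new `a` equal to 2. Then u² = a v p q and w² = 2pq show that t =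
-u/w is a square root of v s, and precisely the one that makes the new `u` equal to -w. The
invariants ad, ev, uh take care of the comultiplication. -/
theorem scale_params (ha : a ≠ 0) (hv : v ≠ 0) (hu : u * u = a * v * (p * q))
    (hk : a * d = p - 2) (hm : e * v = -(p * Rt)) (hn : u * h = p * p * (Rt + 1)) :
    ∃ s t : ℂ, s ≠ 0 ∧ t ≠ 0 ∧ a = 2 * s ∧ v * s = t * t ∧ u = -w * t ∧ d * s = p / 2 - 1 ∧
      e * (t * t) = -(p * Rt) * s ∧ h * t = -((Rt + 1) * q * w / 2) := by
  have hw := w_ne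
  have hww := w_mul_w
  have hp := p_ne
  have hq := q_ne
  have hu0 : u ≠ 0 := by
    rintro rfl
    have : a * v * (p * q) = 0 := by rw [← hu, zero_mul]
    simp [ha, hv, hp, hq] at this
  have ht : v * (a / 2) = (-u / w) * (-u / w) := by
    field_simp
    rw [pow_two, pow_two, hu, hww]
    ring
  refine ⟨a / 2, -u / w, by simpa using ha, div_ne_zero (neg_ne_zero.2 hu0) hw, by ring, ht,
    by field_simp, by linear_combination hk / 2, ?_, ?_⟩
  · rw [← ht]
    linear_combination (a / 2) * hm
  · have : h * (-u / w) = -(p * p * (Rt + 1)) / w := by rw [← hn]; ring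
    rw [this, div_eq_iff hw]
    linear_combination (Rt + 1) * q / 2 * hww + (Rt + 1) * p * q_mul_q

theorem scale_intertwines {s t : ℂ} (h1 : a = 2 * s) (h2 : v * s = t * t) (h3 : u = -w * t)
    (h4 : d * s = p / 2 - 1) (h5 : e * (t * t) = -(p * Rt) * s)
    (h6 : h * t = -((Rt + 1) * q * w / 2)) :
    scale0 s * pM0 a v = pM0 2 1 * ten0 (scale0 s) (scale1 t) (scale0 s) (scale1 t) ∧
    scale1 t * pM1 a a u = pM1 2 2 (-w) * ten1 (scale0 s) (scale1 t) (scale0 s) (scale1 t) ∧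
    pD0 (p / 2 - 1) (-(p * Rt)) * scale0 s =
      ten0 (scale0 s) (scale1 t) (scale0 s) (scale1 t) * pD0 d e ∧
    pD1 (p / 2 - 1) (p / 2 - 1) (-((Rt + 1) * q * w / 2)) * scale1 t =
      ten1 (scale0 s) (scale1 t) (scale0 s) (scale1 t) * pD1 d d h ∧
    scale0 s * N0 = N0 ∧ pE0 * scale0 s = pE0 := by
  refine ⟨ext_act fun y => ?_, ext_act fun y => ?_, ext_act fun y => ?_, ext_act fun y => ?_,
    ext_act fun y => ?_, ext_act fun y => ?_⟩
  all_goals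
    simp only [Sum.forall, Prod.forall, Fin.forall_fin_two, Unique.forall_iff, forall_const,
      act_scal, ← mulVec_mulVec, ten_act, unit_counit_act, scale_act s t,
      param_act a a a d e d d h u v, param_act 2 2 2 (p / 2 - 1) (-(p * Rt)) (p / 2 - 1)
      (p / 2 - 1) (-((Rt + 1) * q * w / 2)) (-w) 1]
    and_intros
  all_goals grind

/-- The new basis consists of the unit `y` and a vector spanning the kernel of the counit `z`. The
determinant of the change of basis is z y = 1, so the adjugate is the inverse. -/
theorem exists_basis_matrix (y : Matrix (Fin 2) Unit ℂ) (z : Matrix Unit (Fin 2) ℂ)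
    (h : z * y = 1) : ∃ G G' : Matrix (Fin 2) (Fin 2) ℂ,
      G' * G = 1 ∧ G * G' = 1 ∧ G * y = N0 ∧ z * G' = pE0 := by
  obtain ⟨r0, hr0⟩ : ∃ r, r = z () 0 := ⟨_, rfl⟩
  obtain ⟨r1, hr1⟩ : ∃ r, r = z () 1 := ⟨_, rfl⟩
  obtain ⟨u0, hu0⟩ : ∃ r, r = y 0 () := ⟨_, rfl⟩
  obtain ⟨u1, hu1⟩ : ∃ r, r = y 1 () := ⟨_, rfl⟩
  have K : r0 * u0 + r1 * u1 = 1 := by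
    have := congrFun (congrFun h ()) ()
    rwa [Matrix.mul_apply, Fin.sum_univ_two, Matrix.one_apply_eq, ← hr0, ← hr1, ← hu0,
      ← hu1] at this
  have mk : ∀ {a b c d a' b' c' d' : ℂ}, a = a' → b = b' → c = c' → d = d' →
      !![a, b; c, d] = !![a', b'; c', d'] := by
    rintro _ _ _ _ _ _ _ _ rfl rfl rfl rfl; rfl
  refine ⟨!![r0, r1; -u1, u0], !![u0, -r1; u1, r0], ?_, ?_, ?_, ?_⟩
  · rw [Matrix.mul_fin_two, Matrix.one_fin_two]
    exact mk (by linear_combination K) (by ring) (by ring) (by linear_combination K)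
  · rw [Matrix.mul_fin_two, Matrix.one_fin_two]
    exact mk (by linear_combination K) (by ring) (by ring) (by linear_combination K)
  · refine ext_act fun v => Fin.forall_fin_two.2 ⟨?_, ?_⟩
    · rw [← mulVec_mulVec, sum_act2, sum_act1, sum_act1, unit_counit_act.2.1, ← hu0, ← hu1]
      change r0 * (u0 * _) + r1 * (u1 * _) = _
      linear_combination v () * K
    · rw [← mulVec_mulVec, sum_act2, sum_act1, sum_act1, unit_counit_act.2.2.1, ← hu0, ← hu1]
      change -u1 * (u0 * _) + u0 * (u1 * _) = _
      ring
  · refine ext_act fun v i => ?_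
    rw [← mulVec_mulVec, sum_act2, sum_act2, sum_act2, unit_counit_act.1, ← hr0, ← hr1]
    change r0 * (u0 * _ + -r1 * _) + r1 * (u1 * _ + r0 * _) = _
    linear_combination v 0 * K

end FibMat

/-! ### Uniqueness of the Hopf algebra -/

namespace Fib

attribute [local instance] monObjTwoPlusTau comonObjTwoPlusTau
  bimonObjTwoPlusTau hopfObjTwoPlusTau

open FibMat

/-- An isomorphism from its matrices. -/
def isoMk {X Y : Fib} (a : Matrix Y.one X.one ℂ) (a' : Matrix X.one Y.one ℂ)
    (b : Matrix Y.tau X.tau ℂ) (b' : Matrix X.tau Y.tau ℂ) (h1 : a' * a = 1) (h2 : a * a' = 1)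
    (h3 : b' * b = 1) (h4 : b * b' = 1) : X ≅ Y where
  hom := ⟨a, b⟩
  inv := ⟨a', b'⟩
  hom_inv_id := hom_ext h1 h3
  inv_hom_id := hom_ext h2 h4

open MonObj ComonObj HopfObj

/-- The structure maps of `2 + τ` in a normalized basis. -/
structure IsNormalizing {B : Fib} [HopfObj B] (e : B ≅ twoPlusTau) : Prop where
  mul : μ[B] ≫ e.hom = (e.hom ⊗ₘ e.hom) ≫ (⟨pM0 2 1, pM1 2 2 (-w)⟩ : Hom _ _)
  comul : e.hom ≫ (⟨pD0 (p / 2 - 1) (-(p * Rt)),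
    pD1 (p / 2 - 1) (p / 2 - 1) (-((Rt + 1) * q * w / 2))⟩ : Hom _ _) = Δ[B] ≫ (e.hom ⊗ₘ e.hom)
  one : η[B] ≫ e.hom = ⟨N0, N1⟩
  counit : e.hom ≫ (⟨pE0, E1⟩ : Hom _ _) = ε[B]

/-- A Hopf algebra structure on `2 + τ` with normalized unit and counit. -/
theorem exists_scale (J : HopfObj twoPlusTau) (h1 : J.one = ⟨N0, N1⟩) (h2 : J.counit = ⟨pE0, E1⟩) :
    ∃ g : twoPlusTau ≅ twoPlusTau,
      J.mul ≫ g.hom = (g.hom ⊗ₘ g.hom) ≫ (⟨pM0 2 1, pM1 2 2 (-w)⟩ : Hom _ _) ∧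
      g.hom ≫ (⟨pD0 (p / 2 - 1) (-(p * Rt)),
        pD1 (p / 2 - 1) (p / 2 - 1) (-((Rt + 1) * q * w / 2))⟩ : Hom _ _) =
        J.comul ≫ (g.hom ⊗ₘ g.hom) ∧
      J.one ≫ g.hom = ⟨N0, N1⟩ ∧ g.hom ≫ (⟨pE0, E1⟩ : Hom _ _) = J.counit := by
  have l1 := J.one_mul
  have l2 := J.mul_one
  have l3 := J.mul_assoc
  have l4 := J.counit_comul
  have l5 := J.comul_counit
  have l6 := J.comul_assoc
  have l7 : J.mul ≫ J.comul = (J.comul ⊗ₘ J.comul) ≫ tensorμ _ _ _ _ ≫ (J.mul ⊗ₘ J.mul) :=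
    J.mul_comul
  have l8 : J.one ≫ J.comul = (λ_ _).inv ≫ (J.one ⊗ₘ J.one) := J.one_comul
  have l9 : J.mul ≫ J.counit = (J.counit ⊗ₘ J.counit) ≫ (λ_ _).hom := J.mul_counit
  have l10 := J.antipode_left
  have l11 : J.one ≫ J.antipode = J.one := @HopfObj.one_antipode _ _ _ _ _ J
  have l12 : J.antipode ≫ J.counit = J.counit := @HopfObj.antipode_counit _ _ _ _ _ J
  rw [h1, h2] at *
  generalize J.mul = m at *
  generalize J.comul = D at *
  generalize J.antipode = S at *
  obtain ⟨m0, m1⟩ := m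
  obtain ⟨D0, D1⟩ := D
  obtain ⟨S0, S1⟩ := S
  obtain ⟨a, b, c, u, v, rfl, rfl⟩ := mul_params m0 m1 (congrArg Hom.one l1)
    (congrArg Hom.tau l1) (congrArg Hom.one l2) (congrArg Hom.tau l2) (congrArg Hom.one l9)
  obtain ⟨d, e, f, g, h, rfl, rfl⟩ := comul_params D0 D1 (congrArg Hom.one l4)
    (congrArg Hom.tau l4) (congrArg Hom.one l5) (congrArg Hom.tau l5) (congrArg Hom.one l8)
  obtain ⟨s, t, hs⟩ := param_antipode S0 S1 (congrArg Hom.one l10) (congrArg Hom.one l11)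
    (congrArg Hom.one l12)
  obtain ⟨k1, k2, k3, k4, k5⟩ := param_bimon (congrArg Hom.one l7) (congrArg Hom.tau l7)
  obtain ⟨ha, hv, rfl, rfl, rfl, rfl, hu, hk, hm, hn⟩ := param_solve
    (param_assoc (congrArg Hom.one l3) (congrArg Hom.tau l3))
    (param_coassoc (congrArg Hom.one l6) (congrArg Hom.tau l6)) k1 k2 k3 k4 k5 hs
  obtain ⟨s, t, hs, ht, q1, q2, q3, q4, q5, q6⟩ := scale_params ha hv hu hk hm hn
  obtain ⟨i1, i2, i3, i4, i5, i6⟩ := scale_intertwines q1 q2 q3 q4 q5 q6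
  refine ⟨isoMk (scale0 s) (scale0 s⁻¹) (scale1 t) (scale1 t⁻¹) (scale0_mul (inv_mul_cancel₀ hs))
    (scale0_mul (mul_inv_cancel₀ hs)) (scale1_mul (inv_mul_cancel₀ ht))
    (scale1_mul (mul_inv_cancel₀ ht)), hom_ext i1 i2, hom_ext i3 i4,
    hom_ext i5 (funext fun _ => funext fun i => i.elim), hom_ext i6 (funext fun i => i.elim)⟩

/-- Every Hopf algebra on `2 + τ` has a basis with normalized unit and counit. -/
theorem exists_unitBasis {B : Fib} [HopfObj B] (i : B ≅ twoPlusTau) :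
    ∃ g : B ≅ twoPlusTau, η[B] ≫ g.hom = ⟨N0, N1⟩ ∧ g.inv ≫ ε[B] = ⟨pE0, E1⟩ := by
  have h : (η[B] ≫ i.hom) ≫ (i.inv ≫ ε[B]) = 𝟙 _ := by simp
  obtain ⟨y, hy⟩ : ∃ y, y = η[B] ≫ i.hom := ⟨_, rfl⟩
  obtain ⟨z, hz⟩ : ∃ z, z = i.inv ≫ ε[B] := ⟨_, rfl⟩
  rw [← hy, ← hz] at h
  obtain ⟨y0, y1⟩ := y
  obtain ⟨z0, z1⟩ := z
  obtain ⟨G, G', k1, k2, k3, k4⟩ := exists_basis_matrix y0 z0 (congrArg Hom.one h)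
  refine ⟨i ≪≫ isoMk (X := twoPlusTau) (Y := twoPlusTau) G G' 1 1 k1 k2 (Matrix.mul_one 1)
    (Matrix.mul_one 1), ?_, ?_⟩
  · rw [Iso.trans_hom, ← Category.assoc, ← hy]
    exact hom_ext k3 (funext fun _ => funext fun i => i.elim)
  · rw [Iso.trans_inv, Category.assoc, ← hz]
    exact hom_ext k4 (funext fun i => i.elim)

/-- Composite of two changes of basis: one fixes unit and counit, the other rescales x and τ. -/
theorem exists_normalizing {B : Fib} [HopfObj B] (i : B ≅ twoPlusTau) :
    ∃ g : B ≅ twoPlusTau, IsNormalizing g := by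
  obtain ⟨j, h1, h2⟩ := exists_unitBasis i
  obtain ⟨g, k1, k2, k3, k4⟩ := exists_scale (transportHopf j) h1 h2
  refine ⟨j ≪≫ g, ?_, ?_, ?_, ?_⟩
  · have : ((j.inv ⊗ₘ j.inv) ≫ μ[B] ≫ j.hom) ≫ g.hom = (g.hom ⊗ₘ g.hom) ≫ _ := k1
    rw [← cancel_epi (j.inv ⊗ₘ j.inv)]
    simp only [Category.assoc] at this
    simp [this, tensorHom_comp_tensorHom_assoc]
  · have : g.hom ≫ _ = (j.inv ≫ Δ[B] ≫ (j.hom ⊗ₘ j.hom)) ≫ (g.hom ⊗ₘ g.hom) := k2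
    simp [this, tensorHom_comp_tensorHom]
  · have : (η[B] ≫ j.hom) ≫ g.hom = _ := k3
    simpa using this
  · have : g.hom ≫ _ = j.inv ≫ ε[B] := k4
    simp [this]

/-- Two Hopf algebras with the same matrices in suitable bases are isomorphic: one identification
followed by the inverse of the other preserves all structure maps. -/
theorem IsNormalizing.isBimonHom {B B' : Fib} [HopfObj B] [HopfObj B'] {e : B ≅ twoPlusTau}
    {e' : B' ≅ twoPlusTau} (h : IsNormalizing e) (h' : IsNormalizing e') :
    IsBimonHom (e ≪≫ e'.symm).hom := by
  have m1 := h.mul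
  have m2 : (e'.inv ⊗ₘ e'.inv) ≫ μ[B'] = _ ≫ e'.inv :=
    (Iso.eq_comp_inv e').2 (by
      rw [Category.assoc, h'.mul, tensorHom_comp_tensorHom_assoc, e'.inv_hom_id, id_tensorHom_id,
        Category.id_comp])
  have c1 := h.comul
  have c2 : e'.inv ≫ Δ[B'] = (⟨pD0 (p / 2 - 1) (-(p * Rt)),
      pD1 (p / 2 - 1) (p / 2 - 1) (-((Rt + 1) * q * w / 2))⟩ : Hom _ _) ≫
        (e'.inv ⊗ₘ e'.inv) := by
    rw [Iso.inv_comp_eq, ← Category.assoc, h'.comul, Category.assoc, tensorHom_comp_tensorHom,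
      e'.hom_inv_id, id_tensorHom_id, Category.comp_id]
  exact
    { one_hom := by simp [reassoc_of% h.one, ← h'.one]
      mul_hom := by
        simp only [Iso.trans_hom, Iso.symm_hom, ← tensorHom_comp_tensorHom, Category.assoc, m2]
        rw [← Category.assoc, m1, Category.assoc]
      hom_counit := by simp [← h.counit, ← h'.counit]
      hom_comul := by
        simp only [Iso.trans_hom, Iso.symm_hom, ← tensorHom_comp_tensorHom, Category.assoc, c2]
        rw [← Category.assoc, c1, Category.assoc] }


theorem exists_bimonIso (B : Fib) [HopfObj B] (h : Nonempty (B ≅ twoPlusTau)) :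
    ∃ e : B ≅ twoPlusTau, IsBimonHom e.hom ∧
      HopfObj.antipode ≫ e.hom = e.hom ≫ HopfObj.antipode := by
  obtain ⟨i⟩ := h
  obtain ⟨e, he⟩ := exists_normalizing i
  -- The existence statement applies to `2 + τ` itself, so its own normalizing basis need not be
  -- exhibited.
  obtain ⟨e', he'⟩ := exists_normalizing (Iso.refl twoPlusTau)
  have := he.isBimonHom he'
  -- A bimonoid morphism between Hopf monoids respects antipodes automatically.
  exact ⟨e ≪≫ e'.symm, this, (HopfObj.hom_antipode _).symm⟩

end Fib

/-! ### Integral, order of the antipode, failure of (co)commutativity -/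

namespace FibMat

open Matrix Sum

/-- The matrix of the integral `1₁ + 1₂`. -/
def I0 : Matrix (Fin 2) Unit ℂ
  | 0 => Pi.single () 1
  | 1 => Pi.single () 1

theorem integral_act :
    (∀ (y : Unit → ℂ), (I0 *ᵥ y) 0 = y ()) ∧ (∀ (y : Unit → ℂ), (I0 *ᵥ y) 1 = y ()) := by
  refine ⟨?_, ?_⟩
  all_goals
    intros
    simp only [mulVec, I0, single_dotProduct, one_mul]

theorem integral_left0 :
    M0 * ten0 I0 N1 (1 : Matrix (Fin 2) (Fin 2) ℂ) (1 : Matrix Unit Unit ℂ) =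
      I0 * E0 * lunit0 (Fin 2) Unit := by
  refine ext_act fun v => Fin.forall_fin_two.2 ⟨?_, ?_⟩
  all_goals simp only [one_mulVec, ← mulVec_mulVec, ten_act, unit_act, hopf_act, integral_act]
  all_goals ring

theorem integral_left1 :
    M1 * ten1 I0 N1 (1 : Matrix (Fin 2) (Fin 2) ℂ) (1 : Matrix Unit Unit ℂ) =
      N1 * E1 * lunit1 (Fin 2) Unit := by
  refine ext_act fun v i => ?_
  simp only [one_mulVec, ← mulVec_mulVec, ten_act, unit_act, hopf_act, integral_act]
  ring

theorem integral_right0 :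
    M0 * ten0 (1 : Matrix (Fin 2) (Fin 2) ℂ) (1 : Matrix Unit Unit ℂ) I0 N1 =
      I0 * E0 * runit0 (Fin 2) Unit := by
  refine ext_act fun v => Fin.forall_fin_two.2 ⟨?_, ?_⟩
  all_goals simp only [one_mulVec, ← mulVec_mulVec, ten_act, unit_act, hopf_act, integral_act]
  all_goals ring

theorem integral_right1 :
    M1 * ten1 (1 : Matrix (Fin 2) (Fin 2) ℂ) (1 : Matrix Unit Unit ℂ) I0 N1 =
      N1 * E1 * runit1 (Fin 2) Unit := by
  refine ext_act fun v i => ?_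
  simp only [one_mulVec, ← mulVec_mulVec, ten_act, unit_act, hopf_act, integral_act]
  ring

/-- The scalar is Rt⁻¹ = e^(-3πi/5), a primitive tenth root of unity. Algebraically: its fifth power
is -1 and its square is not 1, which excludes the proper divisors of 10. -/
theorem orderOf_antipode_scalar : orderOf (-(p + Rt)) = 10 := by
  have hp := p_mul_p
  have hR := Rt_sq
  have h2 : (-(p + Rt)) ^ 2 = p * (Rt - 1) := by linear_combination hR + hp
  have h5 : (-(p + Rt)) ^ 5 = -1 := by
    have : (-(p + Rt)) ^ 4 = -(p * p * Rt * (p + 2)) := by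
      rw [show (-(p + Rt)) ^ 4 = ((-(p + Rt)) ^ 2) ^ 2 by ring, h2]
      linear_combination p * p * hR
    rw [pow_succ, this]
    linear_combination p * p * (p + 2) * hR - (p + 1) * hp
  refine orderOf_eq_of_pow_and_pow_div_prime (by norm_num) ?_ fun r hr hd => ?_
  · rw [show (10 : ℕ) = 5 * 2 by norm_num, pow_mul, h5]; norm_num
  · have : r = 2 ∨ r = 5 := by
      have h : r ∣ 2 * 5 := by simpa using hd
      rcases (Nat.Prime.dvd_mul hr).1 h with h | h
      · exact Or.inl ((Nat.prime_dvd_prime_iff_eq hr Nat.prime_two).1 h)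
      · exact Or.inr ((Nat.prime_dvd_prime_iff_eq hr Nat.prime_five).1 h)
    rcases this with rfl | rfl
    · rw [show 10 / 2 = 5 by norm_num, h5]; norm_num
    · rw [show 10 / 5 = 2 by norm_num, h2]
      intro h
      -- If the square p(Rt - 1) were 1, then Rt would be 1 + p⁻¹ = 2 + p, which violates Rt² = -p
      -- Rt - 1.
      have hR' : Rt = 2 + p := by
        linear_combination (1 + p) * h - (Rt - 1) * hp
      rw [hR'] at hR
      have h7 : 4 * p + 7 = 0 := by linear_combination hR - 2 * hp
      have : (1 : ℂ) = 0 := by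
        linear_combination (16 / 5) * hp - (4 * p - 3) / 5 * h7
      norm_num at this

theorem scale1_one : scale1 1 = 1 := ext_act fun y i => by
  rw [(scale_act 0 1).2.2, Matrix.one_mulVec, one_mul]

theorem scale1_comp (s t : ℂ) : scale1 (s * t) = scale1 s * scale1 t := ext_act fun y i => by
  rw [← Matrix.mulVec_mulVec, (scale_act 0 _).2.2, (scale_act 0 _).2.2, (scale_act 0 _).2.2,
    mul_assoc]

theorem scale1_injective : Function.Injective scale1 := fun s t hst => by
  have := congrFun (congrFun hst ()) ()
  simpa [scale1] using this

theorem integral_counit : E0 * I0 ≠ 0 := fun h => by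
  have h2 := congrFun (congrArg (Matrix.mulVec · fun _ => 1) h) ()
  simp only [← Matrix.mulVec_mulVec, hopf_act, integral_act] at h2
  norm_num at h2

/-- The component ττ → τ is nonzero, and the braiding multiplies it by Rt ≠ 1. -/
theorem not_comm : M1 * braid1 (Fin 2) Unit (Fin 2) Unit Rt ≠ M1 := fun h1 => by
  have h2 := congrFun (congrArg (Matrix.mulVec · (Pi.single (Sum.inr (Sum.inr ((), ()))) 1)) h1) ()
  simp only [← Matrix.mulVec_mulVec, braid_act, hopf_act] at h2
  simp [w_ne] at h2
  exact Rt_ne_one (by rw [h2, sub_self])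

/-- The component of Δ from the second 𝟏 to ττ is nonzero, and the braiding multiplies it by R1 =
Rt² ≠ 1. -/
theorem not_cocomm : braid0 (Fin 2) Unit (Fin 2) Unit R1 * D0 ≠ D0 := fun h1 => by
  have h2 := congrFun (congrArg (Matrix.mulVec · (Pi.single 1 1)) h1) (Sum.inr ((), ()))
  simp only [← Matrix.mulVec_mulVec, braid_act, hopf_act] at h2
  simp [p_ne, Rt_ne, R1_eq] at h2
  rcases mul_self_eq_one_iff.1 h2 with h | h
  · exact Rt_ne_one (by rw [h, sub_self])
  · exact Rt_ne_neg_one (by rw [h, neg_add_cancel])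

end FibMat

namespace Fib

attribute [local instance] monObjTwoPlusTau comonObjTwoPlusTau
  bimonObjTwoPlusTau hopfObjTwoPlusTau

open FibMat MonObj ComonObj

theorem not_isCommMonObj : ¬ IsCommMonObj twoPlusTau := fun _ => by
  have h : (β_ twoPlusTau twoPlusTau).hom ≫ hopfMul = hopfMul := IsCommMonObj.mul_comm twoPlusTau
  rw [hopfMul_eq] at h
  exact not_comm (congrArg Hom.tau h)

theorem not_isCommComonObj : ¬ IsCommComonObj twoPlusTau := fun _ => by
  have h : hopfComul ≫ (β_ twoPlusTau twoPlusTau).hom = hopfComul :=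
    IsCommComonObj.comul_comm twoPlusTau
  rw [hopfComul_eq] at h
  exact not_cocomm (congrArg Hom.one h)

/-- The integral `1₁ + 1₂`. -/
def integral : 𝟙_ Fib ⟶ twoPlusTau := ⟨I0, N1⟩

theorem integral_mul : integral ▷ twoPlusTau ≫ hopfMul =
    (λ_ twoPlusTau).hom ≫ hopfCounit ≫ integral := by
  rw [hopfMul_eq, hopfCounit_eq]
  exact hom_ext integral_left0 integral_left1

theorem mul_integral : twoPlusTau ◁ integral ≫ hopfMul =
    (ρ_ twoPlusTau).hom ≫ hopfCounit ≫ integral := by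
  rw [hopfMul_eq, hopfCounit_eq]
  exact hom_ext integral_right0 integral_right1

theorem integral_comp_counit : integral ≫ hopfCounit ≠ 0 := fun h => by
  rw [hopfCounit_eq] at h
  exact integral_counit (congrArg Hom.one h)

theorem exists_integral :
    ∃ Λ : 𝟙_ Fib ⟶ twoPlusTau, IsTwoSidedIntegral Λ ∧ Λ ≫ counit ≠ 0 :=
  ⟨integral, ⟨integral_mul, mul_integral⟩, integral_comp_counit⟩

/-- The endomorphisms of `2 + τ` that are scalar on `τ` and the identity on the copies of `𝟏`. -/
def tauScalar : ℂ →* End twoPlusTau where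
  toFun s := (⟨(1 : Matrix (Fin 2) (Fin 2) ℂ), scale1 s⟩ : Hom twoPlusTau twoPlusTau)
  map_one' := hom_ext rfl scale1_one
  map_mul' s t := hom_ext (Matrix.mul_one (1 : Matrix (Fin 2) (Fin 2) ℂ)).symm (scale1_comp s t)

theorem orderOf_antipode : orderOf (G := End twoPlusTau) hopfAntipode = 10 := by
  have h : hopfAntipode = tauScalar (-(p + Rt)) := hopfAntipode_eq
  rw [h, orderOf_injective tauScalar (fun s t hst => ?_), orderOf_antipode_scalar]
  exact scale1_injective (congrArg Hom.tau hst)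

end Fib

/-! ### Modules over a universal coacting Hopf monoid and the Drinfeld center -/

namespace CenterOfCoaction

universe v u

variable {C : Type u} [Category.{v} C] [MonoidalCategory C]

open MonObj ComonObj HopfObj

section Act

variable {H : C} (κ : ∀ U : C, U ⟶ U ⊗ H)

/-- The morphism `U ⊗ X ⟶ U ⊗ Y` that a coaction `κ` of `H` on `U` makes of `r : H ⊗ X ⟶ Y`. -/
def coactAct {X Y : C} (r : H ⊗ X ⟶ Y) (U : C) : U ⊗ X ⟶ U ⊗ Y :=
  κ U ▷ X ≫ (α_ U H X).hom ≫ U ◁ r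

variable {κ} {X Y Z : C}

theorem coactAct_natural (hκ : ∀ {U V : C} (f : U ⟶ V), f ≫ κ V = κ U ≫ f ▷ H)
    (r : H ⊗ X ⟶ Y) {U V : C} (f : U ⟶ V) :
    f ▷ X ≫ coactAct κ r V = coactAct κ r U ≫ f ▷ Y := by
  simp only [coactAct, Category.assoc]
  rw [← comp_whiskerRight_assoc, hκ, whisker_exchange]
  simp

theorem coactAct_comp (r : H ⊗ X ⟶ Y) (f : Y ⟶ Z) (U : C) :
    coactAct κ (r ≫ f) U = coactAct κ r U ≫ U ◁ f := by
  simp [coactAct]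

theorem comp_coactAct (f : X ⟶ Y) (r : H ⊗ Y ⟶ Z) (U : C) :
    coactAct κ (H ◁ f ≫ r) U = U ◁ f ≫ coactAct κ r U := by
  simp only [coactAct]
  rw [whisker_exchange_assoc]
  simp

end Act

variable [BraidedCategory C] (H : C) [HopfObj H]

/-- A natural coaction of `H` on all objects by which `H` represents the natural families
`U ⊗ X ⟶ U ⊗ Y`. -/
structure UniversalCoaction where
  κ : ∀ U : C, U ⟶ U ⊗ H
  natural : ∀ {U V : C} (f : U ⟶ V), f ≫ κ V = κ U ≫ f ▷ H
  unit : κ (𝟙_ C) = η[H] ≫ (λ_ H).inv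
  -- The multiplication of `H` records tensor products of the objects acted on, while its
  -- comultiplication, in `coassoc`, records composition of families on one object.
  tensor : ∀ U V : C, κ (U ⊗ V) = κ U ▷ V ≫ (α_ U H V).hom ≫ U ◁ (β_ V H).inv ≫
    U ◁ κ V ▷ H ≫ U ◁ (α_ V H H).hom ≫ (α_ U V (H ⊗ H)).inv ≫ (U ⊗ V) ◁ μ[H]
  coassoc : ∀ U : C, κ U ≫ κ U ▷ H ≫ (α_ U H H).hom = κ U ≫ U ◁ Δ[H]
  counit : ∀ U : C, κ U ≫ U ◁ ε[H] = (ρ_ U).inv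
  -- The last two fields are the injectivity and surjectivity of the map from morphisms H ⊗ X ⟶ Y to
  -- natural families.
  ext : ∀ {X Y : C} (r s : H ⊗ X ⟶ Y), (∀ U, coactAct κ r U = coactAct κ s U) → r = s
  exists_act : ∀ {X Y : C} (t : ∀ U : C, U ⊗ X ⟶ U ⊗ Y),
    (∀ {U V : C} (f : U ⟶ V), f ▷ X ≫ t V = t U ≫ f ▷ Y) → ∃ r, ∀ U, t U = coactAct κ r U

namespace UniversalCoaction

variable {H} (K : UniversalCoaction H) {X Y Z W : C}

theorem act_unit (r : H ⊗ X ⟶ Y) :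
    coactAct K.κ r (𝟙_ C) = 𝟙_ C ◁ ((λ_ X).inv ≫ η[H] ▷ X ≫ r) := by
  simp only [coactAct, K.unit]
  monoidal

theorem act_counit (U : C) : coactAct K.κ (ε[H] ▷ X ≫ (λ_ X).hom) U = 𝟙 _ := by
  have h : coactAct K.κ (ε[H] ▷ X ≫ (λ_ X).hom) U =
      (K.κ U ≫ U ◁ ε[H]) ▷ X ⊗≫ 𝟙 _ := by
    simp only [coactAct]; monoidal
  rw [h, K.counit]
  monoidal

/-- Two successive actions coact twice on `U`; coassociativity replaces this by one coaction
followed by Δ. -/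
theorem act_act (r : H ⊗ X ⟶ Y) (s : H ⊗ Y ⟶ Z) (U : C) :
    coactAct K.κ r U ≫ coactAct K.κ s U =
      coactAct K.κ (Δ[H] ▷ X ≫ (α_ H H X).hom ≫ H ◁ r ≫ s) U := by
  calc
    _ = K.κ U ▷ X ⊗≫ (U ◁ r ≫ K.κ U ▷ Y) ⊗≫ U ◁ s := by
      simp only [coactAct]; monoidal
    _ = (K.κ U ≫ K.κ U ▷ H ≫ (α_ U H H).hom) ▷ X ⊗≫ U ◁ H ◁ r ≫ U ◁ s := by
      rw [whisker_exchange]; monoidal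
    _ = _ := by
      rw [K.coassoc]; simp only [coactAct]; monoidal

/-- The action of `t` through the coactions on `U` and on `V`. -/
def act₂ (t : (H ⊗ H) ⊗ X ⟶ Y) (U V : C) : (U ⊗ V) ⊗ X ⟶ (U ⊗ V) ⊗ Y :=
  (K.κ U ▷ V) ▷ X ⊗≫ U ◁ (β_ V H).inv ▷ X ⊗≫ U ◁ K.κ V ▷ (H ⊗ X) ⊗≫ (U ⊗ V) ◁ t

theorem act_tensor (r : H ⊗ X ⟶ Y) (U V : C) :
    coactAct K.κ r (U ⊗ V) = K.act₂ (μ[H] ▷ X ≫ r) U V := by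
  simp only [coactAct, K.tensor, act₂]
  monoidal

/-- Nesting two one-variable actions reduces the two-variable uniqueness in `act₂_ext` to two
applications of `ext`. -/
theorem act₂_eq (t : (H ⊗ H) ⊗ X ⟶ Y) (U V : C) :
    K.act₂ t U V = (α_ U V X).hom ≫ coactAct K.κ ((α_ H V X).inv ≫ (β_ V H).inv ▷ X ≫
      (α_ V H X).hom ≫ coactAct K.κ ((α_ H H X).inv ≫ t) V) U ≫ (α_ U V Y).inv := by
  simp only [coactAct, act₂]
  monoidal

theorem act₂_ext (t t' : (H ⊗ H) ⊗ X ⟶ Y) (h : ∀ U V, K.act₂ t U V = K.act₂ t' U V) :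
    t = t' := by
  rw [← cancel_epi (α_ H H X).inv]
  refine K.ext _ _ fun V => ?_
  rw [← cancel_epi (α_ V H X).hom, ← cancel_epi ((β_ V H).inv ▷ X), ← cancel_epi (α_ H V X).inv]
  refine K.ext _ _ fun U => ?_
  rw [← cancel_epi (α_ U V X).hom, ← cancel_mono (α_ U V Y).inv]
  simpa only [Category.assoc, act₂_eq] using h U V

/-- The half-braiding of an action. -/
def halfBraid {X : C} (r : H ⊗ X ⟶ X) (U : C) : X ⊗ U ⟶ U ⊗ X :=
  (β_ U X).inv ≫ coactAct K.κ r U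

theorem halfBraid_natural (r : H ⊗ X ⟶ X) {U V : C} (f : U ⟶ V) :
    X ◁ f ≫ K.halfBraid r V = K.halfBraid r U ≫ f ▷ X := by
  rw [halfBraid, halfBraid, BraidedCategory.braiding_inv_naturality_right_assoc,
    coactAct_natural (fun f => K.natural f), Category.assoc]

/-- By `act_tensor` the half-braiding with U ⊗ V is the same expression with μ in place of the
iterated action. Hence the hexagon for `halfBraid` is the associativity of `r`, tested by `act₂`. -/
theorem halfBraid_halfBraid (r : H ⊗ X ⟶ X) (U V : C) :
    (α_ X U V).inv ≫ K.halfBraid r U ▷ V ≫ (α_ U X V).hom ≫ U ◁ K.halfBraid r V ≫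
      (α_ U V X).inv = (β_ (U ⊗ V) X).inv ≫ K.act₂ ((α_ H H X).hom ≫ H ◁ r ≫ r) U V := by
  calc
    _ = 𝟙 _ ⊗≫ (β_ U X).inv ▷ V ⊗≫ K.κ U ▷ X ▷ V ⊗≫ U ◁ (r ▷ V ≫ (β_ V X).inv) ⊗≫
        U ◁ K.κ V ▷ X ⊗≫ U ◁ V ◁ r ⊗≫ 𝟙 _ := by
      simp only [halfBraid, coactAct]; monoidal
    _ = 𝟙 _ ⊗≫ (β_ U X).inv ▷ V ⊗≫ (K.κ U ▷ (X ⊗ V) ≫ (U ⊗ H) ◁ (β_ V X).inv) ⊗≫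
        U ◁ (β_ V H).inv ▷ X ⊗≫ U ◁ (V ◁ r ≫ K.κ V ▷ X) ⊗≫ U ◁ V ◁ r ⊗≫ 𝟙 _ := by
      -- `r` slides through the braiding of `V` with `X`, and the hexagon of the ambient braiding
      -- then moves `V` past `H` and `X` separately.
      rw [BraidedCategory.braiding_inv_naturality_left, BraidedCategory.braiding_tensor_right_inv]; monoidal
    _ = _ := by
      rw [whisker_exchange, ← whisker_exchange, BraidedCategory.braiding_tensor_left_inv, act₂]
      monoidal

/-- Invertibility of the half-braiding: acting by h₁ and then by S(h₂), or the other way round, is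
acting by ε(h), and the counit acts trivially. -/
theorem act_antipode_left (r : H ⊗ X ⟶ X) (h1 : η[H] ▷ X ≫ r = (λ_ X).hom)
    (h2 : μ[H] ▷ X ≫ r = (α_ H H X).hom ≫ H ◁ r ≫ r) (U : C) :
    coactAct K.κ r U ≫ coactAct K.κ (𝒮[H] ▷ X ≫ r) U = 𝟙 _ := by
  rw [act_act, ← K.act_counit]
  congr 1
  rw [whisker_exchange_assoc, ← associator_naturality_left_assoc, ← h2, ← h1,
    ← comp_whiskerRight_assoc, ← comp_whiskerRight_assoc, ← comp_whiskerRight_assoc,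
    Category.assoc, HopfObj.antipode_left]

theorem act_antipode_right (r : H ⊗ X ⟶ X) (h1 : η[H] ▷ X ≫ r = (λ_ X).hom)
    (h2 : μ[H] ▷ X ≫ r = (α_ H H X).hom ≫ H ◁ r ≫ r) (U : C) :
    coactAct K.κ (𝒮[H] ▷ X ≫ r) U ≫ coactAct K.κ r U = 𝟙 _ := by
  rw [act_act, ← K.act_counit]
  congr 1
  rw [MonoidalCategory.whiskerLeft_comp_assoc, ← associator_naturality_middle_assoc, ← h2, ← h1,
    ← comp_whiskerRight_assoc, ← comp_whiskerRight_assoc, ← comp_whiskerRight_assoc,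
    Category.assoc, HopfObj.antipode_right]

theorem cross (U : C) : X ◁ K.κ U ≫ (α_ X U H).inv ≫ (β_ U X).inv ▷ H =
    (β_ U X).inv ≫ K.κ U ▷ X ≫ (α_ U H X).hom ≫ U ◁ (β_ H X).hom ≫ (α_ U X H).inv := by
  rw [← BraidedCategory.braiding_inv_naturality_right_assoc, BraidedCategory.braiding_tensor_left_inv]
  simp

/-- Half-braiding past `Y` and then past `X` coacts twice on the same `U`. Coassociativity merges
the coactions into Δ, and `cross` produces the braiding of `H` past `X` that occurs in the action on
the tensor product. -/
theorem halfBraid_tensorAct (r : H ⊗ X ⟶ X) (s : H ⊗ Y ⟶ Y) (U : C) :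
    (α_ X Y U).hom ≫ X ◁ K.halfBraid s U ≫ (α_ X U Y).inv ≫ K.halfBraid r U ▷ Y ≫
      (α_ U X Y).hom = K.halfBraid (ModTensor.tensorAct r s) U := by
  calc
    _ = 𝟙 _ ⊗≫ X ◁ (β_ U Y).inv ⊗≫ X ◁ K.κ U ▷ Y ⊗≫
        ((X ⊗ U) ◁ s ≫ (β_ U X).inv ▷ Y) ⊗≫ K.κ U ▷ X ▷ Y ⊗≫ U ◁ r ▷ Y := by
      simp only [halfBraid, coactAct]; monoidal
    _ = 𝟙 _ ⊗≫ X ◁ (β_ U Y).inv ⊗≫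
        (X ◁ K.κ U ≫ (α_ X U H).inv ≫ (β_ U X).inv ▷ H) ▷ Y ⊗≫
        ((U ⊗ X) ◁ s ≫ (K.κ U ▷ X) ▷ Y) ⊗≫ U ◁ r ▷ Y := by
      rw [whisker_exchange]; monoidal
    _ = 𝟙 _ ⊗≫ X ◁ (β_ U Y).inv ⊗≫ (β_ U X).inv ▷ Y ⊗≫ K.κ U ▷ X ▷ Y ⊗≫
        (U ◁ ((β_ H X).hom ▷ Y ≫ (α_ X H Y).hom) ≫ K.κ U ▷ (X ⊗ H ⊗ Y)) ⊗≫
        (U ⊗ H) ◁ X ◁ s ⊗≫ U ◁ r ▷ Y := by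
      -- Here the first coaction is pulled through the inverse braiding of `U` with `X`, so that
      -- both coactions stand next to each other.
      rw [cross, whisker_exchange]; monoidal
    _ = 𝟙 _ ⊗≫ X ◁ (β_ U Y).inv ⊗≫ (β_ U X).inv ▷ Y ⊗≫
        (K.κ U ≫ K.κ U ▷ H ≫ (α_ U H H).hom) ▷ (X ⊗ Y) ⊗≫
        U ◁ H ◁ (β_ H X).hom ▷ Y ⊗≫ U ◁ ((H ⊗ X) ◁ s ≫ r ▷ Y) := by
      rw [whisker_exchange]; monoidal
    _ = _ := by
      rw [K.coassoc, whisker_exchange, halfBraid, BraidedCategory.braiding_tensor_right_inv,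
        coactAct, ModTensor.tensorAct, tensorμ, MonoidalCategory.tensorHom_def]
      monoidal

/-- The isomorphism underlying the half-braiding of a module. -/
def halfBraidIso (r : H ⊗ X ⟶ X) (h1 : η[H] ▷ X ≫ r = (λ_ X).hom)
    (h2 : μ[H] ▷ X ≫ r = (α_ H H X).hom ≫ H ◁ r ≫ r) (U : C) : X ⊗ U ≅ U ⊗ X :=
  (β_ U X).symm ≪≫
    { hom := coactAct K.κ r U
      inv := coactAct K.κ (𝒮[H] ▷ X ≫ r) U
      hom_inv_id := K.act_antipode_left r h1 h2 U
      inv_hom_id := K.act_antipode_right r h1 h2 U }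

/-- The object of the center of a module. -/
def toCenterObj (M : Mod C H) : Center C :=
  ⟨M.X,
    { β := K.halfBraidIso (ModTensor.act M) (ModTensor.one_act M) (ModTensor.mul_act M)
      monoidal := fun U V => by
        change K.halfBraid (ModTensor.act M) (U ⊗ V) = _
        refine Eq.trans ?_ (K.halfBraid_halfBraid (ModTensor.act M) U V).symm
        rw [← ModTensor.mul_act, ← act_tensor, halfBraid]
      naturality := fun f => K.halfBraid_natural (ModTensor.act M) f }⟩

/-- Naturality of the braiding cancels it from both sides, and `ext` turns equality of the families
into equality of morphisms. This gives functoriality and fullness at once. -/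
theorem comm_iff (r : H ⊗ X ⟶ X) (s : H ⊗ Y ⟶ Y) (f : X ⟶ Y) :
    (∀ U, f ▷ U ≫ K.halfBraid s U = K.halfBraid r U ≫ U ◁ f) ↔ r ≫ f = H ◁ f ≫ s := by
  have h : ∀ U, f ▷ U ≫ K.halfBraid s U = K.halfBraid r U ≫ U ◁ f ↔
      coactAct K.κ (H ◁ f ≫ s) U = coactAct K.κ (r ≫ f) U := fun U => by
    rw [halfBraid, halfBraid, BraidedCategory.braiding_inv_naturality_left_assoc, Category.assoc,
      cancel_epi, comp_coactAct, coactAct_comp]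
  exact ⟨fun H => (K.ext _ _ fun U => (h U).1 (H U)).symm, fun H U => (h U).2 (by rw [H])⟩

/-- From modules over `H` to the center. -/
def toCenter : Mod C H ⥤ Center C where
  obj := K.toCenterObj
  map {M N} f := ⟨f.hom, (K.comm_iff (ModTensor.act M) (ModTensor.act N) f.hom).2
    (ModTensor.act_hom f)⟩

instance : K.toCenter.Faithful where
  map_injective h := Mod.hom_ext _ _ (congrArg Center.Hom.f h)

instance : K.toCenter.Full where
  map_surjective {M N} f := ⟨ModTensor.mkHom f.f
    ((K.comm_iff (ModTensor.act M) (ModTensor.act N) f.f).1 f.comm), rfl⟩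

/-- The half-braiding composed with the braiding is a natural family U ⊗ X → U ⊗ X, hence comes from
some `r`; the hexagon gives its associativity. -/
theorem exists_action (Z : Center C) : ∃ r : H ⊗ Z.1 ⟶ Z.1,
    (∀ U, (Z.2.β U).hom = K.halfBraid r U) ∧ η[H] ▷ Z.1 ≫ r = (λ_ Z.1).hom ∧
      μ[H] ▷ Z.1 ≫ r = (α_ H H Z.1).hom ≫ H ◁ r ≫ r := by
  obtain ⟨X, b⟩ := Z
  obtain ⟨r, hr⟩ := K.exists_act (fun U => (β_ U X).hom ≫ (b.β U).hom) fun f => by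
    rw [BraidedCategory.braiding_naturality_left_assoc, b.naturality, Category.assoc]
  have hb : ∀ U, (b.β U).hom = K.halfBraid r U := fun U => by
    rw [halfBraid, ← hr, Iso.inv_hom_id_assoc]
  have hmul : μ[H] ▷ X ≫ r = (α_ H H X).hom ≫ H ◁ r ≫ r := by
    refine K.act₂_ext _ _ fun U V => ?_
    rw [← cancel_epi (β_ (U ⊗ V) X).inv, ← halfBraid_halfBraid, ← hb, ← hb, ← b.monoidal,
      ← act_tensor, hb, halfBraid]
  refine ⟨r, hb, ?_, hmul⟩
  -- A half-braiding is not required to be trivial on the unit object. The action of η is invertible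
  -- because it is a half-braiding with 𝟏, and idempotent by associativity, hence the identity.
  have h1 : 𝟙_ C ◁ ((λ_ X).inv ≫ η[H] ▷ X ≫ r) = (β_ (𝟙_ C) X).hom ≫ (b.β (𝟙_ C)).hom := by
    rw [hr, act_unit]
  have h2 : IsIso ((λ_ X).inv ≫ η[H] ▷ X ≫ r) := by
    have : IsIso (𝟙_ C ◁ ((λ_ X).inv ≫ η[H] ▷ X ≫ r)) := by rw [h1]; infer_instance
    have h : (λ_ X).inv ≫ η[H] ▷ X ≫ r =
        (λ_ X).inv ≫ 𝟙_ C ◁ ((λ_ X).inv ≫ η[H] ▷ X ≫ r) ≫ (λ_ X).hom := by simp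
    exact h ▸ inferInstance
  have h3 : ((λ_ X).inv ≫ η[H] ▷ X ≫ r) ≫ ((λ_ X).inv ≫ η[H] ▷ X ≫ r) =
      (λ_ X).inv ≫ η[H] ▷ X ≫ r := by
    calc
      _ = (λ_ X).inv ≫ (λ_ (𝟙_ C)).inv ▷ X ≫ (η[H] ▷ 𝟙_ C) ▷ X ≫ (H ◁ η[H]) ▷ X ≫
          (α_ H H X).hom ≫ H ◁ r ≫ r := by
        calc
          _ = 𝟙 _ ⊗≫ (𝟙_ C ◁ (η[H] ▷ X ≫ r) ≫ η[H] ▷ X) ⊗≫ r := by monoidal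
          _ = _ := by rw [whisker_exchange]; monoidal
      _ = _ := by
        rw [← hmul, ← comp_whiskerRight_assoc (H ◁ η[H]), MonObj.mul_one]
        monoidal
  have h4 := (cancel_mono ((λ_ X).inv ≫ η[H] ▷ X ≫ r)).1 (h3.trans (Category.id_comp _).symm)
  rw [← cancel_epi (λ_ X).inv, h4, Iso.inv_hom_id]

instance : K.toCenter.EssSurj where
  mem_essImage Z := by
    obtain ⟨r, hb, h1, h2⟩ := K.exists_action Z
    let f : K.toCenter.obj (ModTensor.mkMod r h1 h2) ⟶ Z := ⟨𝟙 Z.1, fun U => by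
      change 𝟙 Z.1 ▷ U ≫ (Z.2.β U).hom = K.halfBraid r U ≫ U ◁ 𝟙 Z.1
      rw [hb]; simp⟩
    have : IsIso f.f := inferInstanceAs (IsIso (𝟙 Z.1))
    exact ⟨_, ⟨Center.isoMk f⟩⟩

instance : K.toCenter.IsEquivalence where

theorem halfBraid_unitAct (U : C) :
    K.halfBraid (ModTensor.unitAct H) U = (λ_ U).hom ≫ (ρ_ U).inv := by
  have : ModTensor.unitAct H = ε[H] ▷ 𝟙_ C ≫ (λ_ (𝟙_ C)).hom := by
    rw [ModTensor.unitAct, unitors_equal, rightUnitor_naturality]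
  rw [halfBraid, this, act_counit]
  simp

/-- The unit of the center comes from the trivial module. -/
def toCenterUnit : 𝟙_ (Center C) ≅ K.toCenter.obj (𝟙_ (Mod C H)) where
  hom := ⟨𝟙 (𝟙_ C), fun U => by
    change 𝟙 (𝟙_ C) ▷ U ≫ K.halfBraid (ModTensor.unitAct H) U =
      ((λ_ U).hom ≫ (ρ_ U).inv) ≫ U ◁ 𝟙 (𝟙_ C)
    rw [halfBraid_unitAct]; simp⟩
  inv := ⟨𝟙 (𝟙_ C), fun U => by
    change 𝟙 (𝟙_ C) ▷ U ≫ (λ_ U).hom ≫ (ρ_ U).inv =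
      K.halfBraid (ModTensor.unitAct H) U ≫ U ◁ 𝟙 (𝟙_ C)
    rw [halfBraid_unitAct]; simp⟩
  hom_inv_id := Center.ext _ _ (Category.comp_id _)
  inv_hom_id := Center.ext _ _ (Category.comp_id _)

theorem tensor_β_hom (M N : Mod C H) (U : C) :
    ((K.toCenter.obj M ⊗ K.toCenter.obj N).2.β U).hom =
      K.halfBraid (ModTensor.tensorAct (ModTensor.act M) (ModTensor.act N)) U :=
  K.halfBraid_tensorAct (ModTensor.act M) (ModTensor.act N) U

/-- The tensor product in the center comes from the tensor product of modules. -/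
def toCenterTensor (M N : Mod C H) :
    K.toCenter.obj M ⊗ K.toCenter.obj N ≅ K.toCenter.obj (M ⊗ N) where
  hom := ⟨𝟙 (M.X ⊗ N.X), fun U => by
    rw [tensor_β_hom]
    change 𝟙 (M.X ⊗ N.X) ▷ U ≫
      K.halfBraid (ModTensor.tensorAct (ModTensor.act M) (ModTensor.act N)) U =
      K.halfBraid (ModTensor.tensorAct (ModTensor.act M) (ModTensor.act N)) U ≫
        U ◁ 𝟙 (M.X ⊗ N.X)
    simp⟩
  inv := ⟨𝟙 (M.X ⊗ N.X), fun U => by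
    rw [tensor_β_hom]
    change 𝟙 (M.X ⊗ N.X) ▷ U ≫
      K.halfBraid (ModTensor.tensorAct (ModTensor.act M) (ModTensor.act N)) U =
      K.halfBraid (ModTensor.tensorAct (ModTensor.act M) (ModTensor.act N)) U ≫
        U ◁ 𝟙 (M.X ⊗ N.X)
    simp⟩
  hom_inv_id := Center.ext _ _ (Category.comp_id _)
  inv_hom_id := Center.ext _ _ (Category.comp_id _)

/-- The functor to the center is monoidal. -/
def toCenterMonoidal : K.toCenter.CoreMonoidal where
  εIso := K.toCenterUnit
  μIso := K.toCenterTensor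
  μIso_hom_natural_left f M := Center.ext _ _ (by
    change f.hom ▷ M.X ≫ 𝟙 _ = 𝟙 _ ≫ (f.hom ⊗ₘ 𝟙 M.X)
    simp)
  μIso_hom_natural_right M f := Center.ext _ _ (by
    change M.X ◁ f.hom ≫ 𝟙 _ = 𝟙 _ ≫ (𝟙 M.X ⊗ₘ f.hom)
    simp)
  associativity M N L := Center.ext _ _ (by
    change 𝟙 (M.X ⊗ N.X) ▷ L.X ≫ 𝟙 _ ≫ (α_ M.X N.X L.X).hom =
      (α_ M.X N.X L.X).hom ≫ M.X ◁ 𝟙 (N.X ⊗ L.X) ≫ 𝟙 _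
    simp)
  left_unitality M := Center.ext _ _ (by
    change (λ_ M.X).hom = 𝟙 (𝟙_ C) ▷ M.X ≫ 𝟙 _ ≫ (λ_ M.X).hom
    simp)
  right_unitality M := Center.ext _ _ (by
    change (ρ_ M.X).hom = M.X ◁ 𝟙 (𝟙_ C) ≫ 𝟙 _ ≫ (ρ_ M.X).hom
    simp)

instance : K.toCenter.Monoidal := K.toCenterMonoidal.toMonoidal

end UniversalCoaction

section Linear

variable [Preadditive C] [MonoidalPreadditive C]

instance (K : UniversalCoaction H) : K.toCenter.Additive where
  map_add := Center.ext _ _ rfl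

instance (R : Type*) [Semiring R] [Linear R C] [MonoidalLinear R C] (K : UniversalCoaction H) :
    K.toCenter.Linear R where
  map_smul _ _ := Center.ext _ _ rfl

end Linear

end CenterOfCoaction

/-! ### A criterion for universality with the generators `𝟏` and `t` -/

namespace CenterOfCoaction

universe v u

variable {C : Type u} [Category.{v} C] [MonoidalCategory C]

variable {H : C} {κ : ∀ U : C, U ⟶ U ⊗ H} {t t' : C} [ExactPairing t t'] {X Y : C}

variable (κ t t') in
/-- The coaction on `t`, with `t` moved to the left. -/
def transposeCoaction : t' ⊗ t ⟶ H :=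
  t' ◁ κ t ≫ (α_ t' t H).inv ≫ ExactPairing.evaluation t t' ▷ H ≫ (λ_ H).hom

/-- Duality converts the component at `t` into `r` precomposed with a fixed map t' ⊗ t → H, so this
component determines `r` on the image of that map. -/
theorem transpose_coactAct (r : H ⊗ X ⟶ Y) :
    (tensorLeftHomEquiv (t ⊗ X) t t' Y).symm (coactAct κ r t) =
      (α_ t' t X).inv ≫ transposeCoaction κ t t' ▷ X ≫ r := by
  calc
    _ = 𝟙 _ ⊗≫ t' ◁ κ t ▷ X ⊗≫ ((t' ⊗ t) ◁ r ≫ ExactPairing.evaluation t t' ▷ Y) ⊗≫ 𝟙 _ := by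
      dsimp only [tensorLeftHomEquiv, Equiv.coe_fn_symm_mk, coactAct]; monoidal
    _ = _ := by
      rw [whisker_exchange, transposeCoaction]; monoidal

variable [Preadditive C] [MonoidalPreadditive C] {e : 𝟙_ C ⟶ H}
  {ι₁ : H ⟶ 𝟙_ C} {ι₂ : H ⟶ t' ⊗ t}

theorem act_unit' (hκ : κ (𝟙_ C) = e ≫ (λ_ H).inv) (r : H ⊗ X ⟶ Y) :
    coactAct κ r (𝟙_ C) = 𝟙_ C ◁ ((λ_ X).inv ≫ e ▷ X ≫ r) := by
  simp only [coactAct, hκ]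
  monoidal

theorem whiskerLeft_unit_injective : Function.Injective fun f : X ⟶ Y => 𝟙_ C ◁ f := fun f g h => by
  simpa using h

/-- The component at 𝟏 gives `r` on the unit, the component at `t` gives it on the image of t' ⊗ t,
and `hι` says that the two images together exhaust `H`. -/
theorem eq_of_coactAct_eq (hκ : κ (𝟙_ C) = e ≫ (λ_ H).inv)
    (hι : ι₁ ≫ e + ι₂ ≫ transposeCoaction κ t t' = 𝟙 H) (r s : H ⊗ X ⟶ Y)
    (h : ∀ U, coactAct κ r U = coactAct κ s U) : r = s := by
  have h1 : e ▷ X ≫ r = e ▷ X ≫ s := by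
    have := h (𝟙_ C)
    rw [act_unit' hκ, act_unit' hκ] at this
    simpa using whiskerLeft_unit_injective this
  have h2 : transposeCoaction κ t t' ▷ X ≫ r = transposeCoaction κ t t' ▷ X ≫ s := by
    have := congrArg (tensorLeftHomEquiv (t ⊗ X) t t' Y).symm (h t)
    rw [transpose_coactAct, transpose_coactAct] at this
    simpa using this
  calc
    r = (ι₁ ≫ e + ι₂ ≫ transposeCoaction κ t t') ▷ X ≫ r := by rw [hι]; simp
    _ = (ι₁ ≫ e + ι₂ ≫ transposeCoaction κ t t') ▷ X ≫ s := by
      simp only [MonoidalPreadditive.add_whiskerRight, Preadditive.add_comp, comp_whiskerRight,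
        Category.assoc, h1, h2]
    _ = s := by rw [hι]; simp

theorem exists_eq_coactAct (hn : ∀ {U V : C} (f : U ⟶ V), f ≫ κ V = κ U ≫ f ▷ H)
    (hκ : κ (𝟙_ C) = e ≫ (λ_ H).inv) (h11 : e ≫ ι₁ = 𝟙 _) (h12 : e ≫ ι₂ = 0)
    (h21 : transposeCoaction κ t t' ≫ ι₁ = 0) (h22 : transposeCoaction κ t t' ≫ ι₂ = 𝟙 _)
    (hC : ∀ {X Y : C} (f g : ∀ U : C, U ⊗ X ⟶ U ⊗ Y),
      (∀ {U V : C} (a : U ⟶ V), a ▷ X ≫ f V = f U ≫ a ▷ Y) →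
      (∀ {U V : C} (a : U ⟶ V), a ▷ X ≫ g V = g U ≫ a ▷ Y) →
      f (𝟙_ C) = g (𝟙_ C) → f t = g t → ∀ U, f U = g U)
    (f : ∀ U : C, U ⊗ X ⟶ U ⊗ Y) (hf : ∀ {U V : C} (a : U ⟶ V), a ▷ X ≫ f V = f U ≫ a ▷ Y) :
    ∃ r, ∀ U, f U = coactAct κ r U := by
  -- On the summand 𝟏 of `H` the component at 𝟏 is prescribed, on the summand t' ⊗ t the transpose
  -- of the component at `t`; by `hC` these two components determine the family.
  let r : H ⊗ X ⟶ Y := ι₁ ▷ X ≫ f (𝟙_ C) ≫ (λ_ Y).hom +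
    ι₂ ▷ X ≫ (α_ t' t X).hom ≫ (tensorLeftHomEquiv (t ⊗ X) t t' Y).symm (f t)
  have h1 : e ▷ X ≫ r = f (𝟙_ C) ≫ (λ_ Y).hom := by
    simp only [r, Preadditive.comp_add, ← comp_whiskerRight_assoc, h11, h12,
      MonoidalPreadditive.zero_whiskerRight, Limits.zero_comp, add_zero, id_whiskerRight,
      Category.id_comp]
  have h2 : transposeCoaction κ t t' ▷ X ≫ r =
      (α_ t' t X).hom ≫ (tensorLeftHomEquiv (t ⊗ X) t t' Y).symm (f t) := by
    simp only [r, Preadditive.comp_add, ← comp_whiskerRight_assoc, h21, h22,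
      MonoidalPreadditive.zero_whiskerRight, Limits.zero_comp, zero_add, id_whiskerRight,
      Category.id_comp]
  refine ⟨r, hC f (coactAct κ r) hf (coactAct_natural hn r) ?_ ?_⟩
  · rw [act_unit' hκ, h1]
    simp
  · apply (tensorLeftHomEquiv (t ⊗ X) t t' Y).symm.injective
    rw [transpose_coactAct, h2, Iso.inv_hom_id_assoc]

end CenterOfCoaction

/-! ### The coaction of `2 + τ` on all objects -/

namespace FibMat

open Matrix Sum

section Coaction

variable (A₀ A₁ : Type) [DecidableEq A₀] [DecidableEq A₁]

/-- The scalar by which `τ ⊗ τ` occurs in the coaction of `2 + τ` on `τ`. -/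
def kτ : ℂ := (1 + p) * (Rt + 1) * q * w / 2

/-- The `𝟏`-part of the coaction of `2 + τ`. -/
def coact0 : Matrix (T0 A₀ A₁ (Fin 2) Unit) A₀ ℂ
  | inl (a, 0) => Pi.single a 1
  | inl (_, 1) => 0
  | inr _ => 0

/-- The `τ`-part of the coaction of `2 + τ`. -/
def coact1 : Matrix (T1 A₀ A₁ (Fin 2) Unit) A₁ ℂ
  | inl _ => 0
  | inr (inl (a, 0)) => Pi.single a (p / 2)
  | inr (inl (a, 1)) => Pi.single a (1 - p / 2)
  | inr (inr (a, _)) => Pi.single a kτ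

end Coaction

variable {A₀ A₁ B₀ B₁ : Type} [Fintype A₀] [Fintype A₁] [Fintype B₀] [Fintype B₁]
  [DecidableEq A₀] [DecidableEq A₁] [DecidableEq B₀] [DecidableEq B₁]

theorem coact_act :
    (∀ (y : A₀ → ℂ) (i), (coact0 A₀ A₁ *ᵥ y) (inl (i, 0)) = y i) ∧
    (∀ (y : A₀ → ℂ) (i), (coact0 A₀ A₁ *ᵥ y) (inl (i, 1)) = 0) ∧
    (∀ (y : A₀ → ℂ) (i), (coact0 A₀ A₁ *ᵥ y) (inr i) = 0) ∧
    (∀ (y : A₁ → ℂ) (i), (coact1 A₀ A₁ *ᵥ y) (inl i) = 0) ∧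
    (∀ (y : A₁ → ℂ) (i), (coact1 A₀ A₁ *ᵥ y) (inr (inl (i, 0))) = p / 2 * y i) ∧
    (∀ (y : A₁ → ℂ) (i), (coact1 A₀ A₁ *ᵥ y) (inr (inl (i, 1))) = (1 - p / 2) * y i) ∧
    (∀ (y : A₁ → ℂ) (i j), (coact1 A₀ A₁ *ᵥ y) (inr (inr (i, j))) = kτ * y i) := by
  refine ⟨?_, ?_, ?_, ?_, ?_, ?_, ?_⟩
  all_goals
    intros
    simp only [mulVec, coact0, coact1, single_dotProduct, zero_dotProduct, one_mul]

theorem act_zero' {a b : Type} [Fintype a] (M : Matrix b a ℂ) (i : b) :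
    (M *ᵥ fun _ => 0) i = 0 := congrFun (mulVec_zero M) i

theorem coact_natural0 (f₀ : Matrix B₀ A₀ ℂ) (f₁ : Matrix B₁ A₁ ℂ) :
    coact0 B₀ B₁ * f₀ = ten0 f₀ f₁ (1 : Matrix (Fin 2) (Fin 2) ℂ) (1 : Matrix Unit Unit ℂ) *
      coact0 A₀ A₁ := by
  refine ext_act fun v => ?_
  simp only [Sum.forall, Prod.forall, Fin.forall_fin_two, act_scal, act_zero', one_mulVec,
    ← mulVec_mulVec, ten_act, coact_act]
  simp

theorem coact_natural1 (f₀ : Matrix B₀ A₀ ℂ) (f₁ : Matrix B₁ A₁ ℂ) :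
    coact1 B₀ B₁ * f₁ = ten1 f₀ f₁ (1 : Matrix (Fin 2) (Fin 2) ℂ) (1 : Matrix Unit Unit ℂ) *
      coact1 A₀ A₁ := by
  refine ext_act fun v => ?_
  simp only [Sum.forall, Prod.forall, Fin.forall_fin_two, act_scal, act_zero', one_mulVec,
    ← mulVec_mulVec, ten_act, coact_act]
  simp

theorem coact_unit0 : coact0 Unit Empty = lunitInv0 (Fin 2) Unit * N0 := by
  refine ext_act fun v => ?_
  simp only [Sum.forall, Prod.forall, Fin.forall_fin_two, Unique.forall_iff, ← mulVec_mulVec,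
    unit_act, coact_act, hopf_act]
  simp

theorem coact_counit0 : ten0 (1 : Matrix A₀ A₀ ℂ) (1 : Matrix A₁ A₁ ℂ) E0 E1 * coact0 A₀ A₁ =
    runitInv0 A₀ A₁ := by
  refine ext_act fun v => ?_
  simp only [Sum.forall, Prod.forall, Unique.forall_iff, one_mulVec, ← mulVec_mulVec, unit_act,
    coact_act, hopf_act, ten_act]
  simp

theorem coact_counit1 : ten1 (1 : Matrix A₀ A₀ ℂ) (1 : Matrix A₁ A₁ ℂ) E0 E1 * coact1 A₀ A₁ =
    runitInv1 A₀ A₁ := by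
  refine ext_act fun v => ?_
  simp only [Sum.forall, Prod.forall, Unique.forall_iff, one_mulVec, ← mulVec_mulVec, unit_act,
    coact_act, hopf_act, ten_act]
  refine ⟨fun _ b => b.elim, fun a => by ring, fun _ b => b.elim⟩

theorem coact_coassoc0 : assoc0 A₀ A₁ (Fin 2) Unit (Fin 2) Unit *
      ten0 (coact0 A₀ A₁) (coact1 A₀ A₁) (1 : Matrix (Fin 2) (Fin 2) ℂ) (1 : Matrix Unit Unit ℂ) *
      coact0 A₀ A₁ =
    ten0 (1 : Matrix A₀ A₀ ℂ) (1 : Matrix A₁ A₁ ℂ) D0 D1 * coact0 A₀ A₁ := by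
  refine ext_act fun v => ?_
  simp only [Sum.forall, Prod.forall, Fin.forall_fin_two, Unique.forall_iff, act_scal, act_zero',
    one_mulVec, ← mulVec_mulVec, ten_act, assoc_act, coact_act, hopf_act]
  and_intros <;> intros <;> grind

theorem coact_coassoc1 : assoc1 A₀ A₁ (Fin 2) Unit (Fin 2) Unit *
      ten1 (coact0 A₀ A₁) (coact1 A₀ A₁) (1 : Matrix (Fin 2) (Fin 2) ℂ) (1 : Matrix Unit Unit ℂ) *
      coact1 A₀ A₁ =
    ten1 (1 : Matrix A₀ A₀ ℂ) (1 : Matrix A₁ A₁ ℂ) D0 D1 * coact1 A₀ A₁ := by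
  refine ext_act fun v => ?_
  simp only [Sum.forall, Prod.forall, Fin.forall_fin_two, Unique.forall_iff, act_scal, act_zero',
    one_mulVec, ← mulVec_mulVec, ten_act, assoc_act, coact_act, hopf_act, kτ]
  and_intros <;> intros <;> grind [p_mul_p, q_mul_q, w_mul_w, Rt_sq]

/-- Keeps the inverse braiding polynomial, so that the tensor law of the coaction is again a set of
polynomial identities. -/
theorem Rt_inv : Rt⁻¹ = -(p + Rt) := inv_eq_of_mul_eq_one_right (by linear_combination -Rt_sq)

theorem R1_inv : R1⁻¹ = (p + Rt) * (p + Rt) := by rw [R1_eq, mul_inv, Rt_inv]; ring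

theorem coact_tensor0 : coact0 (T0 A₀ A₁ B₀ B₁) (T1 A₀ A₁ B₀ B₁) =
    ten0 (1 : Matrix (T0 A₀ A₁ B₀ B₁) (T0 A₀ A₁ B₀ B₁) ℂ)
        (1 : Matrix (T1 A₀ A₁ B₀ B₁) (T1 A₀ A₁ B₀ B₁) ℂ) M0 M1 *
      assocInv0 A₀ A₁ B₀ B₁ (T0 (Fin 2) Unit (Fin 2) Unit) (T1 (Fin 2) Unit (Fin 2) Unit) *
      ten0 (1 : Matrix A₀ A₀ ℂ) (1 : Matrix A₁ A₁ ℂ) (assoc0 B₀ B₁ (Fin 2) Unit (Fin 2) Unit)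
        (assoc1 B₀ B₁ (Fin 2) Unit (Fin 2) Unit) *
      ten0 (1 : Matrix A₀ A₀ ℂ) (1 : Matrix A₁ A₁ ℂ)
        (ten0 (coact0 B₀ B₁) (coact1 B₀ B₁) (1 : Matrix (Fin 2) (Fin 2) ℂ)
          (1 : Matrix Unit Unit ℂ))
        (ten1 (coact0 B₀ B₁) (coact1 B₀ B₁) (1 : Matrix (Fin 2) (Fin 2) ℂ)
          (1 : Matrix Unit Unit ℂ)) *
      ten0 (1 : Matrix A₀ A₀ ℂ) (1 : Matrix A₁ A₁ ℂ) (braid0 (Fin 2) Unit B₀ B₁ R1⁻¹)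
        (braid1 (Fin 2) Unit B₀ B₁ Rt⁻¹) *
      assoc0 A₀ A₁ (Fin 2) Unit B₀ B₁ *
      ten0 (coact0 A₀ A₁) (coact1 A₀ A₁) (1 : Matrix B₀ B₀ ℂ) (1 : Matrix B₁ B₁ ℂ) := by
  refine ext_act fun v => ?_
  simp only [Sum.forall, Prod.forall, Fin.forall_fin_two, Unique.forall_iff, act_scal, act_zero',
    act_comb, one_mulVec, ← mulVec_mulVec, ten_act, assoc_act, assocInv_act, braid_act, coact_act,
    hopf_act, R1_inv, Rt_inv, kτ]
  and_intros <;> intros <;> grind [p_mul_p, q_mul_q, w_mul_w, Rt_sq]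

theorem coact_tensor1 : coact1 (T0 A₀ A₁ B₀ B₁) (T1 A₀ A₁ B₀ B₁) =
    ten1 (1 : Matrix (T0 A₀ A₁ B₀ B₁) (T0 A₀ A₁ B₀ B₁) ℂ)
        (1 : Matrix (T1 A₀ A₁ B₀ B₁) (T1 A₀ A₁ B₀ B₁) ℂ) M0 M1 *
      assocInv1 A₀ A₁ B₀ B₁ (T0 (Fin 2) Unit (Fin 2) Unit) (T1 (Fin 2) Unit (Fin 2) Unit) *
      ten1 (1 : Matrix A₀ A₀ ℂ) (1 : Matrix A₁ A₁ ℂ) (assoc0 B₀ B₁ (Fin 2) Unit (Fin 2) Unit)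
        (assoc1 B₀ B₁ (Fin 2) Unit (Fin 2) Unit) *
      ten1 (1 : Matrix A₀ A₀ ℂ) (1 : Matrix A₁ A₁ ℂ)
        (ten0 (coact0 B₀ B₁) (coact1 B₀ B₁) (1 : Matrix (Fin 2) (Fin 2) ℂ)
          (1 : Matrix Unit Unit ℂ))
        (ten1 (coact0 B₀ B₁) (coact1 B₀ B₁) (1 : Matrix (Fin 2) (Fin 2) ℂ)
          (1 : Matrix Unit Unit ℂ)) *
      ten1 (1 : Matrix A₀ A₀ ℂ) (1 : Matrix A₁ A₁ ℂ) (braid0 (Fin 2) Unit B₀ B₁ R1⁻¹)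
        (braid1 (Fin 2) Unit B₀ B₁ Rt⁻¹) *
      assoc1 A₀ A₁ (Fin 2) Unit B₀ B₁ *
      ten1 (coact0 A₀ A₁) (coact1 A₀ A₁) (1 : Matrix B₀ B₀ ℂ) (1 : Matrix B₁ B₁ ℂ) := by
  refine ext_act fun v => ?_
  simp only [Sum.forall, Prod.forall, Fin.forall_fin_two, Unique.forall_iff, act_scal, act_zero',
    act_comb, one_mulVec, ← mulVec_mulVec, ten_act, assoc_act, assocInv_act, braid_act, coact_act,
    hopf_act, R1_inv, Rt_inv, kτ]
  and_intros <;> intros <;> grind [p_mul_p, q_mul_q, w_mul_w, Rt_sq]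

end FibMat

/-! ### Duality of `τ` and the decomposition of `2 + τ` -/

namespace FibMat

open Matrix Sum

/-! The duality morphisms of `τ`. -/

def coev0 : Matrix (T0 Empty Unit Empty Unit) Unit ℂ
  | inl (a, _) => a.elim
  | inr _ => Pi.single () 1

def coev1 : Matrix (T1 Empty Unit Empty Unit) Empty ℂ := 0

/-- The zigzag through 𝟏 picks up the F-entry `p`; the factor 1 + p = φ compensates it, as p(1 + p)
= 1. -/
def ev0 : Matrix Unit (T0 Empty Unit Empty Unit) ℂ
  | _ => Pi.single (inr ((), ())) (1 + p)

def ev1 : Matrix Empty (T1 Empty Unit Empty Unit) ℂ := 0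

theorem pairing_act :
    (∀ (y : Unit → ℂ) i, (coev0 *ᵥ y) (inr i) = y ()) ∧
    (∀ (y : Empty → ℂ) i, (coev1 *ᵥ y) i = 0) ∧
    (∀ (y : T0 Empty Unit Empty Unit → ℂ) i, (ev0 *ᵥ y) i = (1 + p) * y (inr ((), ()))) := by
  refine ⟨?_, by simp [coev1], ?_⟩
  all_goals
    intros
    simp only [mulVec, coev0, ev0, single_dotProduct, one_mul]

theorem coev_ev1 : ten1 ev0 ev1 (1 : Matrix Empty Empty ℂ) (1 : Matrix Unit Unit ℂ) *
      assocInv1 Empty Unit Empty Unit Empty Unit *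
      ten1 (1 : Matrix Empty Empty ℂ) (1 : Matrix Unit Unit ℂ) coev0 coev1 =
    lunitInv1 Empty Unit * runit1 Empty Unit := by
  refine ext_act fun v => ?_
  simp only [Sum.forall, Prod.forall, Unique.forall_iff, one_mulVec, ← mulVec_mulVec, act_scal,
    act_zero', ten_act, assocInv_act, unit_act, pairing_act]
  refine ⟨?_, fun i => i.elim, fun i => i.elim⟩
  change (1 + p) * (p * v (inr (inl ((), ()))) + q * 0) = v (inr (inl ((), ())))
  linear_combination v (inr (inl ((), ()))) * p_mul_p

theorem ev_coev1 : ten1 (1 : Matrix Empty Empty ℂ) (1 : Matrix Unit Unit ℂ) ev0 ev1 *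
      assoc1 Empty Unit Empty Unit Empty Unit *
      ten1 coev0 coev1 (1 : Matrix Empty Empty ℂ) (1 : Matrix Unit Unit ℂ) =
    runitInv1 Empty Unit * lunit1 Empty Unit := by
  refine ext_act fun v => ?_
  simp only [Sum.forall, Prod.forall, Unique.forall_iff, one_mulVec, ← mulVec_mulVec, act_scal,
    act_zero', ten_act, assoc_act, unit_act, pairing_act]
  refine ⟨fun i => i.elim, ?_, fun i => i.elim⟩
  change (1 + p) * (p * v (inl ((), ())) + q * 0) = v (inl ((), ()))
  linear_combination v (inl ((), ())) * p_mul_p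

/-! The splitting of `2 + τ` into `𝟏` and `τ ⊗ τ`. -/

def trans0 : Matrix (Fin 2) (T0 Empty Unit Empty Unit) ℂ
  | 0 => Pi.single (inr ((), ())) ((1 + p) * (p / 2))
  | 1 => Pi.single (inr ((), ())) ((1 + p) * (1 - p / 2))

def trans1 : Matrix Unit (T1 Empty Unit Empty Unit) ℂ
  | _ => Pi.single (inr (inr ((), ()))) ((1 + p) * q * kτ)

/-- The functional that is 1 on the unit and vanishes on the image of `trans0`, which is spanned by
(p/2, 1 - p/2); this determines the second coefficient. -/
def split0 : Matrix Unit (Fin 2) ℂ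
  | _ => Pi.single 0 1 + Pi.single 1 (-(1 + 2 * p) / 5)

/-- It vanishes on the unit; its coefficient is inverse to the second entry (1 + p)(1 - p/2) of
`trans0`, because p(1 + p) = 1. -/
def splitTau0 : Matrix (T0 Empty Unit Empty Unit) (Fin 2) ℂ
  | inl (a, _) => a.elim
  | inr _ => Pi.single 1 (p * (1 - p / 2)⁻¹)

def splitTau1 : Matrix (T1 Empty Unit Empty Unit) Unit ℂ
  | inl (a, _) => a.elim
  | inr (inl (_, a)) => a.elim
  | inr (inr _) => Pi.single () ((1 + p) * q * kτ)⁻¹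

theorem split_act :
    (∀ (y : T0 Empty Unit Empty Unit → ℂ),
      (trans0 *ᵥ y) 0 = (1 + p) * (p / 2) * y (inr ((), ()))) ∧
    (∀ (y : T0 Empty Unit Empty Unit → ℂ),
      (trans0 *ᵥ y) 1 = (1 + p) * (1 - p / 2) * y (inr ((), ()))) ∧
    (∀ (y : T1 Empty Unit Empty Unit → ℂ) i,
      (trans1 *ᵥ y) i = (1 + p) * q * kτ * y (inr (inr ((), ())))) ∧
    (∀ (y : Fin 2 → ℂ) i, (split0 *ᵥ y) i = y 0 + -(1 + 2 * p) / 5 * y 1) ∧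
    (∀ (y : Fin 2 → ℂ) i, (splitTau0 *ᵥ y) (inr i) = p * (1 - p / 2)⁻¹ * y 1) ∧
    (∀ (y : Unit → ℂ) i, (splitTau1 *ᵥ y) (inr (inr i)) = ((1 + p) * q * kτ)⁻¹ * y ()) := by
  refine ⟨?_, ?_, ?_, ?_, ?_, ?_⟩
  all_goals
    intros
    simp only [mulVec, trans0, trans1, split0, splitTau0, splitTau1, add_dotProduct,
      single_dotProduct, one_mul]

theorem one_add_p_ne : 1 + p ≠ 0 := fun h => p_ne (by linear_combination p * p * h - p * p_mul_p)

theorem kτ_ne : kτ ≠ 0 :=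
  div_ne_zero (mul_ne_zero (mul_ne_zero (mul_ne_zero one_add_p_ne Rt_ne_neg_one) q_ne) w_ne)
    two_ne_zero

theorem inv_one_sub : (1 - p / 2)⁻¹ = (2 * p + 6) / 5 :=
  inv_eq_of_mul_eq_one_right (by linear_combination (-1 / 5) * p_mul_p)

theorem trans_eq0 : trans0 = lunit0 (Fin 2) Unit *
    ten0 ev0 ev1 (1 : Matrix (Fin 2) (Fin 2) ℂ) (1 : Matrix Unit Unit ℂ) *
    assocInv0 Empty Unit Empty Unit (Fin 2) Unit *
    ten0 (1 : Matrix Empty Empty ℂ) (1 : Matrix Unit Unit ℂ) (coact0 Empty Unit)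
      (coact1 Empty Unit) := by
  refine ext_act fun v => ?_
  simp only [Fin.forall_fin_two, one_mulVec, ← mulVec_mulVec, act_scal,
    act_zero', ten_act, assocInv_act, unit_act, pairing_act, coact_act, split_act]
  exact ⟨by ring, by ring⟩

theorem trans_eq1 : trans1 = lunit1 (Fin 2) Unit *
    ten1 ev0 ev1 (1 : Matrix (Fin 2) (Fin 2) ℂ) (1 : Matrix Unit Unit ℂ) *
    assocInv1 Empty Unit Empty Unit (Fin 2) Unit *
    ten1 (1 : Matrix Empty Empty ℂ) (1 : Matrix Unit Unit ℂ) (coact0 Empty Unit)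
      (coact1 Empty Unit) := by
  refine ext_act fun v => ?_
  simp only [Unique.forall_iff, one_mulVec, ← mulVec_mulVec, act_scal,
    act_zero', ten_act, assocInv_act, unit_act, pairing_act, coact_act, split_act]
  ring

theorem split_sum0 : N0 * split0 + trans0 * splitTau0 = 1 := by
  refine ext_act fun v => Fin.forall_fin_two.2 ⟨?_, ?_⟩
  all_goals simp only [add_mulVec, Pi.add_apply, one_mulVec, ← mulVec_mulVec, hopf_act, split_act]
  all_goals rw [inv_one_sub]
  all_goals grind [p_mul_p]

theorem split_sum1 : N1 * (0 : Matrix Empty Unit ℂ) + trans1 * splitTau1 = 1 := by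
  refine ext_act fun v i => ?_
  simp only [add_mulVec, Pi.add_apply, one_mulVec, ← mulVec_mulVec, hopf_act, split_act]
  rw [mul_inv_cancel_left₀ (mul_ne_zero (mul_ne_zero one_add_p_ne q_ne) kτ_ne), zero_add]

theorem split_one : split0 * N0 = 1 := by
  refine ext_act fun v i => ?_
  simp only [one_mulVec, ← mulVec_mulVec, hopf_act, split_act]
  ring

theorem splitTau_one : splitTau0 * N0 = 0 := by
  refine ext_act fun v => ?_
  simp only [Sum.forall, Prod.forall, zero_mulVec, ← mulVec_mulVec, hopf_act, split_act]
  exact ⟨fun i => i.elim, fun _ _ => mul_zero _⟩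

theorem split_trans : split0 * trans0 = 0 := by
  refine ext_act fun v i => ?_
  simp only [zero_mulVec, ← mulVec_mulVec, split_act, Pi.zero_apply]
  linear_combination (1 + p) * v (inr ((), ())) / 5 * p_mul_p

theorem splitTau_trans0 : splitTau0 * trans0 = 1 := by
  refine ext_act fun v => ?_
  simp only [Sum.forall, Prod.forall, Unique.forall_iff, one_mulVec, ← mulVec_mulVec, split_act,
    inv_one_sub]
  refine ⟨fun i => i.elim, ?_⟩
  change _ = v (inr ((), ()))
  grind [p_mul_p]

theorem splitTau_trans1 : splitTau1 * trans1 = 1 := by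
  refine ext_act fun v => ?_
  simp only [Sum.forall, Prod.forall, Unique.forall_iff, one_mulVec, ← mulVec_mulVec, split_act]
  refine ⟨fun i => i.elim, fun i => i.elim, ?_⟩
  exact inv_mul_cancel_left₀ (mul_ne_zero (mul_ne_zero one_add_p_ne q_ne) kτ_ne) _

end FibMat

/-! ### Universality for Fib and the equivalence with the center -/

namespace Fib

attribute [local instance] monObjTwoPlusTau comonObjTwoPlusTau
  bimonObjTwoPlusTau hopfObjTwoPlusTau

open FibMat MonObj ComonObj HopfObj CenterOfCoaction

instance : ExactPairing tauObj tauObj where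
  coevaluation' := ⟨coev0, coev1⟩
  evaluation' := ⟨ev0, ev1⟩
  coevaluation_evaluation' := hom_ext (funext fun i => i.elim (fun i => i.2.elim)
    fun i => i.1.elim) coev_ev1
  evaluation_coevaluation' := hom_ext (funext fun i => i.elim (fun i => i.1.elim)
    fun i => i.2.elim) ev_coev1

/-- The coaction of `2 + τ` on all objects. -/
def coact (U : Fib) : U ⟶ U ⊗ twoPlusTau := ⟨coact0 U.one U.tau, coact1 U.one U.tau⟩

theorem coact_natural {U V : Fib} (f : U ⟶ V) : f ≫ coact V = coact U ≫ f ▷ twoPlusTau :=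
  hom_ext (coact_natural0 f.one f.tau) (coact_natural1 f.one f.tau)

theorem coact_unit : coact (𝟙_ Fib) = hopfUnit ≫ (λ_ twoPlusTau).inv := by
  rw [hopfUnit_eq]
  exact hom_ext coact_unit0 (funext fun _ => funext fun i => i.elim)

theorem coact_tensor (U V : Fib) : coact (U ⊗ V) = coact U ▷ V ≫ (α_ U twoPlusTau V).hom ≫
    U ◁ (β_ V twoPlusTau).inv ≫ U ◁ coact V ▷ twoPlusTau ≫
    U ◁ (α_ V twoPlusTau twoPlusTau).hom ≫ (α_ U V (twoPlusTau ⊗ twoPlusTau)).inv ≫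
    (U ⊗ V) ◁ hopfMul := by
  rw [hopfMul_eq]
  exact hom_ext coact_tensor0 coact_tensor1

theorem coact_coassoc (U : Fib) :
    coact U ≫ coact U ▷ twoPlusTau ≫ (α_ U twoPlusTau twoPlusTau).hom =
      coact U ≫ U ◁ hopfComul := by
  rw [hopfComul_eq]
  exact hom_ext coact_coassoc0 coact_coassoc1

theorem coact_counit (U : Fib) : coact U ≫ U ◁ hopfCounit = (ρ_ U).inv := by
  rw [hopfCounit_eq]
  exact hom_ext coact_counit0 coact_counit1

/-- The inclusion of a copy of `𝟏`. -/
def incOne (U : Fib) (i : U.one) : 𝟙_ Fib ⟶ U := ⟨fun j _ => if j = i then 1 else 0, 0⟩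
/-- The projection to a copy of `𝟏`. -/
def projOne (U : Fib) (i : U.one) : U ⟶ 𝟙_ Fib := ⟨fun _ j => if j = i then 1 else 0, 0⟩
/-- The inclusion of a copy of `τ`. -/
def incTau (U : Fib) (i : U.tau) : tauObj ⟶ U := ⟨0, fun j _ => if j = i then 1 else 0⟩
/-- The projection to a copy of `τ`. -/
def projTau (U : Fib) (i : U.tau) : U ⟶ tauObj := ⟨0, fun _ j => if j = i then 1 else 0⟩

theorem sum_one {X Y : Fib} {J : Type} (s : Finset J) (f : J → (X ⟶ Y)) :
    (∑ i ∈ s, f i : X ⟶ Y).one = ∑ i ∈ s, (f i).one :=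
  map_sum (AddMonoidHom.mk' (fun g : X ⟶ Y => g.one) fun _ _ => rfl) f s

theorem sum_tau {X Y : Fib} {J : Type} (s : Finset J) (f : J → (X ⟶ Y)) :
    (∑ i ∈ s, f i : X ⟶ Y).tau = ∑ i ∈ s, (f i).tau :=
  map_sum (AddMonoidHom.mk' (fun g : X ⟶ Y => g.tau) fun _ _ => rfl) f s

theorem sum_col_mul_row (n k : Type) [Fintype n] [DecidableEq n] [Fintype k] 
    [Unique k] : ∑ i : n, Matrix.of (fun (j : n) (_ : k) => if j = i then (1 : ℂ) else 0) *
      Matrix.of (fun (_ : k) (j : n) => if j = i then (1 : ℂ) else 0) = 1 := by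
  ext a b
  simp [Matrix.sum_apply, Matrix.mul_apply, Matrix.one_apply]

theorem sum_proj_inc (U : Fib) :
    ∑ i, projOne U i ≫ incOne U i + ∑ i, projTau U i ≫ incTau U i = 𝟙 U := by
  refine hom_ext ?_ ?_
  · rw [add_one, sum_one, sum_one]
    refine Eq.trans ?_ ((add_zero _).trans (sum_col_mul_row U.one Unit))
    exact congrArg _ (Finset.sum_eq_zero fun i _ => Matrix.zero_mul _)
  · rw [add_tau, sum_tau, sum_tau]
    refine Eq.trans ?_ ((zero_add _).trans (sum_col_mul_row U.tau Unit))
    exact congrArg (· + _) (Finset.sum_eq_zero fun i _ => Matrix.zero_mul _)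

/-- Every identity is a sum of morphisms through 𝟏 and τ, and naturality carries the family to those
two objects. -/
theorem natural_ext {X Y : Fib} (f g : ∀ U : Fib, U ⊗ X ⟶ U ⊗ Y)
    (hf : ∀ {U V : Fib} (a : U ⟶ V), a ▷ X ≫ f V = f U ≫ a ▷ Y)
    (hg : ∀ {U V : Fib} (a : U ⟶ V), a ▷ X ≫ g V = g U ≫ a ▷ Y)
    (h1 : f (𝟙_ Fib) = g (𝟙_ Fib)) (h2 : f tauObj = g tauObj) (U : Fib) : f U = g U := by
  have key : ∀ h : ∀ U : Fib, U ⊗ X ⟶ U ⊗ Y,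
      (∀ {U V : Fib} (a : U ⟶ V), a ▷ X ≫ h V = h U ≫ a ▷ Y) →
      h U = ∑ i, projOne U i ▷ X ≫ h (𝟙_ Fib) ≫ incOne U i ▷ Y +
        ∑ i, projTau U i ▷ X ≫ h tauObj ≫ incTau U i ▷ Y := fun h hh => by
    conv_lhs => rw [← Category.id_comp (h U), ← id_whiskerRight, ← sum_proj_inc]
    simp only [MonoidalPreadditive.add_whiskerRight, sum_whiskerRight, Preadditive.add_comp,
      Preadditive.sum_comp, comp_whiskerRight, Category.assoc, hh]
  rw [key f hf, key g hg, h1, h2]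

theorem transpose_coact : transposeCoaction coact tauObj tauObj = ⟨trans0, trans1⟩ :=
  hom_ext trans_eq0.symm trans_eq1.symm

/-- The first projection of `2 + τ = 𝟏 + τ ⊗ τ`. -/
def splitOne : twoPlusTau ⟶ 𝟙_ Fib := ⟨split0, 0⟩
/-- The second projection of `2 + τ = 𝟏 + τ ⊗ τ`. -/
def splitTau : twoPlusTau ⟶ tauObj ⊗ tauObj := ⟨splitTau0, splitTau1⟩

theorem split_sum :
    splitOne ≫ hopfUnit + splitTau ≫ transposeCoaction coact tauObj tauObj = 𝟙 twoPlusTau := by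
  rw [transpose_coact, hopfUnit_eq]
  exact hom_ext split_sum0 split_sum1

/-- The universal coaction of `2 + τ` on the Fibonacci category. -/
def universalCoaction : UniversalCoaction twoPlusTau where
  κ := coact
  natural := coact_natural
  unit := coact_unit
  tensor := coact_tensor
  coassoc := coact_coassoc
  counit := coact_counit
  ext r s h := eq_of_coactAct_eq coact_unit split_sum r s h
  exists_act f hf := exists_eq_coactAct (t := tauObj) (t' := tauObj) (ι₁ := splitOne)
    (ι₂ := splitTau) coact_natural coact_unit
    (by rw [hopfUnit_eq]; exact hom_ext split_one (funext fun i => i.elim))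
    (by rw [hopfUnit_eq]; exact hom_ext splitTau_one (funext fun _ => funext fun i => i.elim))
    (by rw [transpose_coact]; exact hom_ext split_trans (funext fun i => i.elim))
    (by rw [transpose_coact]; exact hom_ext splitTau_trans0 splitTau_trans1) natural_ext f hf

theorem exists_equivalence_center : ∃ E : Mod Fib twoPlusTau ≌ Center Fib,
    Nonempty E.functor.Monoidal ∧ E.functor.Additive ∧ E.functor.Linear ℂ :=
  ⟨universalCoaction.toCenter.asEquivalence,
    ⟨inferInstanceAs universalCoaction.toCenter.Monoidal⟩,
    inferInstanceAs universalCoaction.toCenter.Additive,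
    inferInstanceAs (universalCoaction.toCenter.Linear ℂ)⟩

end Fib

/-! ### Semisimplicity from a Schur family that splits every identity -/

section SimpleDecomposition

universe v u

open Limits

variable {D : Type u} [Category.{v} D] [Preadditive D] {I : Type*} (S : I → D)

/-- The identity of `M` is a sum of `n` morphisms that factor through objects of the family `S`. -/
def FactorsThrough (M : D) (n : ℕ) : Prop :=
  ∃ (c : Fin n → I) (π : ∀ k, M ⟶ S (c k)) (s : ∀ k, S (c k) ⟶ M), ∑ k, π k ≫ s k = 𝟙 M

variable {S}

theorem FactorsThrough.of_sum {M : D} {J : Type*} [Fintype J] (c : J → I) (π : ∀ k, M ⟶ S (c k))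
    (s : ∀ k, S (c k) ⟶ M) (h : ∑ k, π k ≫ s k = 𝟙 M) : ∃ n, FactorsThrough S M n := by
  let e := Fintype.equivFin J
  refine ⟨Fintype.card J, fun k => c (e.symm k), fun k => π (e.symm k), fun k => s (e.symm k), ?_⟩
  rw [← h]
  exact e.symm.sum_comp fun k => π k ≫ s k

/-- An expression of the identity with the least number of terms is automatically a biproduct.
Otherwise a linear relation with an invertible coefficient among the inclusions would eliminate one
term. -/
theorem exists_bicone (hS : ∀ {i j} (f : S i ⟶ S j), f ≠ 0 → IsIso f) (M : D)
    (hM : ∃ n, FactorsThrough S M n) :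
    ∃ (n : ℕ) (c : Fin n → I) (b : Bicone fun k => S (c k)),
      Nonempty b.IsBilimit ∧ Nonempty (b.pt ≅ M) := by
  classical
  obtain ⟨n, hn, hmin⟩ : ∃ n, FactorsThrough S M n ∧ ∀ m, m < n → ¬ FactorsThrough S M m :=
    ⟨Nat.find hM, Nat.find_spec hM, fun m => Nat.find_min hM⟩
  obtain ⟨c, π, s, h⟩ := hn
  let δ : ∀ j k, S (c j) ⟶ S (c k) := fun j k =>
    if h : j = k then eqToHom (congrArg (fun k => S (c k)) h) else 0
  have hδ : ∀ j, ∑ k, δ j k ≫ s k = s j := fun j => by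
    rw [Finset.sum_eq_single j]
    · simp [δ]
    · intro k _ hk
      simp [δ, hk.symm]
    · simp
  have hs : ∀ j, ∑ k, (s j ≫ π k) ≫ s k = s j := fun j => by
    simp only [Category.assoc]
    rw [← Preadditive.comp_sum, h, Category.comp_id]
  -- Composing the decomposition of the identity with `s j` yields this relation among the `s k`; a
  -- nonzero coefficient is invertible by the Schur hypothesis.
  have hN : ∀ j, ∑ k, (δ j k - s j ≫ π k) ≫ s k = 0 := fun j => by
    simp only [Preadditive.sub_comp, Finset.sum_sub_distrib, hδ, hs, sub_self]
  have key : ∀ j k, s j ≫ π k = δ j k := by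
    intro j k
    by_contra hne
    have : IsIso (δ j k - s j ≫ π k) := hS _ (sub_ne_zero.2 (Ne.symm hne))
    obtain ⟨n, rfl⟩ : ∃ m, n = m + 1 := ⟨n - 1, by have := k.2; omega⟩
    have h2 := hN j
    rw [Fin.sum_univ_succAbove _ k] at h2
    have h3 : s k = -(inv (δ j k - s j ≫ π k) ≫
        ∑ l, (δ j (k.succAbove l) - s j ≫ π (k.succAbove l)) ≫ s (k.succAbove l)) := by
      rw [← Preadditive.comp_neg, IsIso.eq_inv_comp]
      exact eq_neg_of_add_eq_zero_left h2
    -- Substituting the expression for `s k` leaves one term fewer, at the cost of correcting the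
    -- projections.
    refine hmin n n.lt_succ_self ⟨fun l => c (k.succAbove l), fun l => π (k.succAbove l) -
      π k ≫ inv (δ j k - s j ≫ π k) ≫ (δ j (k.succAbove l) - s j ≫ π (k.succAbove l)),
      fun l => s (k.succAbove l), ?_⟩
    rw [Fin.sum_univ_succAbove _ k, h3] at h
    rw [← h]
    simp only [Preadditive.sub_comp, Finset.sum_sub_distrib, Preadditive.comp_neg,
      Preadditive.comp_sum, Category.assoc, Preadditive.comp_sub]
    abel
  let b : Bicone fun k => S (c k) := ⟨M, π, s, fun j k => by convert key j k⟩
  exact ⟨n, c, b, ⟨isBilimitOfTotal b h⟩, ⟨Iso.refl M⟩⟩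

/-- A nonzero monomorphism Y → S i is nonzero on some piece of Y. There it is an isomorphism, so it
is split epi as well as mono. -/
theorem simple_of_bicones (hS : ∀ {i j} (f : S i ⟶ S j), f ≠ 0 → IsIso f)
    (h0 : ∀ i, 𝟙 (S i) ≠ 0) (h : ∀ M, ∃ n, FactorsThrough S M n) (i : I) : Simple (S i) where
  mono_isIso_iff_nonzero {Y} f hf := by
    constructor
    · intro h1 h2
      refine h0 i ?_
      rw [← IsIso.inv_hom_id f]
      exact (congrArg (inv f ≫ ·) h2).trans comp_zero
    · intro hf0
      obtain ⟨n, c, π, s, hsum⟩ := h Y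
      obtain ⟨k, hk⟩ : ∃ k, s k ≫ f ≠ 0 := by
        by_contra! hk
        refine hf0 ?_
        rw [← Category.id_comp f, ← hsum, Preadditive.sum_comp]
        exact Finset.sum_eq_zero fun k _ => by rw [Category.assoc, hk, comp_zero]
      have := hS _ hk
      have : IsSplitEpi f := ⟨⟨inv (s k ≫ f) ≫ s k, by simp⟩⟩
      exact isIso_of_mono_of_isSplitEpi f

/-- A nonzero summand inclusion into a simple object is a nonzero monomorphism, hence an
isomorphism. -/
theorem exists_iso_of_simple (hS : ∀ {i j} (f : S i ⟶ S j), f ≠ 0 → IsIso f)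
    (h : ∀ M, ∃ n, FactorsThrough S M n) (M : D) [Simple M] : ∃ i, Nonempty (M ≅ S i) := by
  obtain ⟨n, c, b, ⟨hb⟩, ⟨e⟩⟩ := exists_bicone hS M (h M)
  have total : ∑ k, b.π k ≫ b.ι k = 𝟙 b.pt := IsBilimit.total hb
  obtain ⟨k, hk⟩ : ∃ k, b.ι k ≠ 0 := by
    by_contra! hk
    refine id_nonzero M ?_
    rw [← e.inv_hom_id, ← Category.id_comp e.hom, ← total, Preadditive.sum_comp]
    rw [Finset.sum_eq_zero fun k _ => by rw [hk, comp_zero, zero_comp], comp_zero]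
  have : Mono (b.ι k ≫ e.hom) := inferInstance
  have : IsIso (b.ι k ≫ e.hom) := isIso_of_mono_of_nonzero fun h => hk (by
    rw [← cancel_mono e.hom, h, zero_comp])
  exact ⟨c k, ⟨(asIso (b.ι k ≫ e.hom)).symm⟩⟩

theorem everyObjectSemisimple (hS : ∀ {i j} (f : S i ⟶ S j), f ≠ 0 → IsIso f)
    (h0 : ∀ i, 𝟙 (S i) ≠ 0) (h : ∀ M, ∃ n, FactorsThrough S M n) : EveryObjectSemisimple D :=
  fun M => by
    obtain ⟨n, c, b, hb, he⟩ := exists_bicone hS M (h M)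
    exact ⟨n, fun k => S (c k), fun k => simple_of_bicones hS h0 h (c k), b, hb, he⟩

end SimpleDecomposition

/-! ### Modules over `2 + τ` as five matrices -/

namespace FibMat

open Matrix Sum

section ModuleData

variable {X₀ X₁ Y₀ Y₁ : Type} [Fintype X₀] [Fintype X₁] [Fintype Y₀] [Fintype Y₁]
  [DecidableEq X₀] [DecidableEq X₁] [DecidableEq Y₀] [DecidableEq Y₁]

/-- The `𝟏`-part of an action of `2 + τ`, for which the first copy of `𝟏` acts as identity. -/
def actOne (G₀ : Matrix X₀ X₀ ℂ) (C : Matrix X₀ X₁ ℂ) :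
    Matrix X₀ (T0 (Fin 2) Unit X₀ X₁) ℂ := fun i x => match x with
  | inl (0, j) => (1 : Matrix X₀ X₀ ℂ) i j
  | inl (1, j) => G₀ i j
  | inr (_, j) => C i j

/-- The `τ`-part of an action of `2 + τ`, for which the first copy of `𝟏` acts as identity. -/
def actTau (G₁ : Matrix X₁ X₁ ℂ) (D : Matrix X₁ X₀ ℂ) (E : Matrix X₁ X₁ ℂ) :
    Matrix X₁ (T1 (Fin 2) Unit X₀ X₁) ℂ := fun i x => match x with
  | inl (0, j) => (1 : Matrix X₁ X₁ ℂ) i j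
  | inl (1, j) => G₁ i j
  | inr (inl (_, j)) => D i j
  | inr (inr (_, j)) => E i j

theorem actOne_act (G₀ : Matrix X₀ X₀ ℂ) (C : Matrix X₀ X₁ ℂ)
    (v : T0 (Fin 2) Unit X₀ X₁ → ℂ) :
    actOne G₀ C *ᵥ v = fun i => v (inl (0, i)) + (G₀ *ᵥ fun j => v (inl (1, j))) i +
      (C *ᵥ fun j => v (inr ((), j))) i := by
  funext i
  simp [mulVec, dotProduct, Fintype.sum_sum_type, Fintype.sum_prod_type, actOne, Matrix.one_apply]

theorem actTau_act (G₁ : Matrix X₁ X₁ ℂ) (D : Matrix X₁ X₀ ℂ) (E : Matrix X₁ X₁ ℂ)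
    (v : T1 (Fin 2) Unit X₀ X₁ → ℂ) :
    actTau G₁ D E *ᵥ v = fun i => v (inl (0, i)) + (G₁ *ᵥ fun j => v (inl (1, j))) i +
      (D *ᵥ fun j => v (inr (inl ((), j)))) i + (E *ᵥ fun j => v (inr (inr ((), j)))) i := by
  funext i
  simp [mulVec, dotProduct, Fintype.sum_sum_type, Fintype.sum_prod_type, actTau, Matrix.one_apply,
    add_assoc]

/-- The equations of an action of `2 + τ`. -/
structure IsAction (G₀ : Matrix X₀ X₀ ℂ) (C : Matrix X₀ X₁ ℂ) (G₁ : Matrix X₁ X₁ ℂ)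
    (D : Matrix X₁ X₀ ℂ) (E : Matrix X₁ X₁ ℂ) : Prop where
  g₀ : G₀ * G₀ = 1
  g₁ : G₁ * G₁ = 1
  gc : G₀ * C = -C
  cg : C * G₁ = -C
  gd : G₁ * D = -D
  dg : D * G₀ = -D
  ge : G₁ * E = -E
  eg : E * G₁ = -E
  cd : C * D = 1 - G₀
  ed : E * D = -w • D
  ce : C * E = -w • C
  -- The last two equations are the module law for τ, τ acting from τ to τ: the F-matrix mixes the
  -- paths through 𝟏 and through τ.
  dc_ee : p • (D * C) + q • (E * E) = 1 - G₁
  dc_ee' : q • (D * C) - p • (E * E) = -w • E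

variable {G₀ : Matrix X₀ X₀ ℂ} {C : Matrix X₀ X₁ ℂ} {G₁ : Matrix X₁ X₁ ℂ} {D : Matrix X₁ X₀ ℂ}
  {E : Matrix X₁ X₁ ℂ} {G₀' : Matrix Y₀ Y₀ ℂ} {C' : Matrix Y₀ Y₁ ℂ} {G₁' : Matrix Y₁ Y₁ ℂ}
  {D' : Matrix Y₁ Y₀ ℂ} {E' : Matrix Y₁ Y₁ ℂ}

theorem act_add' {a b : Type} [Fintype a] (M : Matrix b a ℂ) (x y : a → ℂ) (i : b) :
    (M *ᵥ fun j => x j + y j) i = (M *ᵥ x) i + (M *ᵥ y) i := congrFun (mulVec_add M x y) i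

theorem act_sub' {a b : Type} [Fintype a] (M : Matrix b a ℂ) (x y : a → ℂ) (i : b) :
    (M *ᵥ fun j => x j - y j) i = (M *ᵥ x) i - (M *ᵥ y) i := congrFun (mulVec_sub M x y) i

theorem act_neg' {a b : Type} [Fintype a] (M : Matrix b a ℂ) (x : a → ℂ) (i : b) :
    (M *ᵥ fun j => -x j) i = -(M *ᵥ x) i := congrFun (mulVec_neg x M) i

/-- Each equation is the module law on a vector supported on one summand of (H ⊗ H) ⊗ X. -/
theorem isAction_of_mul
    (H0 : actOne G₀ C * ten0 M0 M1 (1 : Matrix X₀ X₀ ℂ) (1 : Matrix X₁ X₁ ℂ) =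
      actOne G₀ C * ten0 (1 : Matrix (Fin 2) (Fin 2) ℂ) (1 : Matrix Unit Unit ℂ) (actOne G₀ C)
        (actTau G₁ D E) * assoc0 (Fin 2) Unit (Fin 2) Unit X₀ X₁)
    (H1 : actTau G₁ D E * ten1 M0 M1 (1 : Matrix X₀ X₀ ℂ) (1 : Matrix X₁ X₁ ℂ) =
      actTau G₁ D E * ten1 (1 : Matrix (Fin 2) (Fin 2) ℂ) (1 : Matrix Unit Unit ℂ) (actOne G₀ C)
        (actTau G₁ D E) * assoc1 (Fin 2) Unit (Fin 2) Unit X₀ X₁) :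
    IsAction G₀ C G₁ D E := by
  have K0 := fun v i => congrFun (congrArg (· *ᵥ v) H0) i
  have K1 := fun v i => congrFun (congrArg (· *ᵥ v) H1) i
  simp only [← mulVec_mulVec, actOne_act, actTau_act, one_mulVec, ten_act, assoc_act, hopf_act]
    at K0 K1
  constructor
  · refine ext_act fun y i => ?_
    have := K0 (Sum.elim (fun x => Sum.elim (fun a => if a = (1, 1) then y x.2 else 0) (fun _ => 0) x.1)
      fun _ => 0) i
    simpa [act_zero', ← mulVec_mulVec] using this.symm
  · refine ext_act fun y i => ?_
    have := K1 (Sum.elim (fun x => Sum.elim (fun a => if a = (1, 1) then y x.2 else 0) (fun _ => 0) x.1)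
      fun _ => 0) i
    simpa [act_zero', ← mulVec_mulVec] using this.symm
  · refine ext_act fun y i => ?_
    have := K0 (Sum.elim (fun _ => 0) fun x => Sum.elim (fun a => if a.1 = 1 then y x.2 else 0)
      (fun _ => 0) x.1) i
    simpa [act_zero', act_neg', ← mulVec_mulVec, neg_mulVec] using this.symm
  · refine ext_act fun y i => ?_
    have := K0 (Sum.elim (fun _ => 0) fun x => Sum.elim (fun _ => 0) (Sum.elim (fun a => if a.2 = 1 then y x.2
      else 0) fun _ => 0) x.1) i
    simpa [act_zero', act_neg', ← mulVec_mulVec, neg_mulVec] using this.symm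
  · refine ext_act fun y i => ?_
    have := K1 (Sum.elim (fun _ => 0) (Sum.elim (fun x => Sum.elim (fun a => if a.1 = 1 then y x.2 else 0)
      (fun _ => 0) x.1) fun _ => 0)) i
    simpa [act_zero', act_neg', ← mulVec_mulVec, neg_mulVec] using this.symm
  · refine ext_act fun y i => ?_
    have := K1 (Sum.elim (fun _ => 0) (Sum.elim (fun x => Sum.elim (fun _ => 0) (Sum.elim (fun a => if a.2 = 1
      then y x.2 else 0) fun _ => 0) x.1) fun _ => 0)) i
    simpa [act_zero', act_neg', ← mulVec_mulVec, neg_mulVec] using this.symm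
  · refine ext_act fun y i => ?_
    have := K1 (Sum.elim (fun _ => 0) (Sum.elim (fun _ => 0) fun x => Sum.elim (fun a => if a.1 = 1 then y x.2
      else 0) (fun _ => 0) x.1)) i
    simpa [act_zero', act_neg', ← mulVec_mulVec, neg_mulVec] using this.symm
  · refine ext_act fun y i => ?_
    have := K1 (Sum.elim (fun _ => 0) (Sum.elim (fun _ => 0) fun x => Sum.elim (fun _ => 0) (Sum.elim (fun a =>
      if a.2 = 1 then y x.2 else 0) fun _ => 0) x.1)) i
    simpa [act_zero', act_neg', ← mulVec_mulVec, neg_mulVec] using this.symm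
  · refine ext_act fun y i => ?_
    have := K0 (Sum.elim (fun x => Sum.elim (fun _ => 0) (fun _ => y x.2) x.1) fun _ => 0) i
    simpa [act_zero', act_neg', ← mulVec_mulVec, sub_mulVec, ← sub_eq_add_neg] using this.symm
  · refine ext_act fun y i => ?_
    have := K1 (Sum.elim (fun _ => 0) (Sum.elim (fun x => Sum.elim (fun _ => 0) (Sum.elim (fun _ => 0) fun _ =>
      y x.2) x.1) fun _ => 0)) i
    simpa [act_zero', act_neg', act_scal, ← mulVec_mulVec, smul_mulVec, neg_mulVec] using this.symm
  · refine ext_act fun y i => ?_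
    have := K0 (Sum.elim (fun _ => 0) fun x => Sum.elim (fun _ => 0) (Sum.elim (fun _ => 0) fun _ => y x.2)
      x.1) i
    simpa [act_zero', act_neg', act_scal, ← mulVec_mulVec, smul_mulVec, neg_mulVec] using this.symm
  · refine ext_act fun y i => ?_
    have := K1 (Sum.elim (fun x => Sum.elim (fun _ => 0) (fun _ => y x.2) x.1) fun _ => 0) i
    simpa [act_zero', act_neg', act_scal, ← mulVec_mulVec, sub_mulVec, add_mulVec, smul_mulVec,
      neg_mulVec,      ← sub_eq_add_neg] using this.symm
  · refine ext_act fun y i => ?_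
    have := K1 (Sum.elim (fun _ => 0) (Sum.elim (fun _ => 0) fun x => Sum.elim (fun _ => 0) (Sum.elim (fun _ => 0)
      fun _ => y x.2) x.1)) i
    simpa [act_zero', act_neg', act_scal, ← mulVec_mulVec, sub_mulVec, add_mulVec, smul_mulVec,
      neg_mulVec,      ← sub_eq_add_neg] using this.symm

theorem mulVec_of_mul_eq {a b c : Type} [Fintype a] [Fintype b] {M : Matrix c b ℂ}
    {N : Matrix b a ℂ} {K : Matrix c a ℂ} (h : M * N = K) (x : a → ℂ) (i : c) :
    (M *ᵥ fun j => (N *ᵥ x) j) i = (K *ᵥ x) i := by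
  rw [← h, ← mulVec_mulVec]

theorem mulVec_fun_zero {a b : Type} [Fintype a] (M : Matrix b a ℂ) :
    (M *ᵥ fun _ => 0) = fun _ => 0 := mulVec_zero M

/-- The F-matrix is its own inverse, since p² + q² = 1, so the pair `dc_ee`, `dc_ee'` can be solved
for E E and D C. -/
theorem IsAction.ee (h : IsAction G₀ C G₁ D E) : E * E = q • (1 - G₁) + (p * w) • E := by
  ext i j
  have h1 := congrFun₂ h.dc_ee i j
  have h2 := congrFun₂ h.dc_ee' i j
  simp only [Matrix.add_apply, Matrix.sub_apply, Matrix.smul_apply, smul_eq_mul, neg_smul,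
    Matrix.neg_apply] at h1 h2 ⊢
  linear_combination q * h1 - p * h2 - (p_mul_p + q_mul_q) * (E * E) i j

theorem IsAction.dc (h : IsAction G₀ C G₁ D E) : D * C = p • (1 - G₁) - (q * w) • E := by
  ext i j
  have h1 := congrFun₂ h.dc_ee i j
  have h2 := congrFun₂ h.dc_ee' i j
  simp only [Matrix.add_apply, Matrix.sub_apply, Matrix.smul_apply, smul_eq_mul, neg_smul,
    Matrix.neg_apply] at h1 h2 ⊢
  linear_combination p * h1 + q * h2 - (p_mul_p + q_mul_q) * (D * C) i j

theorem IsAction.mul (h : IsAction G₀ C G₁ D E) :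
    actOne G₀ C * ten0 M0 M1 (1 : Matrix X₀ X₀ ℂ) (1 : Matrix X₁ X₁ ℂ) =
      actOne G₀ C * ten0 (1 : Matrix (Fin 2) (Fin 2) ℂ) (1 : Matrix Unit Unit ℂ) (actOne G₀ C)
        (actTau G₁ D E) * assoc0 (Fin 2) Unit (Fin 2) Unit X₀ X₁ ∧
    actTau G₁ D E * ten1 M0 M1 (1 : Matrix X₀ X₀ ℂ) (1 : Matrix X₁ X₁ ℂ) =
      actTau G₁ D E * ten1 (1 : Matrix (Fin 2) (Fin 2) ℂ) (1 : Matrix Unit Unit ℂ) (actOne G₀ C)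
        (actTau G₁ D E) * assoc1 (Fin 2) Unit (Fin 2) Unit X₀ X₁ := by
  constructor
  · refine ext_act fun v i => ?_
    simp only [← mulVec_mulVec, actOne_act, actTau_act, one_mulVec, ten_act, assoc_act, hopf_act,
      act_add', act_sub', act_neg', act_scal, mulVec_of_mul_eq h.g₀, mulVec_of_mul_eq h.gc, mulVec_of_mul_eq h.cg,
      mulVec_of_mul_eq h.cd, mulVec_of_mul_eq h.ce, sub_mulVec, neg_mulVec, smul_mulVec, Pi.sub_apply, Pi.neg_apply, Pi.smul_apply, smul_eq_mul]
    ring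
  · refine ext_act fun v i => ?_
    simp only [← mulVec_mulVec, actOne_act, actTau_act, one_mulVec, ten_act, assoc_act, hopf_act,
      act_add', act_sub', act_neg', act_scal, mulVec_of_mul_eq h.g₁, mulVec_of_mul_eq h.ge, mulVec_of_mul_eq h.eg,
      mulVec_of_mul_eq h.gd, mulVec_of_mul_eq h.dg, mulVec_of_mul_eq h.ed, mulVec_of_mul_eq h.ee, mulVec_of_mul_eq h.dc, add_mulVec, sub_mulVec, neg_mulVec, smul_mulVec, Pi.sub_apply, Pi.add_apply, Pi.neg_apply, Pi.smul_apply, smul_eq_mul]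
    -- What remains is a multiple of p² + q² - 1.
    linear_combination (-(v (inl (inr ((), ()), i)) - (G₁ *ᵥ fun j => v (inl (inr ((), ()), j))) i -
      w * (E *ᵥ fun x => v (inr (inr (inr (inr ((), ())), x)))) i)) * (p_mul_p + q_mul_q)

theorem hom_of_commute {f₀ : Matrix Y₀ X₀ ℂ} {f₁ : Matrix Y₁ X₁ ℂ} (h1 : f₀ * G₀ = G₀' * f₀)
    (h2 : f₁ * G₁ = G₁' * f₁) (h3 : f₀ * C = C' * f₁) (h4 : f₁ * D = D' * f₀)
    (h5 : f₁ * E = E' * f₁) :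
    f₀ * actOne G₀ C = actOne G₀' C' * ten0 (1 : Matrix (Fin 2) (Fin 2) ℂ)
      (1 : Matrix Unit Unit ℂ) f₀ f₁ ∧
    f₁ * actTau G₁ D E = actTau G₁' D' E' * ten1 (1 : Matrix (Fin 2) (Fin 2) ℂ)
      (1 : Matrix Unit Unit ℂ) f₀ f₁ := by
  constructor <;> refine ext_act fun v i => ?_
  · simp only [← mulVec_mulVec, actOne_act, one_mulVec, ten_act, act_add', mulVec_of_mul_eq h1,
      mulVec_of_mul_eq h3]
  · simp only [← mulVec_mulVec, actTau_act, one_mulVec, ten_act, act_add', mulVec_of_mul_eq h2,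
      mulVec_of_mul_eq h4, mulVec_of_mul_eq h5]

theorem commute_of_hom {f₀ : Matrix Y₀ X₀ ℂ} {f₁ : Matrix Y₁ X₁ ℂ}
    (H0 : f₀ * actOne G₀ C = actOne G₀' C' * ten0 (1 : Matrix (Fin 2) (Fin 2) ℂ)
      (1 : Matrix Unit Unit ℂ) f₀ f₁)
    (H1 : f₁ * actTau G₁ D E = actTau G₁' D' E' * ten1 (1 : Matrix (Fin 2) (Fin 2) ℂ)
      (1 : Matrix Unit Unit ℂ) f₀ f₁) :
    f₀ * G₀ = G₀' * f₀ ∧ f₁ * G₁ = G₁' * f₁ ∧ f₀ * C = C' * f₁ ∧ f₁ * D = D' * f₀ ∧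
      f₁ * E = E' * f₁ := by
  have K0 := fun v i => congrFun (congrArg (· *ᵥ v) H0) i
  have K1 := fun v i => congrFun (congrArg (· *ᵥ v) H1) i
  simp only [← mulVec_mulVec, actOne_act, actTau_act, one_mulVec, ten_act, act_add'] at K0 K1
  refine ⟨?_, ?_, ?_, ?_, ?_⟩ <;> refine ext_act fun y i => ?_
  · have := K0 (Sum.elim (fun x => if x.1 = 1 then y x.2 else 0) fun _ => 0) i
    simpa [mulVec_fun_zero, ← mulVec_mulVec] using this
  · have := K1 (Sum.elim (fun x => if x.1 = 1 then y x.2 else 0) fun _ => 0) i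
    simpa [mulVec_fun_zero, ← mulVec_mulVec] using this
  · have := K0 (Sum.elim (fun _ => 0) fun x => y x.2) i
    simpa [mulVec_fun_zero, ← mulVec_mulVec] using this
  · have := K1 (Sum.elim (fun _ => 0) (Sum.elim (fun x => y x.2) fun _ => 0)) i
    simpa [mulVec_fun_zero, ← mulVec_mulVec] using this
  · have := K1 (Sum.elim (fun _ => 0) (Sum.elim (fun _ => 0) fun x => y x.2)) i
    simpa [mulVec_fun_zero, ← mulVec_mulVec] using this

end ModuleData

end FibMat

/-! ### The unit law and the matrices of the four modules -/

namespace FibMat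

open Matrix Sum

section ModuleUnit

variable {X₀ X₁ : Type} [Fintype X₀] [Fintype X₁] [DecidableEq X₀] [DecidableEq X₁]

theorem eq_actOne {r : Matrix X₀ (T0 (Fin 2) Unit X₀ X₁) ℂ}
    (h : r * ten0 N0 N1 (1 : Matrix X₀ X₀ ℂ) (1 : Matrix X₁ X₁ ℂ) = lunit0 X₀ X₁) :
    r = actOne (fun i j => r i (inl (1, j))) fun i j => r i (inr ((), j)) := by
  ext i (⟨k, j⟩ | ⟨k, j⟩)
  · fin_cases k
    · have := congrFun₂ h i (inl ((), j))
      simpa [Matrix.mul_apply, Fintype.sum_sum_type, Fintype.sum_prod_type, ten0, lunit0, N0,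
        Matrix.one_apply, Pi.single_apply, actOne, eq_comm] using this
    · rfl
  · rfl

theorem eq_actTau {r : Matrix X₁ (T1 (Fin 2) Unit X₀ X₁) ℂ}
    (h : r * ten1 N0 N1 (1 : Matrix X₀ X₀ ℂ) (1 : Matrix X₁ X₁ ℂ) = lunit1 X₀ X₁) :
    r = actTau (fun i j => r i (inl (1, j))) (fun i j => r i (inr (inl ((), j))))
      fun i j => r i (inr (inr ((), j))) := by
  ext i (⟨k, j⟩ | ⟨k, j⟩ | ⟨k, j⟩)
  · fin_cases k
    · have := congrFun₂ h i (inl ((), j))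
      simpa [Matrix.mul_apply, Fintype.sum_sum_type, Fintype.sum_prod_type, ten1, lunit1, N0,
        Matrix.one_apply, Pi.single_apply, actTau, eq_comm] using this
    · rfl
  · rfl
  · rfl

theorem actOne_unit (G₀ : Matrix X₀ X₀ ℂ) (C : Matrix X₀ X₁ ℂ) :
    actOne G₀ C * ten0 N0 N1 (1 : Matrix X₀ X₀ ℂ) (1 : Matrix X₁ X₁ ℂ) = lunit0 X₀ X₁ := by
  refine ext_act fun v i => ?_
  simp [← mulVec_mulVec, actOne_act, ten_act, hopf_act, unit_act, mulVec_fun_zero]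

theorem actTau_unit (G₁ : Matrix X₁ X₁ ℂ) (D : Matrix X₁ X₀ ℂ) (E : Matrix X₁ X₁ ℂ) :
    actTau G₁ D E * ten1 N0 N1 (1 : Matrix X₀ X₀ ℂ) (1 : Matrix X₁ X₁ ℂ) = lunit1 X₀ X₁ := by
  refine ext_act fun v i => ?_
  simp [← mulVec_mulVec, actTau_act, ten_act, hopf_act, unit_act, mulVec_fun_zero]

end ModuleUnit

theorem isAction_zero : IsAction (1 : Matrix Unit Unit ℂ) (0 : Matrix Unit Empty ℂ) 1 0 0 := by
  constructor <;> first | exact Subsingleton.elim _ _ | simp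

theorem isAction_one : IsAction (1 : Matrix Empty Empty ℂ) (0 : Matrix Empty Unit ℂ) 1 0 0 := by
  constructor <;> simp

/-- Without copies of 𝟏 one has D C = 0, so G₁ = -1 forces q w E = 2p; the solution is E = w/p = (1
+ p) w. -/
theorem isAction_two : IsAction (1 : Matrix Empty Empty ℂ) (0 : Matrix Empty Unit ℂ) (-1) 0
    (((1 + p) * w) • 1) := by
  constructor <;> first | exact Subsingleton.elim _ _ | (ext; simp)
  · grind [p_mul_p, q_mul_q, w_mul_w]
  · grind [p_mul_p, q_mul_q, w_mul_w]

theorem isAction_three : IsAction (-1 : Matrix Unit Unit ℂ) (1 : Matrix Unit Unit ℂ) (-1)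
    ((2 : ℂ) • 1) (-w • 1) := by
  constructor <;> ext <;> simp
  all_goals grind [p_mul_p, q_mul_q, w_mul_w]

end FibMat

/-! ### Translation between modules and matrices -/

namespace Fib

attribute [local instance] monObjTwoPlusTau comonObjTwoPlusTau
  bimonObjTwoPlusTau hopfObjTwoPlusTau

open FibMat Sum ModTensor MonObj

variable (M N : Mod Fib twoPlusTau)

/-- The action of the second copy of `𝟏` on the copies of `𝟏`. -/
def modG₀ : Matrix M.X.one M.X.one ℂ := fun i j => (act M).one i (inl ((1 : Fin 2), j))
/-- The action of `τ` from the copies of `τ` to the copies of `𝟏`. -/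
def modC : Matrix M.X.one M.X.tau ℂ := fun i j => (act M).one i (inr ((), j))
/-- The action of the second copy of `𝟏` on the copies of `τ`. -/
def modG₁ : Matrix M.X.tau M.X.tau ℂ := fun i j => (act M).tau i (inl ((1 : Fin 2), j))
/-- The action of `τ` from the copies of `𝟏` to the copies of `τ`. -/
def modD : Matrix M.X.tau M.X.one ℂ := fun i j => (act M).tau i (inr (inl ((), j)))
/-- The action of `τ` from the copies of `τ` to the copies of `τ`. -/
def modE : Matrix M.X.tau M.X.tau ℂ := fun i j => (act M).tau i (inr (inr ((), j)))

theorem act_eq : act M = ⟨actOne (modG₀ M) (modC M), actTau (modG₁ M) (modD M) (modE M)⟩ := by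
  have h : hopfUnit ▷ M.X ≫ act M = (λ_ M.X).hom := one_act M
  rw [hopfUnit_eq] at h
  exact hom_ext (eq_actOne (congrArg Hom.one h)) (eq_actTau (congrArg Hom.tau h))

theorem isAction : IsAction (modG₀ M) (modC M) (modG₁ M) (modD M) (modE M) := by
  have h : hopfMul ▷ M.X ≫ act M = (α_ _ _ M.X).hom ≫ twoPlusTau ◁ act M ≫ act M := mul_act M
  rw [hopfMul_eq, act_eq] at h
  exact isAction_of_mul (congrArg Hom.one h) (congrArg Hom.tau h)

/-- A module from its matrices. -/
def modOf {X₀ X₁ : Type} [Fintype X₀] [Fintype X₁] [DecidableEq X₀] [DecidableEq X₁]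
    {G₀ : Matrix X₀ X₀ ℂ} {C : Matrix X₀ X₁ ℂ} {G₁ : Matrix X₁ X₁ ℂ} {D : Matrix X₁ X₀ ℂ}
    {E : Matrix X₁ X₁ ℂ} (h : IsAction G₀ C G₁ D E) : Mod Fib twoPlusTau :=
  mkMod (X := ⟨X₀, X₁⟩) ⟨actOne G₀ C, actTau G₁ D E⟩
    (by
      change hopfUnit ▷ _ ≫ _ = _
      rw [hopfUnit_eq]
      exact hom_ext (actOne_unit _ _) (actTau_unit _ _ _))
    (by
      change hopfMul ▷ _ ≫ _ = _
      rw [hopfMul_eq]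
      exact hom_ext h.mul.1 h.mul.2)

variable {M N}

/-- A module morphism from its matrices. -/
def modHom (f₀ : Matrix N.X.one M.X.one ℂ) (f₁ : Matrix N.X.tau M.X.tau ℂ)
    (h₁ : f₀ * modG₀ M = modG₀ N * f₀) (h₂ : f₁ * modG₁ M = modG₁ N * f₁)
    (h₃ : f₀ * modC M = modC N * f₁) (h₄ : f₁ * modD M = modD N * f₀)
    (h₅ : f₁ * modE M = modE N * f₁) : M ⟶ N :=
  mkHom ⟨f₀, f₁⟩ (by
    have := hom_of_commute h₁ h₂ h₃ h₄ h₅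
    rw [act_eq, act_eq]
    exact hom_ext this.1 this.2)

theorem modHom_commute (f : M ⟶ N) :
    f.hom.one * modG₀ M = modG₀ N * f.hom.one ∧ f.hom.tau * modG₁ M = modG₁ N * f.hom.tau ∧
      f.hom.one * modC M = modC N * f.hom.tau ∧ f.hom.tau * modD M = modD N * f.hom.one ∧
      f.hom.tau * modE M = modE N * f.hom.tau := by
  have h := act_hom f
  rw [act_eq, act_eq] at h
  exact commute_of_hom (congrArg Hom.one h) (congrArg Hom.tau h)

end Fib

/-! ### Idempotents attached to a module -/

namespace FibMat

open Matrix

section Projections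

variable {X₀ X₁ : Type} [Fintype X₀] [Fintype X₁] [DecidableEq X₀] [DecidableEq X₁]
  {G₀ : Matrix X₀ X₀ ℂ} {C : Matrix X₀ X₁ ℂ} {G₁ : Matrix X₁ X₁ ℂ} {D : Matrix X₁ X₀ ℂ}
  {E : Matrix X₁ X₁ ℂ}

theorem half_add_mul_self {X : Type} [Fintype X] [DecidableEq X] {G : Matrix X X ℂ}
    (h : G * G = 1) :
    ((1 / 2 : ℂ) • (1 + G)) * ((1 / 2 : ℂ) • (1 + G)) = (1 / 2 : ℂ) • (1 + G) := by
  rw [Matrix.smul_mul, Matrix.mul_smul, Matrix.add_mul, Matrix.mul_add, Matrix.mul_add, h, Matrix.one_mul,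
    Matrix.mul_one, Matrix.one_mul]
  module

theorem half_sub_mul_self {X : Type} [Fintype X] [DecidableEq X] {G : Matrix X X ℂ}
    (h : G * G = 1) :
    ((1 / 2 : ℂ) • (1 - G)) * ((1 / 2 : ℂ) • (1 - G)) = (1 / 2 : ℂ) • (1 - G) := by
  rw [Matrix.smul_mul, Matrix.mul_smul, Matrix.sub_mul, Matrix.mul_sub, Matrix.mul_sub, h, Matrix.one_mul,
    Matrix.mul_one, Matrix.one_mul]
  module

/-- A row of a matrix, as a matrix. -/
def rowMat {X Y : Type} (A : Matrix X Y ℂ) (k : X) : Matrix Unit Y ℂ := fun _ j => A k j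
/-- A column of a matrix, as a matrix. -/
def colMat {X Y : Type} (A : Matrix X Y ℂ) (k : Y) : Matrix X Unit ℂ := fun i _ => A i k

theorem sum_colMat_mul_rowMat {X Y Z : Type} [Fintype Y] (A : Matrix X Y ℂ) (B : Matrix Y Z ℂ) :
    ∑ k, colMat A k * rowMat B k = A * B := by
  ext i j
  simp [Matrix.sum_apply, Matrix.mul_apply, colMat, rowMat]

theorem sum_smul_mul_colMat_mul_rowMat_mul {V X Y Z W : Type} [Fintype X] [Fintype Y] [Fintype Z]
    (c : ℂ) (D : Matrix V X ℂ) (A : Matrix X Y ℂ) (B : Matrix Y Z ℂ) (C : Matrix Z W ℂ) :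
    ∑ k, (c • (D * colMat A k)) * (rowMat B k * C) = (c • (D * A)) * (B * C) :=
  sum_colMat_mul_rowMat (c • (D * A)) (B * C)

variable (G₁ D C) in
/-- The projection to the part of the copies of `τ` on which `E` has the eigenvalue `(1 + p) w`. -/
def projTwo : Matrix X₁ X₁ ℂ := (1 / 2 : ℂ) • (1 - G₁ - D * C)

namespace IsAction

variable (h : IsAction G₀ C G₁ D E)
include h

/-- The formula for D C solved for E: the inverse of q w is (2 + p) w / 2. On the image of
`projTwo`, where G₁ = -1 and D C vanishes, this exhibits the eigenvalue (1 + p) w. -/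
theorem e_eq : E = ((1 + p) * w / 2) • (1 - G₁) - ((2 + p) * w / 2) • (D * C) := by
  ext i j
  have h1 := congrFun₂ h.dc i j
  simp only [Matrix.sub_apply, Matrix.smul_apply, smul_eq_mul] at h1 ⊢
  linear_combination (2 + p) * w / 2 * h1 - (2 + p) * q / 2 * E i j * w_mul_w +
    (-(2 + p) * p * E i j) * q_mul_q - (1 + p) * E i j * p_mul_p +
    w / 2 * ((1 : Matrix X₁ X₁ ℂ) i j - G₁ i j) * p_mul_p

theorem projTwo_mul_g : projTwo C G₁ D * G₁ = -projTwo C G₁ D := by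
  rw [projTwo, Matrix.smul_mul, Matrix.sub_mul, Matrix.sub_mul, h.g₁, Matrix.one_mul,
    Matrix.mul_assoc, h.cg, Matrix.mul_neg]
  module

theorem g_mul_projTwo : G₁ * projTwo C G₁ D = -projTwo C G₁ D := by
  rw [projTwo, Matrix.mul_smul, Matrix.mul_sub, Matrix.mul_sub, h.g₁, Matrix.mul_one,
    ← Matrix.mul_assoc, h.gd, Matrix.neg_mul]
  module

theorem projTwo_mul_d : projTwo C G₁ D * D = 0 := by
  rw [projTwo, Matrix.smul_mul, Matrix.sub_mul, Matrix.sub_mul, h.gd, Matrix.one_mul,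
    Matrix.mul_assoc, h.cd, Matrix.mul_sub, h.dg, Matrix.mul_one]
  module

theorem c_mul_projTwo : C * projTwo C G₁ D = 0 := by
  rw [projTwo, Matrix.mul_smul, Matrix.mul_sub, Matrix.mul_sub, h.cg, Matrix.mul_one,
    ← Matrix.mul_assoc, h.cd, Matrix.sub_mul, h.gc, Matrix.one_mul]
  module

theorem projTwo_mul_e : projTwo C G₁ D * E = ((1 + p) * w) • projTwo C G₁ D := by
  conv_lhs => rw [h.e_eq]
  rw [Matrix.mul_sub, Matrix.mul_smul, Matrix.mul_smul, ← Matrix.mul_assoc, h.projTwo_mul_d,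
    Matrix.zero_mul, Matrix.mul_sub, h.projTwo_mul_g, Matrix.mul_one]
  module

theorem e_mul_projTwo : E * projTwo C G₁ D = ((1 + p) * w) • projTwo C G₁ D := by
  conv_lhs => rw [h.e_eq]
  rw [Matrix.sub_mul, Matrix.smul_mul, Matrix.smul_mul, Matrix.mul_assoc, h.c_mul_projTwo,
    Matrix.mul_zero, Matrix.sub_mul, h.g_mul_projTwo, Matrix.one_mul]
  module

theorem projTwo_mul_self : projTwo C G₁ D * projTwo C G₁ D = projTwo C G₁ D := by
  conv_lhs => enter [2]; rw [projTwo]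
  rw [Matrix.mul_smul, Matrix.mul_sub, Matrix.mul_sub, ← Matrix.mul_assoc, h.projTwo_mul_d,
    h.projTwo_mul_g, Matrix.zero_mul, Matrix.mul_one]
  module

end IsAction

end Projections

end FibMat

/-! ### The four simple modules and the decomposition of a module -/

namespace Fib

attribute [local instance] monObjTwoPlusTau comonObjTwoPlusTau
  bimonObjTwoPlusTau hopfObjTwoPlusTau

open FibMat ModTensor

/-- The four simple modules. -/
def simpleMod : Fin 4 → Mod Fib twoPlusTau
  | 0 => modOf isAction_zero
  | 1 => modOf isAction_one
  | 2 => modOf isAction_two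
  | 3 => modOf isAction_three

theorem mod_hom_ext {M N : Mod Fib twoPlusTau} {f g : M ⟶ N} (h₀ : f.hom.one = g.hom.one)
    (h₁ : f.hom.tau = g.hom.tau) : f = g := Mod.hom_ext _ _ (hom_ext h₀ h₁)

theorem actOne_trivial : actOne (1 : Matrix Unit Unit ℂ) (0 : Matrix Unit Empty ℂ) =
    E0 * runit0 (Fin 2) Unit := by
  refine ext_act fun v i => ?_
  simp [← Matrix.mulVec_mulVec, actOne_act, unit_act, hopf_act]

theorem isModuleWithAction_zero : IsModuleWithAction (simpleMod 0) action0 :=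
  ⟨_, by
    rw [action0, hopfCounit_eq]
    exact hom_ext actOne_trivial (funext fun i => i.elim), rfl⟩

theorem isModuleWithAction_one : IsModuleWithAction (simpleMod 1) action1 :=
  ⟨_, by
    change Hom.mk (actOne 1 0) (actTau 1 0 0) = action1
    refine hom_ext (funext fun i => i.elim) ?_
    ext i (⟨k, j⟩ | ⟨k, j⟩ | ⟨k, j⟩)
    · fin_cases k <;> rfl
    · rfl
    · rfl, rfl⟩

theorem isModuleWithAction_two : IsModuleWithAction (simpleMod 2) action2 :=
  ⟨_, by
    change Hom.mk (actOne 1 0) (actTau (-1) 0 (((1 + p) * w) • 1)) = action2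
    refine hom_ext (funext fun i => i.elim) ?_
    ext i (⟨k, j⟩ | ⟨k, j⟩ | ⟨k, j⟩)
    · fin_cases k <;> rfl
    · rfl
    · change ((1 + p) * w) * 1 = _
      rw [mul_one, ← action2_coeff_eq]; rfl, rfl⟩

theorem isModuleWithAction_three : IsModuleWithAction (simpleMod 3) action3 :=
  ⟨_, by
    change Hom.mk (actOne (-1) (1 : Matrix Unit Unit ℂ))
      (actTau (-1) ((2 : ℂ) • (1 : Matrix Unit Unit ℂ)) (-w • 1)) = action3
    refine hom_ext ?_ ?_
    · ext i (⟨k, j⟩ | ⟨k, j⟩)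
      · fin_cases k <;> rfl
      · rfl
    · ext i (⟨k, j⟩ | ⟨k, j⟩ | ⟨k, j⟩)
      · fin_cases k <;> rfl
      · exact mul_one 2
      · change -w * 1 = _
        rw [mul_one, ← action3_coeff_eq]; rfl, rfl⟩

theorem eq_zero_of_mul_eq {f : Matrix Unit Unit ℂ} (A B : Matrix Unit Unit ℂ)
    (h : f * A = B * f) (hAB : A () () ≠ B () ()) : f = 0 := by
  ext ⟨⟩ ⟨⟩
  have h1 := congrFun₂ h () ()
  simp only [Matrix.mul_apply, Finset.univ_unique, PUnit.default_eq_unit,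
    Finset.sum_singleton] at h1
  have h2 : (A () () - B () ()) * f () () = 0 := by linear_combination h1
  exact (mul_eq_zero.1 h2).resolve_left (sub_ne_zero.2 hAB)

theorem two_add_p_mul_w_ne : (1 + p) * w ≠ -w := fun h => by
  have h3 := p_mul_p
  have h1 : (2 + p) * w = 0 := by linear_combination h
  have h2 := (mul_eq_zero.1 h1).resolve_right w_ne
  rw [show p = -2 by linear_combination h2] at h3
  norm_num at h3

/-- The modules are told apart by their underlying objects, by the sign of the second copy of 𝟏,
and, for M₂ against M₃, by the scalars (1 + p) w and -w of τ on τ. -/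
theorem simpleMod_hom_eq_zero {i j : Fin 4} (hij : i ≠ j) (f : simpleMod i ⟶ simpleMod j) :
    f = 0 := by
  obtain ⟨h1, h2, -, -, h3⟩ := modHom_commute f
  have n1 : (1 : Matrix Unit Unit ℂ) () () ≠ (-1 : Matrix Unit Unit ℂ) () () := by norm_num
  have n2 : (((1 + p) * w) • 1 : Matrix Unit Unit ℂ) () () ≠
      (-w • 1 : Matrix Unit Unit ℂ) () () := by
    simpa using two_add_p_mul_w_ne
  fin_cases i <;> fin_cases j <;> first | exact (hij rfl).elim | skip
  · exact mod_hom_ext (funext fun i => i.elim) (funext fun _ => funext fun j => j.elim)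
  · exact mod_hom_ext (funext fun i => i.elim) (funext fun _ => funext fun j => j.elim)
  · exact mod_hom_ext (eq_zero_of_mul_eq _ _ h1 n1) (funext fun _ => funext fun j => j.elim)
  · exact mod_hom_ext (funext fun _ => funext fun j => j.elim) (funext fun i => i.elim)
  · exact mod_hom_ext (funext fun i => i.elim) (eq_zero_of_mul_eq _ _ h2 n1)
  · exact mod_hom_ext (funext fun _ => funext fun j => j.elim) (eq_zero_of_mul_eq _ _ h2 n1)
  · exact mod_hom_ext (funext fun _ => funext fun j => j.elim) (funext fun i => i.elim)
  · exact mod_hom_ext (funext fun i => i.elim) (eq_zero_of_mul_eq _ _ h2 n1.symm)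
  · exact mod_hom_ext (funext fun _ => funext fun j => j.elim) (eq_zero_of_mul_eq _ _ h3 n2)
  · exact mod_hom_ext (eq_zero_of_mul_eq _ _ h1 n1.symm) (funext fun i => i.elim)
  · exact mod_hom_ext (funext fun i => i.elim) (eq_zero_of_mul_eq _ _ h2 n1.symm)
  · exact mod_hom_ext (funext fun i => i.elim) (eq_zero_of_mul_eq _ _ h3 n2.symm)

theorem eq_smul_one (f : Matrix Unit Unit ℂ) : f = f () () • (1 : Matrix Unit Unit ℂ) := by
  ext
  simp

theorem simpleMod_hom_eq_smul (i : Fin 4) (f : simpleMod i ⟶ simpleMod i) :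
    ∃ c : ℂ, f = c • 𝟙 _ := by
  obtain ⟨-, -, h, -, -⟩ := modHom_commute f
  fin_cases i
  · exact ⟨f.hom.one () (), mod_hom_ext (eq_smul_one f.hom.one) (funext fun i => i.elim)⟩
  · exact ⟨f.hom.tau () (), mod_hom_ext (funext fun i => i.elim) (eq_smul_one f.hom.tau)⟩
  · exact ⟨f.hom.tau () (), mod_hom_ext (funext fun i => i.elim) (eq_smul_one f.hom.tau)⟩
  -- On M₃ the action of τ from τ to 𝟏 is the identity matrix, which ties the two scalars of an
  -- endomorphism together.
  · have h' : (f.hom.one : Matrix Unit Unit ℂ) = f.hom.tau :=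
      (Matrix.mul_one (f.hom.one : Matrix Unit Unit ℂ)).symm.trans
        (h.trans (Matrix.one_mul (f.hom.tau : Matrix Unit Unit ℂ)))
    exact ⟨f.hom.one () (), mod_hom_ext (eq_smul_one f.hom.one)
      (h'.symm.trans (eq_smul_one f.hom.one))⟩

theorem simpleMod_id_ne_zero (i : Fin 4) : 𝟙 (simpleMod i) ≠ 0 := fun h => by
  have h0 := congrArg (fun f => f.hom.one) h
  have h1 := congrArg (fun f => f.hom.tau) h
  fin_cases i
  · exact one_ne_zero (congrFun₂ h0 () ())
  · exact one_ne_zero (congrFun₂ h1 () ())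
  · exact one_ne_zero (congrFun₂ h1 () ())
  · exact one_ne_zero (congrFun₂ h1 () ())

theorem simpleMod_isIso {i j : Fin 4} (f : simpleMod i ⟶ simpleMod j) (hf : f ≠ 0) : IsIso f := by
  by_cases hij : i = j
  · subst hij
    obtain ⟨c, rfl⟩ := simpleMod_hom_eq_smul i f
    have hc : c ≠ 0 := fun hc => hf (by rw [hc, zero_smul])
    exact ⟨c⁻¹ • 𝟙 _, by simp [hc], by simp [hc]⟩
  · exact (hf (simpleMod_hom_eq_zero hij f)).elim

section Decomposition

variable (M : Mod Fib twoPlusTau)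

/-- A row vector fixed by the action of the second copy of `𝟏`, as a morphism to `M₀`. -/
def toZero (f : Matrix Unit M.X.one ℂ) (h₁ : f * modG₀ M = f) (h₂ : f * modC M = 0) :
    M ⟶ simpleMod 0 :=
  modHom (N := simpleMod 0) f 0 (h₁.trans (Matrix.one_mul f).symm) (funext fun i => i.elim)
    (h₂.trans (Matrix.mul_zero _).symm) (funext fun i => i.elim) (funext fun i => i.elim)

/-- A column vector fixed by the action of the second copy of `𝟏`, as a morphism from `M₀`. -/
def fromZero (f : Matrix M.X.one Unit ℂ) (h₁ : modG₀ M * f = f) (h₂ : modD M * f = 0) :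
    simpleMod 0 ⟶ M :=
  modHom (M := simpleMod 0) f 0 ((Matrix.mul_one f).trans h₁.symm)
    (funext fun _ => funext fun j => j.elim) (funext fun _ => funext fun j => j.elim)
    ((Matrix.zero_mul _).trans h₂.symm) (funext fun _ => funext fun j => j.elim)

/-- A row vector fixed by the action of the second copy of `𝟏`, as a morphism to `M₁`. -/
def toOne (f : Matrix Unit M.X.tau ℂ) (h₁ : f * modG₁ M = f) (h₂ : f * modD M = 0)
    (h₃ : f * modE M = 0) : M ⟶ simpleMod 1 :=
  modHom (N := simpleMod 1) 0 f (funext fun i => i.elim) (h₁.trans (Matrix.one_mul f).symm)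
    (funext fun i => i.elim) (h₂.trans (Matrix.mul_zero _).symm)
    (h₃.trans (Matrix.zero_mul _).symm)

/-- A column vector fixed by the action of the second copy of `𝟏`, as a morphism from `M₁`. -/
def fromOne (f : Matrix M.X.tau Unit ℂ) (h₁ : modG₁ M * f = f) (h₂ : modC M * f = 0)
    (h₃ : modE M * f = 0) : simpleMod 1 ⟶ M :=
  modHom (M := simpleMod 1) 0 f (funext fun _ => funext fun j => j.elim)
    ((Matrix.mul_one f).trans h₁.symm) ((Matrix.zero_mul _).trans h₂.symm)
    (funext fun _ => funext fun j => j.elim) ((Matrix.mul_zero _).trans h₃.symm)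

/-- An eigenvector of the action of `τ`, as a morphism to `M₂`. -/
def toTwo (f : Matrix Unit M.X.tau ℂ) (h₁ : f * modG₁ M = -f) (h₂ : f * modD M = 0)
    (h₃ : f * modE M = ((1 + p) * w) • f) : M ⟶ simpleMod 2 :=
  have a₁ : f * modG₁ M = (-1 : Matrix Unit Unit ℂ) * f := by
    rw [Matrix.neg_mul, Matrix.one_mul, h₁]
  have a₂ : f * modE M = (((1 + p) * w) • 1 : Matrix Unit Unit ℂ) * f := by
    rw [Matrix.smul_mul, Matrix.one_mul, h₃]
  modHom (N := simpleMod 2) 0 f (funext fun i => i.elim) a₁ (funext fun i => i.elim)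
    (h₂.trans (Matrix.mul_zero _).symm) a₂

/-- An eigenvector of the action of `τ`, as a morphism from `M₂`. -/
def fromTwo (f : Matrix M.X.tau Unit ℂ) (h₁ : modG₁ M * f = -f) (h₂ : modC M * f = 0)
    (h₃ : modE M * f = ((1 + p) * w) • f) : simpleMod 2 ⟶ M :=
  have a₁ : f * (-1 : Matrix Unit Unit ℂ) = modG₁ M * f := by
    rw [Matrix.mul_neg, Matrix.mul_one, h₁]
  have a₂ : f * (((1 + p) * w) • 1 : Matrix Unit Unit ℂ) = modE M * f := by
    rw [Matrix.mul_smul, Matrix.mul_one, h₃]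
  modHom (M := simpleMod 2) 0 f (funext fun _ => funext fun j => j.elim) a₁
    ((Matrix.zero_mul _).trans h₂.symm) (funext fun _ => funext fun j => j.elim) a₂

/-- A row vector negated by the action of the second copy of `𝟏`, as a morphism to `M₃`. -/
def toThree (f : Matrix Unit M.X.one ℂ) (h₁ : f * modG₀ M = -f) : M ⟶ simpleMod 3 :=
  have a₁ : f * modG₀ M = (-1 : Matrix Unit Unit ℂ) * f := by
    rw [h₁, Matrix.neg_mul, Matrix.one_mul]
  have a₂ : (f * modC M) * modG₁ M = (-1 : Matrix Unit Unit ℂ) * (f * modC M) := by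
    rw [Matrix.mul_assoc, (isAction M).cg, Matrix.neg_mul, Matrix.one_mul, Matrix.mul_neg]
  have a₃ : (f * modC M) * modD M = ((2 : ℂ) • 1 : Matrix Unit Unit ℂ) * f := by
    rw [Matrix.smul_mul, Matrix.one_mul, Matrix.mul_assoc, (isAction M).cd, Matrix.mul_sub, h₁,
      Matrix.mul_one]
    module
  have a₄ : (f * modC M) * modE M = (-w • 1 : Matrix Unit Unit ℂ) * (f * modC M) := by
    rw [Matrix.smul_mul, Matrix.one_mul, Matrix.mul_assoc, (isAction M).ce, Matrix.mul_smul]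
  -- The τ-component is forced by C = 1 in M₃.
  modHom (N := simpleMod 3) f (f * modC M) a₁ a₂ (Matrix.one_mul (f * modC M)).symm a₃ a₄

/-- A column vector negated by the action of the second copy of `𝟏`, as a morphism from `M₃`. -/
def fromThree (f : Matrix M.X.one Unit ℂ) (h₁ : modG₀ M * f = -f) : simpleMod 3 ⟶ M :=
  have a₁ : f * (-1 : Matrix Unit Unit ℂ) = modG₀ M * f := by
    rw [h₁, Matrix.mul_neg, Matrix.mul_one]
  have a₂ : ((1 / 2 : ℂ) • (modD M * f)) * (-1 : Matrix Unit Unit ℂ) =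
      modG₁ M * ((1 / 2 : ℂ) • (modD M * f)) := by
    rw [Matrix.mul_smul, ← Matrix.mul_assoc, (isAction M).gd, Matrix.mul_neg, Matrix.mul_one,
      Matrix.neg_mul, smul_neg]
  -- C D = 1 - G₀ is 2 on the (-1)-eigenspace of G₀, hence the factor 1/2.
  have a₃ : f * (1 : Matrix Unit Unit ℂ) = modC M * ((1 / 2 : ℂ) • (modD M * f)) := by
    rw [Matrix.mul_smul, ← Matrix.mul_assoc, (isAction M).cd, Matrix.sub_mul, h₁,
      Matrix.mul_one, Matrix.one_mul]
    module
  have a₄ : ((1 / 2 : ℂ) • (modD M * f)) * ((2 : ℂ) • 1 : Matrix Unit Unit ℂ) = modD M * f := by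
    rw [Matrix.mul_smul, Matrix.mul_one]
    module
  have a₅ : ((1 / 2 : ℂ) • (modD M * f)) * (-w • 1 : Matrix Unit Unit ℂ) =
      modE M * ((1 / 2 : ℂ) • (modD M * f)) := by
    rw [Matrix.mul_smul, Matrix.mul_one, Matrix.mul_smul, ← Matrix.mul_assoc, (isAction M).ed,
      Matrix.smul_mul]
    module
  modHom (M := simpleMod 3) f ((1 / 2 : ℂ) • (modD M * f)) a₁ a₂ a₃ a₄ a₅

theorem mod_sum_one {M N : Mod Fib twoPlusTau} {J : Type} (s : Finset J) (f : J → (M ⟶ N)) :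
    (∑ i ∈ s, f i).hom.one = ∑ i ∈ s, (f i).hom.one :=
  map_sum (AddMonoidHom.mk' (fun g : M ⟶ N => g.hom.one) fun _ _ => rfl) f s

theorem mod_sum_tau {M N : Mod Fib twoPlusTau} {J : Type} (s : Finset J) (f : J → (M ⟶ N)) :
    (∑ i ∈ s, f i).hom.tau = ∑ i ∈ s, (f i).hom.tau :=
  map_sum (AddMonoidHom.mk' (fun g : M ⟶ N => g.hom.tau) fun _ _ => rfl) f s

variable {M}

theorem toZero_fromZero {f g} (h₁ h₂ h₃ h₄) :
    (toZero M f h₁ h₂ ≫ fromZero M g h₃ h₄).hom = ⟨g * f, 0⟩ :=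
  hom_ext rfl (Matrix.mul_zero (0 : Matrix M.X.tau Empty ℂ))

theorem toOne_fromOne {f g} (h₁ h₂ h₃ h₄ h₅ h₆) :
    (toOne M f h₁ h₂ h₃ ≫ fromOne M g h₄ h₅ h₆).hom = ⟨0, g * f⟩ :=
  hom_ext (Matrix.mul_zero (0 : Matrix M.X.one Empty ℂ)) rfl

theorem toTwo_fromTwo {f g} (h₁ h₂ h₃ h₄ h₅ h₆) :
    (toTwo M f h₁ h₂ h₃ ≫ fromTwo M g h₄ h₅ h₆).hom = ⟨0, g * f⟩ :=
  hom_ext (Matrix.mul_zero (0 : Matrix M.X.one Empty ℂ)) rfl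

theorem toThree_fromThree {f g} (h₁ h₂) : (toThree M f h₁ ≫ fromThree M g h₂).hom =
    ⟨g * f, ((1 / 2 : ℂ) • (modD M * g)) * (f * modC M)⟩ := rfl

variable (M)

/-- On the copies of 𝟏 the identity is (1 + G₀)/2 + (1 - G₀)/2, belonging to M₀ and M₃. On the
copies of τ it is (1 + G₁)/2 + (1 - G₁ - D C)/2 + D C/2, belonging to M₁, M₂ and M₃. -/
theorem exists_factorsThrough : ∃ n, FactorsThrough simpleMod M n := by
  have h := isAction M
  have h₀ := half_add_mul_self h.g₀
  have h₁ := half_add_mul_self h.g₁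
  have h₂ := h.projTwo_mul_self
  have h₃ := half_sub_mul_self h.g₀
  have a1 : ((1 / 2 : ℂ) • (1 + modG₀ M)) * modG₀ M = (1 / 2 : ℂ) • (1 + modG₀ M) := by
    rw [Matrix.smul_mul, Matrix.add_mul, h.g₀, Matrix.one_mul, add_comm]
  have a2 : ((1 / 2 : ℂ) • (1 + modG₀ M)) * modC M = 0 := by
    rw [Matrix.smul_mul, Matrix.add_mul, h.gc, Matrix.one_mul, add_neg_cancel, smul_zero]
  have a3 : modG₀ M * ((1 / 2 : ℂ) • (1 + modG₀ M)) = (1 / 2 : ℂ) • (1 + modG₀ M) := by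
    rw [Matrix.mul_smul, Matrix.mul_add, h.g₀, Matrix.mul_one, add_comm]
  have a4 : modD M * ((1 / 2 : ℂ) • (1 + modG₀ M)) = 0 := by
    rw [Matrix.mul_smul, Matrix.mul_add, h.dg, Matrix.mul_one, add_neg_cancel, smul_zero]
  have b1 : ((1 / 2 : ℂ) • (1 + modG₁ M)) * modG₁ M = (1 / 2 : ℂ) • (1 + modG₁ M) := by
    rw [Matrix.smul_mul, Matrix.add_mul, h.g₁, Matrix.one_mul, add_comm]
  have b2 : ((1 / 2 : ℂ) • (1 + modG₁ M)) * modD M = 0 := by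
    rw [Matrix.smul_mul, Matrix.add_mul, h.gd, Matrix.one_mul, add_neg_cancel, smul_zero]
  have b3 : ((1 / 2 : ℂ) • (1 + modG₁ M)) * modE M = 0 := by
    rw [Matrix.smul_mul, Matrix.add_mul, h.ge, Matrix.one_mul, add_neg_cancel, smul_zero]
  have b4 : modG₁ M * ((1 / 2 : ℂ) • (1 + modG₁ M)) = (1 / 2 : ℂ) • (1 + modG₁ M) := by
    rw [Matrix.mul_smul, Matrix.mul_add, h.g₁, Matrix.mul_one, add_comm]
  have b5 : modC M * ((1 / 2 : ℂ) • (1 + modG₁ M)) = 0 := by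
    rw [Matrix.mul_smul, Matrix.mul_add, h.cg, Matrix.mul_one, add_neg_cancel, smul_zero]
  have b6 : modE M * ((1 / 2 : ℂ) • (1 + modG₁ M)) = 0 := by
    rw [Matrix.mul_smul, Matrix.mul_add, h.eg, Matrix.mul_one, add_neg_cancel, smul_zero]
  have c1 : ((1 / 2 : ℂ) • (1 - modG₀ M)) * modG₀ M = -((1 / 2 : ℂ) • (1 - modG₀ M)) := by
    rw [Matrix.smul_mul, Matrix.sub_mul, h.g₀, Matrix.one_mul]
    module
  have c2 : modG₀ M * ((1 / 2 : ℂ) • (1 - modG₀ M)) = -((1 / 2 : ℂ) • (1 - modG₀ M)) := by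
    rw [Matrix.mul_smul, Matrix.mul_sub, h.g₀, Matrix.mul_one]
    module
  let J := M.X.one ⊕ M.X.tau ⊕ M.X.tau ⊕ M.X.one
  let c : J → Fin 4 :=
    Sum.elim (fun _ => 0) (Sum.elim (fun _ => 1) (Sum.elim (fun _ => 2) fun _ => 3))
  -- An idempotent P = P P is the sum over k of column k times row k; rows give maps out of `M`,
  -- columns maps into it, and each inherits the eigenvalue equations of P.
  let π : ∀ k, M ⟶ simpleMod (c k) := fun
    | .inl k => toZero M (rowMat _ k) (congrArg (rowMat · k) a1) (congrArg (rowMat · k) a2)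
    | .inr (.inl k) => toOne M (rowMat _ k) (congrArg (rowMat · k) b1)
        (congrArg (rowMat · k) b2) (congrArg (rowMat · k) b3)
    | .inr (.inr (.inl k)) => toTwo M (rowMat _ k) (congrArg (rowMat · k) h.projTwo_mul_g)
        (congrArg (rowMat · k) h.projTwo_mul_d) (congrArg (rowMat · k) h.projTwo_mul_e)
    | .inr (.inr (.inr k)) => toThree M (rowMat _ k) (congrArg (rowMat · k) c1)
  let s : ∀ k, simpleMod (c k) ⟶ M := fun
    | .inl k => fromZero M (colMat _ k) (congrArg (colMat · k) a3) (congrArg (colMat · k) a4)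
    | .inr (.inl k) => fromOne M (colMat _ k) (congrArg (colMat · k) b4)
        (congrArg (colMat · k) b5) (congrArg (colMat · k) b6)
    | .inr (.inr (.inl k)) => fromTwo M (colMat _ k) (congrArg (colMat · k) h.g_mul_projTwo)
        (congrArg (colMat · k) h.c_mul_projTwo) (congrArg (colMat · k) h.e_mul_projTwo)
    | .inr (.inr (.inr k)) => fromThree M (colMat _ k) (congrArg (colMat · k) c2)
  refine FactorsThrough.of_sum c π s (mod_hom_ext ?_ ?_)
  · rw [mod_sum_one, Fintype.sum_sum_type, Fintype.sum_sum_type, Fintype.sum_sum_type]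
    have e0 : ∑ k : M.X.one, (π (.inl k) ≫ s (.inl k)).hom.one = _ :=
      (Finset.sum_congr rfl fun k _ => congrArg Hom.one (toZero_fromZero _ _ _ _)).trans
        ((sum_colMat_mul_rowMat _ _).trans h₀)
    have e1 : ∑ k : M.X.tau, (π (.inr (.inl k)) ≫ s (.inr (.inl k))).hom.one = 0 :=
      Finset.sum_eq_zero fun k _ => congrArg Hom.one (toOne_fromOne _ _ _ _ _ _)
    have e2 : ∑ k : M.X.tau, (π (.inr (.inr (.inl k))) ≫ s (.inr (.inr (.inl k)))).hom.one = 0 :=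
      Finset.sum_eq_zero fun k _ => congrArg Hom.one (toTwo_fromTwo _ _ _ _ _ _)
    have e3 : ∑ k : M.X.one, (π (.inr (.inr (.inr k))) ≫ s (.inr (.inr (.inr k)))).hom.one = _ :=
      (Finset.sum_congr rfl fun k _ => congrArg Hom.one (toThree_fromThree _ _)).trans
        ((sum_colMat_mul_rowMat _ _).trans h₃)
    rw [e0, e1, e2, e3]
    change _ = (1 : Matrix M.X.one M.X.one ℂ)
    module
  · rw [mod_sum_tau, Fintype.sum_sum_type, Fintype.sum_sum_type, Fintype.sum_sum_type]
    have e0 : ∑ k : M.X.one, (π (.inl k) ≫ s (.inl k)).hom.tau = 0 :=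
      Finset.sum_eq_zero fun k _ => congrArg Hom.tau (toZero_fromZero _ _ _ _)
    have e1 : ∑ k : M.X.tau, (π (.inr (.inl k)) ≫ s (.inr (.inl k))).hom.tau = _ :=
      (Finset.sum_congr rfl fun k _ => congrArg Hom.tau (toOne_fromOne _ _ _ _ _ _)).trans
        ((sum_colMat_mul_rowMat _ _).trans h₁)
    have e2 : ∑ k : M.X.tau, (π (.inr (.inr (.inl k))) ≫ s (.inr (.inr (.inl k)))).hom.tau = _ :=
      (Finset.sum_congr rfl fun k _ => congrArg Hom.tau (toTwo_fromTwo _ _ _ _ _ _)).trans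
        ((sum_colMat_mul_rowMat _ _).trans h₂)
    have e3 : ∑ k : M.X.one, (π (.inr (.inr (.inr k))) ≫ s (.inr (.inr (.inr k)))).hom.tau = _ :=
      -- The τ-parts of the M₃ pieces add up to ½ D P P C with P = (1 - G₀)/2, and D P = D, P C = C
      -- reduce this to ½ D C.
      (Finset.sum_congr rfl fun k _ => congrArg Hom.tau (toThree_fromThree _ _)).trans <|
        sum_smul_mul_colMat_mul_rowMat_mul (1 / 2) (modD M) _ _ (modC M)
    have e4 : modD M * ((1 / 2 : ℂ) • (1 - modG₀ M)) = modD M := by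
      rw [Matrix.mul_smul, Matrix.mul_sub, h.dg, Matrix.mul_one]
      module
    have e5 : ((1 / 2 : ℂ) • (1 - modG₀ M)) * modC M = modC M := by
      rw [Matrix.smul_mul, Matrix.sub_mul, h.gc, Matrix.one_mul]
      module
    rw [e0, e1, e2, e3, e4, e5, Matrix.smul_mul, projTwo]
    change _ = (1 : Matrix M.X.tau M.X.tau ℂ)
    module

end Decomposition

theorem everyObjectSemisimple_mod : EveryObjectSemisimple (Mod Fib twoPlusTau) :=
  everyObjectSemisimple simpleMod_isIso simpleMod_id_ne_zero exists_factorsThrough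

theorem isEmpty_simpleMod_iso {i j : Fin 4} (hij : i ≠ j) :
    IsEmpty (simpleMod i ≅ simpleMod j) :=
  ⟨fun e => simpleMod_id_ne_zero i (by
    rw [← e.hom_inv_id, simpleMod_hom_eq_zero hij e.hom, Limits.zero_comp])⟩

theorem exists_simple_modules : ∃ M₀ M₁ M₂ M₃ : Mod Fib twoPlusTau,
    (IsModuleWithAction M₀ action0 ∧ IsModuleWithAction M₁ action1 ∧
      IsModuleWithAction M₂ action2 ∧ IsModuleWithAction M₃ action3) ∧
    (Simple M₀ ∧ Simple M₁ ∧ Simple M₂ ∧ Simple M₃) ∧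
    [M₀, M₁, M₂, M₃].Pairwise (fun M N => IsEmpty (M ≅ N)) ∧
    ∀ M : Mod Fib twoPlusTau, Simple M → ∃ N ∈ [M₀, M₁, M₂, M₃], Nonempty (M ≅ N) := by
  have hs := simple_of_bicones simpleMod_isIso simpleMod_id_ne_zero exists_factorsThrough
  refine ⟨simpleMod 0, simpleMod 1, simpleMod 2, simpleMod 3,
    ⟨isModuleWithAction_zero, isModuleWithAction_one, isModuleWithAction_two,
      isModuleWithAction_three⟩, ⟨hs 0, hs 1, hs 2, hs 3⟩, ?_, fun M hM => ?_⟩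
  · have : [0, 1, 2, 3].Pairwise fun i j : Fin 4 => i ≠ j := by decide
    exact List.Pairwise.map simpleMod (fun _ _ => isEmpty_simpleMod_iso) this
  · obtain ⟨i, hi⟩ := exists_iso_of_simple simpleMod_isIso exists_factorsThrough M
    exact ⟨simpleMod i, by fin_cases i <;> simp, hi⟩

end Fib

end

theorem mainTheorem5 :
    ∃ _ : HopfObj Fib.twoPlusTau,
      -- the structure maps
      (MonObj.mul = Fib.hopfMul ∧ MonObj.one = Fib.hopfUnit ∧
        ComonObj.comul = Fib.hopfComul ∧ ComonObj.counit = Fib.hopfCounit ∧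
        HopfObj.antipode = Fib.hopfAntipode) ∧
      -- uniqueness up to isomorphism
      (∀ (B : Fib) [HopfObj B], Nonempty (B ≅ Fib.twoPlusTau) →
        ∃ e : B ≅ Fib.twoPlusTau, IsBimonHom e.hom ∧
          HopfObj.antipode ≫ e.hom = e.hom ≫ HopfObj.antipode) ∧
      ¬ IsCommMonObj Fib.twoPlusTau ∧
      ¬ IsCommComonObj Fib.twoPlusTau ∧
      -- semisimplicity
      (∃ Λ : 𝟙_ Fib ⟶ Fib.twoPlusTau, IsTwoSidedIntegral Λ ∧ Λ ≫ ComonObj.counit ≠ 0) ∧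
      EveryObjectSemisimple (Mod Fib Fib.twoPlusTau) ∧
      -- the order of the antipode
      orderOf (G := End Fib.twoPlusTau) HopfObj.antipode = 10 ∧
      -- the irreducible modules
      (∃ M₀ M₁ M₂ M₃ : Mod Fib Fib.twoPlusTau,
        (IsModuleWithAction M₀ Fib.action0 ∧ IsModuleWithAction M₁ Fib.action1 ∧
          IsModuleWithAction M₂ Fib.action2 ∧ IsModuleWithAction M₃ Fib.action3) ∧
        (Simple M₀ ∧ Simple M₁ ∧ Simple M₂ ∧ Simple M₃) ∧
        [M₀, M₁, M₂, M₃].Pairwise (fun M N => IsEmpty (M ≅ N)) ∧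
        ∀ M : Mod Fib Fib.twoPlusTau, Simple M → ∃ N ∈ [M₀, M₁, M₂, M₃], Nonempty (M ≅ N)) ∧
      -- the category of modules
      (∃ E : Mod Fib Fib.twoPlusTau ≌ Center Fib,
        Nonempty E.functor.Monoidal ∧ E.functor.Additive ∧ E.functor.Linear ℂ) := by
  refine ⟨Fib.hopfObjTwoPlusTau, ⟨rfl, rfl, rfl, rfl, rfl⟩, fun B _ h => Fib.exists_bimonIso B h,
    Fib.not_isCommMonObj, Fib.not_isCommComonObj, Fib.exists_integral, ?_, Fib.orderOf_antipode,
    ?_, ?_⟩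
  · exact Fib.everyObjectSemisimple_mod
  · exact Fib.exists_simple_modules
  · exact Fib.exists_equivalence_center
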